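/- Let $d\in\{2,3\}$, let $\Omega\subset\mathbb R^d$ be a bounded (open, connected) domain with Lipschitz polygonal/polyhedral boundary, and let $\mathcal T_h$ be a conforming partition of $\overline\Omega$ into finitely many triangles ($d=2$) or tetrahedra ($d=3$). Let $(\cdot,\cdot)$ and $(\cdot,\cdot)_T$ be the $L^2$ inner products on $\Omega$ and on $T\in\mathcal T_h$, and put $$V_h^1=\{v\in[H^1_0(\Omega)]^d: v|_T\in[P_1(T)]^d\ \forall T\in\mathcal T_h\},\qquad RT0=\{v\in H_0(\operatorname{div};\Omega): v|_T\in[P_0(T)]^d\oplus xP_0(T)\ \forall T\in\mathcal T_h\},$$ $$W_h=\Big\{q\in L^2(\Omega): \int_\Omega q=0,\ q|_T\in P_0(T)\ \forall T\in\mathcal T_h\Big\},\qquad V_h=V_h^1\oplus RT0,$$ and write $v=v^1+v^R$ for the decomposition of $v\in V_h$ with $v^1\in V_h^1$, $v^R\in RT0$. Let $\mathcal E^0$ be the set of interior faces of $\mathcal T_h$ (those shared by two elements), and for $e\in\mathcal E^0$ let $\Phi_e\in RT0$ be the standard basis function, supported on the two elements sharing $e$, with unit flux through $e$ and zero normal component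 on every other face; write $v^R=\sum_{e\in\mathcal E^0}v_e\Phi_e$. Let $h_T$, $h_e$ be the diameters of $T$, $e$, and let $\mathcal J$ be either $$\mathcal J^0(u^R,v^R)=\sum_{T\in\mathcal T_h}\alpha_T h_T^{-2}(u^R,v^R)_T\quad\text{or}\quad \mathcal J^D(u^R,v^R)=\sum_{e\in\mathcal E^0}\alpha_e h_e^{-2}u_ev_e(\Phi_e,\Phi_e),$$ with arbitrary parameters $\alpha_T>0$, respectively $\alpha_e>0$. Put $a_h(u,v)=\sum_{T\in\mathcal T_h}(\nabla u,\nabla v)_T+\mathcal J(u^R,v^R)$ and $b(v,q)=(\nabla\cdot v,q)$. For $\nu>0$ and $f\in[L^2(\Omega)]^d$ consider the discrete Stokes problem: find $(u_h,p_h)\in V_h\times W_h$ such that $$\nu a_h(u_h,v_h)-b(v_h,p_h)=(f,v_h)\quad\forall v_h\in V_h,\qquad b(u_h,q_h)=0\quad\forall q_h\in W_h.$$ Then the problem has exactly one solution for every $f\in[L^2(\Omega)]^d$, and the scheme is pressure-robust: if $(u_h,p_h)$ is the solution for $f$, and $\psi\in H^1(\Omega)$, then the solution for $f+\nabla\psi$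 is $(u_h,\,p_h+P_h\psi)$, where $P_h$ is the $L^2$-orthogonal projection onto $W_h$. -/

import Mathlib

open MeasureTheory Filter Topology
open scoped ContDiff NNReal ENNReal

namespace StokesFEM

/-- The Euclidean space `ℝ^d`. -/
abbrev Vec (d : ℕ) := EuclideanSpace ℝ (Fin d)

/-- The Hilbert space `L²(Ω)`. -/
noncomputable abbrev LTwo {d : ℕ} (Ω : Set (Vec d)) : Type := Lp ℝ 2 (volume.restrict Ω)

/-- The Hilbert space `[L²(Ω)]^d`. -/
noncomputable abbrev LTwoVec {d : ℕ} (Ω : Set (Vec d)) : Type := Lp (Vec d) 2 (volume.restrict Ω)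

section Sobolev

variable {d : ℕ}

/-- `φ ∈ C_c^∞(U)`. -/
def IsTest (U : Set (Vec d)) (φ : Vec d → ℝ) : Prop :=
  ContDiff ℝ ∞ φ ∧ HasCompactSupport φ ∧ tsupport φ ⊆ U

/-- `w ∈ H¹(U)`, with weak gradient `g`. -/
def HasWeakGrad (U : Set (Vec d)) (w : Vec d → ℝ) (g : Vec d → Vec d) : Prop :=
  MemLp w 2 (volume.restrict U) ∧ MemLp g 2 (volume.restrict U) ∧
    ∀ φ, IsTest U φ → ∫ x in U, w x • gradient φ x = -∫ x in U, φ x • g x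

/-- `v ∈ H(div; U)`, with weak divergence `δ`. -/
def HasWeakDiv (U : Set (Vec d)) (v : Vec d → Vec d) (δ : Vec d → ℝ) : Prop :=
  MemLp v 2 (volume.restrict U) ∧ MemLp δ 2 (volume.restrict U) ∧
    ∀ φ, IsTest U φ → ∫ x in U, inner ℝ (v x) (gradient φ x) = -∫ x in U, δ x * φ x

/-- `w ∈ H¹₀(U)`: the closure of `C_c^∞(U)` in the norm of `H¹(U)`. -/
def MemH10 (U : Set (Vec d)) (w : Vec d → ℝ) : Prop :=
  ∃ g, HasWeakGrad U w g ∧ ∃ φ : ℕ → Vec d → ℝ, (∀ n, IsTest U (φ n)) ∧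
    Tendsto (fun n => eLpNorm (w - φ n) 2 (volume.restrict U)) atTop (𝓝 0) ∧
    Tendsto (fun n => eLpNorm (g - gradient (φ n)) 2 (volume.restrict U)) atTop (𝓝 0)

/-- `v ∈ H₀(div; U)`: the normal trace of `v`, that is, the functional
`φ ↦ (v, ∇φ) + (∇·v, φ)` on `H¹(U)`, vanishes. -/
def MemH0Div (U : Set (Vec d)) (v : Vec d → Vec d) : Prop :=
  ∃ δ, HasWeakDiv U v δ ∧ ∀ φ g, HasWeakGrad U φ g →
    ∫ x in U, (inner ℝ (v x) (g x) + δ x * φ x) = 0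

open Classical in
/-- The weak gradient (unique up to null sets) of `w ∈ H¹(U)`. -/
noncomputable def weakGrad (U : Set (Vec d)) (w : Vec d → ℝ) : Vec d → Vec d :=
  if h : ∃ g, HasWeakGrad U w g then h.choose else 0

open Classical in
/-- The weak divergence (unique up to null sets) of `v ∈ H(div; U)`. -/
noncomputable def weakDiv (U : Set (Vec d)) (v : Vec d → Vec d) : Vec d → ℝ :=
  if h : ∃ δ, HasWeakDiv U v δ then h.choose else 0

/-- Near each boundary point, and in suitable orthonormal coordinates (the last axis spanned by the
unit vector `n`), `Ω` is the strict epigraph of a Lipschitz function `γ` of the other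
coordinates. -/
def HasLipschitzBoundary (Ω : Set (Vec d)) : Prop :=
  ∀ x ∈ frontier Ω, ∃ (n : Vec d) (γ : Vec d → ℝ) (K : ℝ≥0), ‖n‖ = 1 ∧ LipschitzWith K γ ∧
    ∃ U ∈ 𝓝 x, ∀ y ∈ U, y ∈ Ω ↔ γ (y - inner ℝ n y • n) < inner ℝ n y

end Sobolev

section Closure

/-! Closure of these spaces under linear operations. -/

variable {d : ℕ} {U : Set (Vec d)}

theorem IsTest.zero : IsTest U (0 : Vec d → ℝ) :=
  ⟨contDiff_const, HasCompactSupport.zero, by simp [tsupport]⟩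

theorem IsTest.add {φ χ : Vec d → ℝ} (h : IsTest U φ) (h' : IsTest U χ) : IsTest U (φ + χ) :=
  ⟨h.1.add h'.1, h.2.1.add h'.2.1, (tsupport_add φ χ).trans (Set.union_subset h.2.2 h'.2.2)⟩

theorem IsTest.smul {φ : Vec d → ℝ} (c : ℝ) (h : IsTest U φ) : IsTest U (c • φ) :=
  ⟨h.1.const_smul c, h.2.1.smul_left (f := fun _ => c),
    (closure_mono (Function.support_const_smul_subset c φ)).trans h.2.2⟩

theorem IsTest.gradient_add {φ χ : Vec d → ℝ} (h : IsTest U φ) (h' : IsTest U χ) :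
    gradient (φ + χ) = gradient φ + gradient χ := by
  funext x
  have h1 := (h.1.differentiable (by simp)) x
  have h2 := (h'.1.differentiable (by simp)) x
  simp [gradient, fderiv_add h1 h2]

theorem IsTest.gradient_smul {φ : Vec d → ℝ} (c : ℝ) (h : IsTest U φ) :
    gradient (c • φ) = c • gradient φ := by
  funext x
  have h1 := (h.1.differentiable (by simp)) x
  simp [gradient, fderiv_const_smul h1]

theorem IsTest.memLp {φ : Vec d → ℝ} (h : IsTest U φ) : MemLp φ 2 (volume.restrict U) :=
  (h.1.continuous.memLp_of_hasCompactSupport h.2.1).restrict _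

theorem IsTest.continuous_gradient {φ : Vec d → ℝ} (h : IsTest U φ) : Continuous (gradient φ) :=
  (InnerProductSpace.toDual ℝ (Vec d)).symm.continuous.comp (h.1.continuous_fderiv (by simp))

theorem IsTest.memLp_gradient {φ : Vec d → ℝ} (h : IsTest U φ) :
    MemLp (gradient φ) 2 (volume.restrict U) := by
  refine (h.continuous_gradient.memLp_of_hasCompactSupport ?_).restrict _
  exact (h.2.1.fderiv (𝕜 := ℝ)).comp_left (g := (InnerProductSpace.toDual ℝ (Vec d)).symm)
    (map_zero _)

theorem HasWeakGrad.congr {w w' : Vec d → ℝ} {g : Vec d → Vec d}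
    (h : HasWeakGrad U w g) (hw : w =ᵐ[volume.restrict U] w') : HasWeakGrad U w' g := by
  refine ⟨(memLp_congr_ae hw).1 h.1, h.2.1, fun φ hφ => ?_⟩
  rw [← h.2.2 φ hφ]
  exact integral_congr_ae (by filter_upwards [hw] with x hx; rw [hx])

theorem HasWeakGrad.zero : HasWeakGrad U 0 0 :=
  ⟨MemLp.zero, MemLp.zero, fun φ _ => by simp⟩

theorem integrable_smul_of_memLp {w : Vec d → ℝ} {g : Vec d → Vec d}
    (hw : MemLp w 2 (volume.restrict U)) (hg : MemLp g 2 (volume.restrict U)) :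
    Integrable (fun x => w x • g x) (volume.restrict U) :=
  memLp_one_iff_integrable.1 (hg.smul hw)

theorem integrable_mul_of_memLp {w z : Vec d → ℝ}
    (hw : MemLp w 2 (volume.restrict U)) (hz : MemLp z 2 (volume.restrict U)) :
    Integrable (fun x => w x * z x) (volume.restrict U) :=
  hw.integrable_mul hz

theorem HasWeakGrad.add {w w' : Vec d → ℝ} {g g' : Vec d → Vec d}
    (h : HasWeakGrad U w g) (h' : HasWeakGrad U w' g') : HasWeakGrad U (w + w') (g + g') := by
  refine ⟨h.1.add h'.1, h.2.1.add h'.2.1, fun φ hφ => ?_⟩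
  simp only [Pi.add_apply, add_smul, smul_add]
  rw [integral_add (integrable_smul_of_memLp h.1 hφ.memLp_gradient)
      (integrable_smul_of_memLp h'.1 hφ.memLp_gradient),
    integral_add (integrable_smul_of_memLp hφ.memLp h.2.1) (integrable_smul_of_memLp hφ.memLp h'.2.1),
    h.2.2 φ hφ, h'.2.2 φ hφ, neg_add]

theorem HasWeakGrad.smul {w : Vec d → ℝ} {g : Vec d → Vec d} (c : ℝ)
    (h : HasWeakGrad U w g) : HasWeakGrad U (c • w) (c • g) := by
  refine ⟨h.1.const_smul c, h.2.1.const_smul c, fun φ hφ => ?_⟩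
  simp only [Pi.smul_apply, smul_assoc, smul_comm (φ _) c]
  rw [integral_smul, integral_smul, h.2.2 φ hφ, smul_neg]

theorem MemH10.congr {w w' : Vec d → ℝ} (h : MemH10 U w) (hw : w =ᵐ[volume.restrict U] w') :
    MemH10 U w' := by
  obtain ⟨g, hg, φ, hφ, h1, h2⟩ := h
  refine ⟨g, hg.congr hw, φ, hφ, ?_, h2⟩
  convert h1 using 2 with n
  exact eLpNorm_congr_ae (hw.symm.sub (ae_eq_refl _))

theorem MemH10.zero : MemH10 U (0 : Vec d → ℝ) := by
  refine ⟨0, HasWeakGrad.zero, fun _ => 0, fun _ => IsTest.zero, ?_, ?_⟩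
  · simp
  · have : gradient (0 : Vec d → ℝ) = 0 := by funext x; simp [gradient]
    simp [this]

theorem MemH10.add {w w' : Vec d → ℝ} (h : MemH10 U w) (h' : MemH10 U w') :
    MemH10 U (w + w') := by
  obtain ⟨g, hg, φ, hφ, h1, h2⟩ := h
  obtain ⟨g', hg', φ', hφ', h1', h2'⟩ := h'
  refine ⟨g + g', hg.add hg', fun n => φ n + φ' n, fun n => (hφ n).add (hφ' n), ?_, ?_⟩
  · refine tendsto_of_tendsto_of_tendsto_of_le_of_le tendsto_const_nhds
      (by simpa using h1.add h1') (fun _ => zero_le) fun n => ?_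
    simp only
    rw [add_sub_add_comm]
    exact eLpNorm_add_le (hg.1.sub (hφ n).memLp).1 (hg'.1.sub (hφ' n).memLp).1 (by norm_num)
  · refine tendsto_of_tendsto_of_tendsto_of_le_of_le tendsto_const_nhds
      (by simpa using h2.add h2') (fun _ => zero_le) fun n => ?_
    simp only
    rw [(hφ n).gradient_add (hφ' n), add_sub_add_comm]
    exact eLpNorm_add_le (hg.2.1.sub (hφ n).memLp_gradient).1
      (hg'.2.1.sub (hφ' n).memLp_gradient).1 (by norm_num)

theorem MemH10.smul {w : Vec d → ℝ} (c : ℝ) (h : MemH10 U w) : MemH10 U (c • w) := by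
  obtain ⟨g, hg, φ, hφ, h1, h2⟩ := h
  refine ⟨c • g, hg.smul c, fun n => c • φ n, fun n => (hφ n).smul c, ?_, ?_⟩
  · simp only [← smul_sub, eLpNorm_const_smul]
    simpa using ENNReal.Tendsto.const_mul h1 (Or.inr (by simp : ‖c‖ₑ ≠ ⊤))
  · simp only [(hφ _).gradient_smul, ← smul_sub, eLpNorm_const_smul]
    simpa using ENNReal.Tendsto.const_mul h2 (Or.inr (by simp : ‖c‖ₑ ≠ ⊤))

theorem MemH0Div.congr {v v' : Vec d → Vec d} (h : MemH0Div U v)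
    (hv : v =ᵐ[volume.restrict U] v') : MemH0Div U v' := by
  obtain ⟨δ, hδ, h0⟩ := h
  refine ⟨δ, ⟨(memLp_congr_ae hv).1 hδ.1, hδ.2.1, fun φ hφ => ?_⟩, fun φ g hφ => ?_⟩
  · rw [← hδ.2.2 φ hφ]
    exact integral_congr_ae (by filter_upwards [hv] with x hx; rw [hx])
  · rw [← h0 φ g hφ]
    exact integral_congr_ae (by filter_upwards [hv] with x hx; rw [hx])

theorem MemH0Div.zero : MemH0Div U (0 : Vec d → Vec d) :=
  ⟨0, ⟨MemLp.zero, MemLp.zero, fun φ _ => by simp⟩, fun φ g _ => by simp⟩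

theorem integrable_inner_of_memLp {v g : Vec d → Vec d} (hv : MemLp v 2 (volume.restrict U))
    (hg : MemLp g 2 (volume.restrict U)) :
    Integrable (fun x => inner ℝ (v x) (g x)) (volume.restrict U) := by
  refine (L2.integrable_inner (𝕜 := ℝ) (hv.toLp v) (hg.toLp g)).congr ?_
  filter_upwards [hv.coeFn_toLp, hg.coeFn_toLp] with x h1 h2
  rw [h1, h2]

theorem MemH0Div.add {v v' : Vec d → Vec d} (h : MemH0Div U v) (h' : MemH0Div U v') :
    MemH0Div U (v + v') := by
  obtain ⟨δ, hδ, h0⟩ := h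
  obtain ⟨δ', hδ', h0'⟩ := h'
  refine ⟨δ + δ', ⟨hδ.1.add hδ'.1, hδ.2.1.add hδ'.2.1, fun φ hφ => ?_⟩, fun φ g hφ => ?_⟩
  · simp only [Pi.add_apply, inner_add_left, add_mul]
    rw [integral_add (integrable_inner_of_memLp hδ.1 hφ.memLp_gradient)
        (integrable_inner_of_memLp hδ'.1 hφ.memLp_gradient),
      integral_add (integrable_mul_of_memLp hδ.2.1 hφ.memLp) (integrable_mul_of_memLp hδ'.2.1 hφ.memLp),
      hδ.2.2 φ hφ, hδ'.2.2 φ hφ, neg_add]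
  · simp only [Pi.add_apply, inner_add_left, add_mul, add_add_add_comm]
    have h1 : Integrable (fun x => inner ℝ (v x) (g x) + δ x * φ x) (volume.restrict U) :=
      (integrable_inner_of_memLp hδ.1 hφ.2.1).add (integrable_mul_of_memLp hδ.2.1 hφ.1)
    have h2 : Integrable (fun x => inner ℝ (v' x) (g x) + δ' x * φ x) (volume.restrict U) :=
      (integrable_inner_of_memLp hδ'.1 hφ.2.1).add (integrable_mul_of_memLp hδ'.2.1 hφ.1)
    rw [integral_add h1 h2, h0 φ g hφ, h0' φ g hφ, add_zero]

theorem MemH0Div.smul {v : Vec d → Vec d} (c : ℝ) (h : MemH0Div U v) : MemH0Div U (c • v) := by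
  obtain ⟨δ, hδ, h0⟩ := h
  refine ⟨c • δ, ⟨hδ.1.const_smul c, hδ.2.1.const_smul c, fun φ hφ => ?_⟩, fun φ g hφ => ?_⟩
  · simp only [Pi.smul_apply, real_inner_smul_left, smul_eq_mul, mul_assoc]
    rw [integral_const_mul, integral_const_mul, hδ.2.2 φ hφ, mul_neg]
  · simp only [Pi.smul_apply, real_inner_smul_left, smul_eq_mul, mul_assoc, ← mul_add]
    rw [integral_const_mul, h0 φ g hφ, mul_zero]

end Closure

/-- A conforming simplicial partition of `Ω`; an element is given by its set of vertices, and two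
elements meet in the common face spanned by their common vertices (or not at all). -/
structure Triangulation {d : ℕ} (Ω : Set (Vec d)) where
  elements : Finset (Finset (Vec d))
  card_eq : ∀ T ∈ elements, T.card = d + 1
  affineIndependent : ∀ T ∈ elements, AffineIndependent ℝ ((↑) : T → Vec d)
  conforming : ∀ T ∈ elements, ∀ T' ∈ elements,
    convexHull ℝ (T : Set (Vec d)) ∩ convexHull ℝ (T' : Set (Vec d)) =
      convexHull ℝ ((T : Set (Vec d)) ∩ (T' : Set (Vec d)))
  cover : ⋃ T ∈ elements, convexHull ℝ (T : Set (Vec d)) = closure Ω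

/-- The interior of the simplex with vertex set `T`. -/
def cell {d : ℕ} (T : Finset (Vec d)) : Set (Vec d) := interior (convexHull ℝ (T : Set (Vec d)))

/-- The diameter `h_T` (or `h_e`) of the simplex with vertex set `T` (or `e`). -/
noncomputable def hsize {d : ℕ} (T : Finset (Vec d)) : ℝ :=
  Metric.diam (convexHull ℝ (T : Set (Vec d)))

namespace Triangulation

variable {d : ℕ} {Ω : Set (Vec d)} (𝒯 : Triangulation Ω)

/-- The space `V_h^1` of functions in `[H¹₀(Ω)]^d` that are affine on each element. -/
noncomputable def V1 : Submodule ℝ (LTwoVec Ω) where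
  carrier := {v | (∀ i, MemH10 Ω fun x => v x i) ∧ ∀ T ∈ 𝒯.elements,
    ∃ (A : Vec d →ₗ[ℝ] Vec d) (b : Vec d), ∀ᵐ x ∂volume.restrict Ω, x ∈ cell T → v x = A x + b}
  zero_mem' := by
    have h0 := Lp.coeFn_zero (Vec d) 2 (volume.restrict Ω)
    refine ⟨fun i => MemH10.zero.congr ?_, fun T _ => ⟨0, 0, ?_⟩⟩
    · filter_upwards [h0] with x hx
      rw [hx]
      simp
    · filter_upwards [h0] with x hx _
      rw [hx]
      simp
  add_mem' := by
    rintro v w ⟨hv, hv'⟩ ⟨hw, hw'⟩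
    have h0 := Lp.coeFn_add v w
    refine ⟨fun i => ((hv i).add (hw i)).congr ?_, fun T hT => ?_⟩
    · filter_upwards [h0] with x hx
      rw [hx]
      simp
    · obtain ⟨A, b, h1⟩ := hv' T hT
      obtain ⟨A', b', h2⟩ := hw' T hT
      refine ⟨A + A', b + b', ?_⟩
      filter_upwards [h0, h1, h2] with x hx h1 h2 hxT
      rw [hx, Pi.add_apply, h1 hxT, h2 hxT, LinearMap.add_apply]
      abel
  smul_mem' := by
    rintro c v ⟨hv, hv'⟩
    have h0 := Lp.coeFn_smul c v
    refine ⟨fun i => ((hv i).smul c).congr ?_, fun T hT => ?_⟩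
    · filter_upwards [h0] with x hx
      rw [hx]
      simp
    · obtain ⟨A, b, h1⟩ := hv' T hT
      refine ⟨c • A, c • b, ?_⟩
      filter_upwards [h0, h1] with x hx h1 hxT
      rw [hx, Pi.smul_apply, h1 hxT, LinearMap.smul_apply, smul_add]

/-- The lowest order Raviart–Thomas space `RT0`: functions in `H₀(div; Ω)` that are of the form
`a + c x` on each element, with `a ∈ ℝ^d` and `c ∈ ℝ`. -/
noncomputable def RT0 : Submodule ℝ (LTwoVec Ω) where
  carrier := {v | MemH0Div Ω v ∧ ∀ T ∈ 𝒯.elements,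
    ∃ (a : Vec d) (c : ℝ), ∀ᵐ x ∂volume.restrict Ω, x ∈ cell T → v x = a + c • x}
  zero_mem' := by
    have h0 := Lp.coeFn_zero (Vec d) 2 (volume.restrict Ω)
    refine ⟨MemH0Div.zero.congr h0.symm, fun T _ => ⟨0, 0, ?_⟩⟩
    filter_upwards [h0] with x hx _
    rw [hx]
    simp
  add_mem' := by
    rintro v w ⟨hv, hv'⟩ ⟨hw, hw'⟩
    have h0 := Lp.coeFn_add v w
    refine ⟨(hv.add hw).congr h0.symm, fun T hT => ?_⟩
    obtain ⟨a, b, h1⟩ := hv' T hT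
    obtain ⟨a', b', h2⟩ := hw' T hT
    refine ⟨a + a', b + b', ?_⟩
    filter_upwards [h0, h1, h2] with x hx h1 h2 hxT
    rw [hx, Pi.add_apply, h1 hxT, h2 hxT, add_smul]
    abel
  smul_mem' := by
    rintro c v ⟨hv, hv'⟩
    have h0 := Lp.coeFn_smul c v
    refine ⟨(hv.smul c).congr h0.symm, fun T hT => ?_⟩
    obtain ⟨a, b, h1⟩ := hv' T hT
    refine ⟨c • a, c • b, ?_⟩
    filter_upwards [h0, h1] with x hx h1 hxT
    rw [hx, Pi.smul_apply, h1 hxT, smul_add, smul_assoc]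

/-- The velocity space `V_h = V_h^1 + RT0` (the sum turns out to be direct). -/
noncomputable def Vh : Submodule ℝ (LTwoVec Ω) := 𝒯.V1 ⊔ 𝒯.RT0

/-- The pressure space `W_h` of piecewise constant functions with mean value zero. (Integrability
is automatic, since the partitioned set `Ω` is bounded.) -/
noncomputable def Wh : Submodule ℝ (LTwo Ω) where
  carrier := {q | (∫ x in Ω, q x) = 0 ∧ Integrable q (volume.restrict Ω) ∧ ∀ T ∈ 𝒯.elements,
    ∃ c : ℝ, ∀ᵐ x ∂volume.restrict Ω, x ∈ cell T → q x = c}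
  zero_mem' := by
    have h0 := Lp.coeFn_zero ℝ 2 (volume.restrict Ω)
    refine ⟨(integral_congr_ae h0).trans (by simp), (integrable_congr h0).2 (integrable_zero _ _ _),
      fun T _ => ⟨0, ?_⟩⟩
    filter_upwards [h0] with x hx _
    rw [hx]
    simp
  add_mem' := by
    rintro v w ⟨hv, hvi, hv'⟩ ⟨hw, hwi, hw'⟩
    have h0 := Lp.coeFn_add v w
    refine ⟨?_, (integrable_congr h0).2 (hvi.add hwi), fun T hT => ?_⟩
    · rw [integral_congr_ae h0]
      simp only [Pi.add_apply]
      rw [integral_add hvi hwi, hv, hw, add_zero]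
    · obtain ⟨b, h1⟩ := hv' T hT
      obtain ⟨b', h2⟩ := hw' T hT
      refine ⟨b + b', ?_⟩
      filter_upwards [h0, h1, h2] with x hx h1 h2 hxT
      rw [hx, Pi.add_apply, h1 hxT, h2 hxT]
  smul_mem' := by
    rintro c v ⟨hv, hvi, hv'⟩
    have h0 := Lp.coeFn_smul c v
    refine ⟨?_, (integrable_congr h0).2 (hvi.smul c), fun T hT => ?_⟩
    · rw [integral_congr_ae h0]
      simp only [Pi.smul_apply]
      rw [integral_smul, hv, smul_zero]
    · obtain ⟨b, h1⟩ := hv' T hT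
      refine ⟨c • b, ?_⟩
      filter_upwards [h0, h1] with x hx h1 hxT
      rw [hx, Pi.smul_apply, h1 hxT]

/-- Almost every point of `Ω` lies in the interior of an element. -/
theorem ae_mem_cell : ∀ᵐ x ∂volume.restrict Ω, ∃ T ∈ 𝒯.elements, x ∈ cell T := by
  have h1 : ∀ᵐ x : Vec d, ∀ T ∈ 𝒯.elements, x ∉ frontier (convexHull ℝ (T : Set (Vec d))) := by
    rw [Finset.eventually_all]
    intro T _
    exact measure_eq_zero_iff_ae_notMem.1 ((convex_convexHull ℝ _).addHaar_frontier volume)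
  have h2 : ∀ᵐ x ∂volume.restrict Ω, x ∈ closure Ω :=
    ae_restrict_of_ae_restrict_of_subset subset_closure
      (ae_restrict_mem isClosed_closure.measurableSet)
  filter_upwards [ae_restrict_of_ae h1, h2] with x hx hxΩ
  rw [← 𝒯.cover] at hxΩ
  simp only [Set.mem_iUnion] at hxΩ
  obtain ⟨T, hT, hxT⟩ := hxΩ
  refine ⟨T, hT, ?_⟩
  by_contra hc
  exact hx T hT ⟨subset_closure hxT, hc⟩

instance : FiniteDimensional ℝ 𝒯.Wh := by
  let F : 𝒯.Wh →ₗ[ℝ] (𝒯.elements → ℝ) :=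
    { toFun := fun q T => ∫ x in cell T.1, (q : LTwo Ω) x ∂volume.restrict Ω
      map_add' := by
        intro q r
        funext T
        have h0 := Lp.coeFn_add (q : LTwo Ω) (r : LTwo Ω)
        rw [Pi.add_apply, ← integral_add q.2.2.1.integrableOn r.2.2.1.integrableOn]
        exact integral_congr_ae (ae_restrict_of_ae h0)
      map_smul' := by
        intro c q
        funext T
        have h0 := Lp.coeFn_smul c (q : LTwo Ω)
        rw [Pi.smul_apply, RingHom.id_apply, ← integral_smul]
        exact integral_congr_ae (ae_restrict_of_ae h0) }
  refine Module.Finite.of_injective F ((injective_iff_map_eq_zero F).2 fun q hq => ?_)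
  have h1 : ∀ᵐ x ∂volume.restrict Ω, ∀ T ∈ 𝒯.elements, x ∈ cell T → (q : LTwo Ω) x = 0 := by
    rw [Finset.eventually_all]
    intro T hT
    have hm : MeasurableSet (cell T) := isOpen_interior.measurableSet
    obtain ⟨c, hc⟩ := q.2.2.2 T hT
    have hc' := (ae_restrict_iff' hm).2 hc
    have h2 : ∫ x in cell T, (q : LTwo Ω) x ∂volume.restrict Ω = 0 := congrFun hq ⟨T, hT⟩
    rw [integral_congr_ae hc', setIntegral_const, smul_eq_mul, mul_eq_zero] at h2
    rcases h2 with h2 | rfl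
    · rw [measureReal_eq_zero_iff (by
        have : cell T ⊆ convexHull ℝ (T : Set (Vec d)) := interior_subset
        exact ((measure_mono this).trans_lt ((Measure.restrict_apply_le _ _).trans_lt
          (T.finite_toSet.isCompact_convexHull (𝕜 := ℝ)).measure_lt_top)).ne)] at h2
      filter_upwards [measure_eq_zero_iff_ae_notMem.1 h2] with x hx hxT
      exact absurd hxT hx
    · exact hc
  ext
  filter_upwards [h1, 𝒯.ae_mem_cell, Lp.coeFn_zero ℝ 2 (volume.restrict Ω)] with x hx hT h0
  obtain ⟨T, hT, hxT⟩ := hT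
  rw [hx T hT hxT, ZeroMemClass.coe_zero, h0, Pi.zero_apply]

/-- The `L²` projection `P_h` onto `W_h`, determined by `P_h r ∈ W_h` and `(r - P_h r, q) = 0` for
all `q ∈ W_h`. -/
noncomputable def Ph (r : LTwo Ω) : LTwo Ω := 𝒯.Wh.starProjection r

open Classical in
/-- The set `ℰ⁰` of interior faces: those shared by two elements. -/
noncomputable def interiorFaces : Finset (Finset (Vec d)) :=
  (𝒯.elements.biUnion fun T => T.powersetCard d).filter fun e =>
    ∃ T ∈ 𝒯.elements, ∃ T' ∈ 𝒯.elements, T ≠ T' ∧ e ⊆ T ∧ e ⊆ T'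

open Classical in
/-- One of the two elements that contain the interior face `e`; the choice fixes the orientation
of the unit normal `n_e`, which points out of this element. -/
noncomputable def plusElement (e : Finset (Vec d)) : Finset (Vec d) :=
  if h : ∃ T ∈ 𝒯.elements, e ⊆ T then h.choose else ∅

open Classical in
/-- The standard basis function `Φ_e` of `RT0`: on an element `T` with face `e` and vertex `a`
opposite to `e` it is `± (x - a) / (d |T|)`, with flux `1` through `e` in the direction `n_e` and
no flux through the other faces, and it vanishes on the elements that do not contain `e`. (The
opposite vertex is written as the sum over the singleton `T \ e`.) -/
noncomputable def rtBasis (e : Finset (Vec d)) (x : Vec d) : Vec d :=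
  ∑ T ∈ 𝒯.elements with e ⊆ T, (cell T).indicator
    (fun y => ((if T = 𝒯.plusElement e then 1 else -1) / (d * volume.real (cell T))) •
      (y - ∑ a ∈ T \ e, a)) x

open Classical in
/-- The coefficients `v_e` in `v = ∑_{e ∈ ℰ⁰} v_e Φ_e`, for `v ∈ RT0`. -/
noncomputable def rtCoeff (v : LTwoVec Ω) : 𝒯.interiorFaces → ℝ :=
  if h : ∃ c : 𝒯.interiorFaces → ℝ,
    ∀ᵐ x ∂volume.restrict Ω, v x = ∑ e, c e • 𝒯.rtBasis e.1 x then h.choose else 0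

open Classical in
/-- The component `v^R ∈ RT0` in the decomposition `v = v^1 + v^R` of `v ∈ V_h = V_h^1 ⊕ RT0`. -/
noncomputable def rtPart (v : LTwoVec Ω) : LTwoVec Ω :=
  if h : ∃ w ∈ 𝒯.RT0, v - w ∈ 𝒯.V1 then h.choose else 0

/-- The two choices of the stabilization, with their positive parameters `α_T` or `α_e`. -/
inductive Stabilization : Type
  | elementwise (α : 𝒯.elements → ℝ) (hα : ∀ T, 0 < α T)
  | diagonal (α : 𝒯.interiorFaces → ℝ) (hα : ∀ e, 0 < α e)

/-- The stabilization form `𝒥` on `RT0`: either `𝒥⁰`, which is `∑_T α_T h_T⁻² (u, v)_T`, or `𝒥ᴰ`,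
which is `∑_e α_e h_e⁻² u_e v_e (Φ_e, Φ_e)`. -/
noncomputable def stabForm (J : 𝒯.Stabilization) (u v : LTwoVec Ω) : ℝ :=
  match J with
  | .elementwise α _ => ∑ T, α T * (hsize T.1 ^ 2)⁻¹ * ∫ x in cell T.1, inner ℝ (u x) (v x)
  | .diagonal α _ => ∑ e, α e * (hsize e.1 ^ 2)⁻¹ * 𝒯.rtCoeff u e * 𝒯.rtCoeff v e *
      ∫ x in Ω, inner ℝ (𝒯.rtBasis e.1 x) (𝒯.rtBasis e.1 x)

/-- `(∇_h u, ∇_h v) = ∑_T (∇u, ∇v)_T`. -/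
noncomputable def gradForm (u v : LTwoVec Ω) : ℝ :=
  ∑ T ∈ 𝒯.elements, ∑ i : Fin d, ∫ x in cell T,
    inner ℝ (weakGrad (cell T) (fun y => u y i) x) (weakGrad (cell T) (fun y => v y i) x)

/-- `a_h(u, v) = (∇_h u, ∇_h v) + 𝒥(u^R, v^R)`. -/
noncomputable def ah (J : 𝒯.Stabilization) (u v : LTwoVec Ω) : ℝ :=
  𝒯.gradForm u v + 𝒯.stabForm J (𝒯.rtPart u) (𝒯.rtPart v)

end Triangulation

/-- `b(v, q) = (∇·v, q)`. -/
noncomputable def divForm {d : ℕ} {Ω : Set (Vec d)} (v : LTwoVec Ω) (q : LTwo Ω) : ℝ :=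
  ∫ x in Ω, weakDiv Ω v x * q x

/-- `(u, p) ∈ V_h × W_h` solves the discrete Stokes problem with viscosity `ν` and force `f`. -/
structure IsDiscreteSolution {d : ℕ} {Ω : Set (Vec d)} (𝒯 : Triangulation Ω)
    (J : 𝒯.Stabilization) (ν : ℝ) (f : LTwoVec Ω) (u : LTwoVec Ω) (p : LTwo Ω) : Prop where
  mem_Vh : u ∈ 𝒯.Vh
  mem_Wh : p ∈ 𝒯.Wh
  momentum : ∀ v ∈ 𝒯.Vh, ν * 𝒯.ah J u v - divForm v p = inner ℝ f v
  continuity : ∀ q ∈ 𝒯.Wh, divForm u q = 0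

end StokesFEM

/-! The discrete problem is a square linear system on the finite-dimensional space `V_h × W_h`, so
unique solvability reduces to injectivity (`stokesForm_injective`). Testing the homogeneous system
with its own solution cancels the `b` terms and leaves `ν a_h(u, u) = 0`. The stabilization is
definite on `RT0` (for `𝒥ᴰ` because the `Φ_e` form a basis), so `u^R = 0`. Then `u` lies in `V_h^1`
and has zero gradient on every element, and Poincaré's inequality gives `u = 0`. What remains is
`b(v, p) = 0` for all `v`. Taking `v = Φ_e` shows that `p` does not jump across `e`, so `p` is
constant because any two elements are linked through interior faces, and its zero mean makes it
vanish (`eq_zero_of_divForm_eq_zero`). No quantitative inf-sup bound is needed.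

The decomposition `v = v^1 + v^R` is unique because a field `a + c x` has Jacobian `c I`. A common
element of `V_h^1` and `RT0` thus has some vanishing partial derivative in each component when `d ≥
2`, and Poincaré's inequality in that one direction applies (`MemH10.ae_eq_zero`).

Pressure-robustness holds because `V_h ⊆ H₀(div)` and `∇·V_h ⊆ W_h`. For `v ∈ V_h`, `(∇ψ, v) =
-(∇·v, ψ) = -(∇·v, P_h ψ)`, so the extra load is absorbed by the pressure `P_h ψ`
(`IsDiscreteSolution.add_gradient`).

Most of the work is to show that the `Φ_e` lie in `RT0` and form a basis of it, when all derivatives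
and traces are weak. Surface integrals are replaced by `faceFlux`, the integral of the divergence of
`χ(x) (x - a)` over an element. It is a limit of averages over thin layers at the face opposite to
`a`. Hence it depends only on `χ` on that face, is positive for suitable bumps, and after division
by the volume is the same from both sides (`IsSimplex.faceFlux_div_eq`). So `Φ_e` has divergence
`rtDiv` on the whole space. Contracted towards the centroid of `e` it has compact support in `Ω`;
mollification and a limit then give zero normal trace (`Adjacent.integral_domain_rtBasis`).
Conversely, testing a field of `RT0` with a bump at the centroid of one face gives the balance of
normal components there (`sum_coeff_mul_volume_eq_zero`), from which the coefficients are read off.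

The Lipschitz boundary enters through `interior (closure Ω) = Ω`, which places the open elements and
the relative interiors of the shared faces inside `Ω`. -/

namespace StokesFEM

/-! ### Barycentric coordinates on a nondegenerate simplex -/

section Simplex

open scoped Classical

variable {d : ℕ} {T : Finset (Vec d)}

/-- `T` is the vertex set of a nondegenerate simplex in `ℝ^d`. -/
structure IsSimplex (T : Finset (Vec d)) : Prop where
  card_eq : T.card = d + 1
  affineIndependent : AffineIndependent ℝ ((↑) : T → Vec d)

namespace IsSimplex

/-- The affine basis formed by the vertices of a nondegenerate simplex. -/
noncomputable def basis (h : IsSimplex T) : AffineBasis T ℝ (Vec d) :=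
  ⟨(↑), h.affineIndependent,
    h.affineIndependent.affineSpan_eq_top_iff_card_eq_finrank_add_one.2 (by simp [h.card_eq])⟩

/-- The barycentric coordinate with respect to the vertex `a` of a nondegenerate simplex. -/
noncomputable def coord (h : IsSimplex T) (a : Vec d) : Vec d →ᵃ[ℝ] ℝ :=
  if ha : a ∈ T then h.basis.coord ⟨a, ha⟩ else 0

theorem range_basis (h : IsSimplex T) : Set.range h.basis = (T : Set (Vec d)) :=
  Subtype.range_coe

theorem coord_of_mem (h : IsSimplex T) {a : Vec d} (ha : a ∈ T) :
    h.coord a = h.basis.coord ⟨a, ha⟩ := dif_pos ha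

theorem sum_coord (h : IsSimplex T) (x : Vec d) : ∑ v ∈ T, h.coord v x = 1 := by
  rw [← Finset.sum_coe_sort, ← h.basis.sum_coord_apply_eq_one x]
  exact Finset.sum_congr rfl fun v _ => by rw [h.coord_of_mem v.2]

theorem sum_coord_smul (h : IsSimplex T) (x : Vec d) : ∑ v ∈ T, h.coord v x • v = x := by
  rw [← Finset.sum_coe_sort]
  conv_rhs => rw [← h.basis.linear_combination_coord_eq_self x]
  exact Finset.sum_congr rfl fun v _ => by rw [h.coord_of_mem v.2]; rfl

theorem coord_vertex (h : IsSimplex T) {a v : Vec d} (ha : a ∈ T) (hv : v ∈ T) :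
    h.coord a v = if a = v then 1 else 0 := by
  rw [h.coord_of_mem ha]
  refine (h.basis.coord_apply ⟨a, ha⟩ ⟨v, hv⟩).trans ?_
  simp [Subtype.ext_iff]

theorem coord_self (h : IsSimplex T) {a : Vec d} (ha : a ∈ T) : h.coord a a = 1 := by
  simp [h.coord_vertex ha ha]

theorem coord_ne (h : IsSimplex T) {a v : Vec d} (ha : a ∈ T) (hv : v ∈ T) (hav : a ≠ v) :
    h.coord a v = 0 := by
  simp [h.coord_vertex ha hv, hav]

theorem convexHull_eq (h : IsSimplex T) :
    convexHull ℝ (T : Set (Vec d)) = {x | ∀ v ∈ T, 0 ≤ h.coord v x} := by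
  rw [← h.range_basis, h.basis.convexHull_eq_nonneg_coord]
  ext x
  exact ⟨fun H v hv => by rw [h.coord_of_mem hv]; exact H ⟨v, hv⟩,
    fun H v => by rw [← h.coord_of_mem v.2]; exact H v v.2⟩

theorem cell_eq (h : IsSimplex T) : cell T = {x | ∀ v ∈ T, 0 < h.coord v x} := by
  rw [cell, ← h.range_basis, h.basis.interior_convexHull]
  ext x
  exact ⟨fun H v hv => by rw [h.coord_of_mem hv]; exact H ⟨v, hv⟩,
    fun H v => by rw [← h.coord_of_mem v.2]; exact H v v.2⟩

theorem mem_convexHull (h : IsSimplex T) {x : Vec d} :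
    x ∈ convexHull ℝ (T : Set (Vec d)) ↔ ∀ v ∈ T, 0 ≤ h.coord v x := by
  rw [h.convexHull_eq]; rfl

theorem mem_cell (h : IsSimplex T) {x : Vec d} : x ∈ cell T ↔ ∀ v ∈ T, 0 < h.coord v x := by
  rw [h.cell_eq]; rfl

@[fun_prop]
theorem continuous_coord (h : IsSimplex T) (a : Vec d) : Continuous (h.coord a) :=
  (h.coord a).continuous_of_finiteDimensional

theorem coord_add_smul (h : IsSimplex T) (a x y : Vec d) (t : ℝ) :
    h.coord a (x + t • y) = h.coord a x + t * (h.coord a).linear y := by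
  rw [add_comm, ← vadd_eq_add, AffineMap.map_vadd, map_smul, vadd_eq_add, smul_eq_mul, add_comm]

theorem linear_sub (h : IsSimplex T) (a x y : Vec d) :
    (h.coord a).linear (x - y) = h.coord a x - h.coord a y := by
  rw [← vsub_eq_sub, AffineMap.linearMap_vsub, vsub_eq_sub]

theorem coord_lineMap (h : IsSimplex T) (a x y : Vec d) (t : ℝ) :
    h.coord a (x + t • (y - x)) = (1 - t) * h.coord a x + t * h.coord a y := by
  rw [h.coord_add_smul, h.linear_sub]; ring

/-- Affine maps commute with affine combinations: the linear part does so termwise, and the constant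
part is reproduced because the weights sum to one. -/
theorem coord_sum (h : IsSimplex T) {ι : Type*} {s : Finset ι} {w : ι → ℝ} (hw : ∑ i ∈ s, w i = 1)
    (p : ι → Vec d) (a : Vec d) : h.coord a (∑ i ∈ s, w i • p i) = ∑ i ∈ s, w i * h.coord a (p i) := by
  have key : ∀ x, h.coord a x = (h.coord a).linear x + h.coord a 0 := fun x => by
    have := h.linear_sub a x 0
    rw [sub_zero] at this
    rw [this]; ring
  rw [key, map_sum]
  simp only [map_smul, smul_eq_mul]
  have : ∑ i ∈ s, w i * h.coord a (p i) = ∑ i ∈ s, (w i * (h.coord a).linear (p i) + w i * h.coord a 0) :=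
    Finset.sum_congr rfl fun i _ => by rw [key (p i)]; ring
  rw [this, Finset.sum_add_distrib, ← Finset.sum_mul, hw, one_mul]

theorem ext_coord (h : IsSimplex T) {x y : Vec d} (hxy : ∀ v ∈ T, h.coord v x = h.coord v y) :
    x = y := by
  rw [← h.sum_coord_smul x, ← h.sum_coord_smul y]
  exact Finset.sum_congr rfl fun v hv => by rw [hxy v hv]

theorem nonempty (h : IsSimplex T) : T.Nonempty := by
  rw [← Finset.card_pos, h.card_eq]; omega

/-- The centroid of a nonempty finite set of points. -/
noncomputable def _root_.StokesFEM.centroid (e : Finset (Vec d)) : Vec d :=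
  ∑ v ∈ e, (e.card : ℝ)⁻¹ • v

theorem coord_centroid (h : IsSimplex T) {e : Finset (Vec d)} (he : e.Nonempty) (heT : e ⊆ T)
    {v : Vec d} (hv : v ∈ T) :
    h.coord v (centroid e) = if v ∈ e then (e.card : ℝ)⁻¹ else 0 := by
  have hc : (e.card : ℝ) ≠ 0 := by simpa using he.ne_empty
  rw [centroid, h.coord_sum (by simp [hc])]
  have : ∀ u ∈ e, (e.card : ℝ)⁻¹ * h.coord v u = if v = u then (e.card : ℝ)⁻¹ else 0 := fun u hu => by
    rw [h.coord_vertex hv (heT hu)]; split_ifs <;> simp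
  rw [Finset.sum_congr rfl this, Finset.sum_ite_eq]

theorem coord_eq_zero_of_mem_convexHull (h : IsSimplex T) {e : Finset (Vec d)} (heT : e ⊆ T)
    {x : Vec d} (hx : x ∈ convexHull ℝ (e : Set (Vec d))) {v : Vec d} (hv : v ∈ T) (hve : v ∉ e) :
    h.coord v x = 0 := by
  rw [Finset.convexHull_eq] at hx
  obtain ⟨w, -, hw1, rfl⟩ := hx
  rw [Finset.centerMass_eq_of_sum_1 _ _ hw1, h.coord_sum hw1]
  refine Finset.sum_eq_zero fun u hu => ?_
  rw [id, h.coord_ne hv (heT hu) (by rintro rfl; exact hve hu), mul_zero]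

theorem mem_convexHull_of_coord (h : IsSimplex T) {e : Finset (Vec d)} (heT : e ⊆ T)
    {x : Vec d} (hx : ∀ v ∈ e, 0 ≤ h.coord v x) (hx0 : ∀ v ∈ T, v ∉ e → h.coord v x = 0) :
    x ∈ convexHull ℝ (e : Set (Vec d)) := by
  have h1 : ∑ v ∈ e, h.coord v x = 1 := by
    rw [← h.sum_coord x]
    exact Finset.sum_subset heT hx0
  have h2 : ∑ v ∈ e, h.coord v x • v = x := by
    conv_rhs => rw [← h.sum_coord_smul x]
    exact Finset.sum_subset heT fun v hv hve => by rw [hx0 v hv hve, zero_smul]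
  rw [Finset.convexHull_eq]
  exact ⟨fun v => h.coord v x, hx, h1, by rw [Finset.centerMass_eq_of_sum_1 _ _ h1]; simpa using h2⟩

theorem cell_nonempty (h : IsSimplex T) : (cell T).Nonempty := by
  refine ⟨centroid T, h.mem_cell.2 fun v hv => ?_⟩
  rw [h.coord_centroid h.nonempty subset_rfl hv, if_pos hv]
  have := h.nonempty.card_pos
  positivity

theorem isOpen_cell : IsOpen (cell T) := isOpen_interior

theorem measurableSet_cell : MeasurableSet (cell T) := isOpen_interior.measurableSet

theorem cell_subset : cell T ⊆ convexHull ℝ (T : Set (Vec d)) := interior_subset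

theorem convexHull_subset_closure_cell (h : IsSimplex T) :
    convexHull ℝ (T : Set (Vec d)) ⊆ closure (cell T) := by
  rw [cell, (convex_convexHull ℝ _).closure_interior_eq_closure_of_nonempty_interior h.cell_nonempty]
  exact subset_closure

theorem isCompact_convexHull : IsCompact (convexHull ℝ (T : Set (Vec d))) :=
  T.finite_toSet.isCompact_convexHull (𝕜 := ℝ)

theorem volume_cell_lt_top : volume (cell T) < ⊤ :=
  (measure_mono cell_subset).trans_lt isCompact_convexHull.measure_lt_top

theorem volume_cell_pos (h : IsSimplex T) : 0 < volume (cell T) :=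
  isOpen_cell.measure_pos _ h.cell_nonempty

theorem volume_real_cell_pos (h : IsSimplex T) : 0 < volume.real (cell T) :=
  ENNReal.toReal_pos h.volume_cell_pos.ne' volume_cell_lt_top.ne

/-- If two nondegenerate simplices share the vertices `e`, opposite to `a` and `a'`, and `a'` lies
on the same side of `e` as `a`, then they overlap. -/
theorem exists_mem_inter (h : IsSimplex T) {T' : Finset (Vec d)} (h' : IsSimplex T')
    {a a' : Vec d} (ha : a ∈ T) (ha' : a' ∈ T') (he : T.erase a = T'.erase a')
    (hpos : 0 < h.coord a a') :
    ∃ x ∈ convexHull ℝ (T : Set (Vec d)) ∩ convexHull ℝ (T' : Set (Vec d)), 0 < h.coord a x := by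
  set e := T.erase a with he_def
  have hne : ∀ v ∈ T, v ≠ a → 0 < h.coord v (centroid e) := fun v hv hva => by
    have hve : v ∈ e := Finset.mem_erase.2 ⟨hva, hv⟩
    rw [h.coord_centroid ⟨v, hve⟩ (Finset.erase_subset _ _) hv, if_pos hve]
    have : 0 < e.card := Finset.card_pos.2 ⟨v, hve⟩
    positivity
  -- The overlap point is sought on the segment from the centroid of the common face to `a'`. For
  -- small `t` the positive coordinates at the face vertices stay nonnegative, while the coordinate
  -- at `a` becomes positive at once.
  have hev : ∀ᶠ t in 𝓝[>] (0 : ℝ), ∀ v ∈ e, 0 ≤ h.coord v (centroid e + t • (a' - centroid e)) := by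
    rw [Finset.eventually_all]
    intro v hv
    have hc : Continuous fun t : ℝ => h.coord v (centroid e + t • (a' - centroid e)) := by fun_prop
    have : ∀ᶠ t in 𝓝 (0 : ℝ), 0 < h.coord v (centroid e + t • (a' - centroid e)) := by
      refine hc.continuousAt.eventually_const_lt ?_
      simpa using hne v (Finset.mem_of_mem_erase hv) (Finset.ne_of_mem_erase hv)
    exact nhdsWithin_le_nhds (this.mono fun _ => le_of_lt)
  obtain ⟨t, ht, ht0, ht1⟩ := (hev.and (Ioo_mem_nhdsGT (zero_lt_one (α := ℝ)))).exists
  -- An empty face means `d = 0`, where the space is a single point.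
  have hca : 0 ≤ h.coord a (centroid e) := by
    rcases e.eq_empty_or_nonempty with h0 | h0
    · have : T = {a} := by
        rw [← Finset.insert_erase ha, ← he_def, h0, insert_empty_eq]
      have hd : d = 0 := by have := h.card_eq; simp_all
      subst hd
      rw [Subsingleton.elim (centroid e) a, h.coord_self ha]; exact zero_le_one
    · rw [h.coord_centroid h0 (Finset.erase_subset _ _) ha]; split_ifs <;> positivity
  have hpa : 0 < h.coord a (centroid e + t • (a' - centroid e)) := by
    rw [h.coord_lineMap]
    have := mul_pos ht0 hpos
    have := mul_nonneg (sub_nonneg.2 ht1.le) hca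
    linarith
  have hc : centroid e ∈ convexHull ℝ (T' : Set (Vec d)) := by
    rcases e.eq_empty_or_nonempty with h0 | h0
    · have hd : d = 0 := by
        have := h.card_eq
        rw [← Finset.insert_erase ha, ← he_def, h0] at this
        simpa using this.symm
      subst hd
      rw [Subsingleton.elim (centroid e) a']
      exact subset_convexHull ℝ _ ha'
    · have heT' : e ⊆ T' := by rw [he]; exact Finset.erase_subset _ _
      refine h'.mem_convexHull.2 fun v hv => ?_
      rw [h'.coord_centroid h0 heT' hv]
      split_ifs <;> positivity
  refine ⟨_, ⟨h.mem_convexHull.2 fun v hv => ?_, ?_⟩, hpa⟩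
  · by_cases hva : v = a
    · rw [hva]; exact hpa.le
    · exact ht v (Finset.mem_erase.2 ⟨hva, hv⟩)
  · have := (convex_convexHull ℝ (T' : Set (Vec d))).add_smul_sub_mem hc
      (subset_convexHull ℝ _ (Finset.mem_coe.2 ha')) (t := t) ⟨ht0.le, ht1.le⟩
    exact this

/-- The vertex of a neighbouring simplex opposite to a common face does not lie in the hyperplane
spanned by the face. -/
theorem coord_opposite_ne_zero (h : IsSimplex T) {T' : Finset (Vec d)} (h' : IsSimplex T')
    {a a' : Vec d} (ha' : a' ∈ T') (he : T.erase a = T'.erase a') :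
    h.coord a a' ≠ 0 := by
  intro h0
  -- If the coordinate vanished, `a'` would be an affine combination of the common face vertices,
  -- where the coordinate at `a'` with respect to `T'` is zero.
  have h1 : h'.coord a' a' = 0 := by
    rw [← congrArg (h'.coord a') (h.sum_coord_smul a'), h'.coord_sum (h.sum_coord a')]
    refine Finset.sum_eq_zero fun v hv => ?_
    by_cases hva : v = a
    · rw [hva, h0, zero_mul]
    · have : v ∈ T'.erase a' := by rw [← he]; exact Finset.mem_erase.2 ⟨hva, hv⟩
      rw [h'.coord_ne ha' (Finset.mem_of_mem_erase this) (Finset.ne_of_mem_erase this).symm, mul_zero]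
  rw [h'.coord_self ha'] at h1
  exact one_ne_zero h1

/-- Change of barycentric coordinates between two simplices with a common face. -/
theorem coord_eq_of_erase_eq (h : IsSimplex T) {T' : Finset (Vec d)} (h' : IsSimplex T')
    {a a' : Vec d} (ha : a ∈ T) (ha' : a' ∈ T') (he : T.erase a = T'.erase a') (x : Vec d) :
    h.coord a x = h'.coord a' x * h.coord a a' ∧
      ∀ v ∈ T.erase a, h.coord v x = h'.coord v x + h'.coord a' x * h.coord v a' := by
  have key : ∀ v, h.coord v x = ∑ u ∈ T', h'.coord u x * h.coord v u := fun v => by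
    conv_lhs => rw [← h'.sum_coord_smul x]
    rw [h.coord_sum (h'.sum_coord x)]
  have key2 : ∀ v, h.coord v x = h'.coord a' x * h.coord v a' +
      ∑ u ∈ T.erase a, h'.coord u x * h.coord v u := fun v => by
    rw [key, he]
    exact (Finset.add_sum_erase _ (fun u => h'.coord u x * h.coord v u) ha').symm
  refine ⟨?_, fun v hv => ?_⟩
  · rw [key2, Finset.sum_eq_zero, add_zero]
    intro u hu
    rw [h.coord_ne ha (Finset.mem_of_mem_erase hu) (Finset.ne_of_mem_erase hu).symm, mul_zero]
  · rw [key2, Finset.sum_eq_single_of_mem v hv, h.coord_self (Finset.mem_of_mem_erase hv)]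
    · ring
    · intro u hu huv
      rw [h.coord_ne (Finset.mem_of_mem_erase hv) (Finset.mem_of_mem_erase hu) huv.symm, mul_zero]

end IsSimplex

end Simplex

/-! ### Geometry of conforming triangulations -/

section TriangulationGeometry

open scoped Classical

variable {d : ℕ} {Ω : Set (Vec d)}

/-- A domain with Lipschitz boundary lies on one side of its boundary. -/
theorem HasLipschitzBoundary.interior_closure (hΩ : HasLipschitzBoundary Ω) (ho : IsOpen Ω) :
    interior (closure Ω) = Ω := by
  refine subset_antisymm (fun x hx => ?_) (interior_maximal subset_closure ho)
  by_contra hxΩ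
  obtain ⟨n, γ, K, hn, hγ, U, hU, h⟩ := hΩ x ⟨interior_subset hx, by rwa [ho.interior_eq]⟩
  have hx0 : inner ℝ n x ≤ γ (x - inner ℝ n x • n) :=
    not_lt.1 fun hlt => hxΩ ((h x (mem_of_mem_nhds hU)).2 hlt)
  -- A point interior to the closure but outside `Ω` lies on or below the graph. Moving it slightly
  -- along `-n` puts it strictly below, where a whole neighbourhood misses `Ω`, although it is still
  -- in the closure.
  have hc : Continuous fun t : ℝ => x - t • n := by fun_prop
  have h1 : ∀ᶠ t in 𝓝[>] (0 : ℝ), x - t • n ∈ interior U ∩ interior (closure Ω) := by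
    refine nhdsWithin_le_nhds (hc.continuousAt.eventually_mem ?_)
    simp only [zero_smul, sub_zero]
    exact inter_mem (interior_mem_nhds.2 hU) (isOpen_interior.mem_nhds hx)
  obtain ⟨t, ⟨htU, htΩ⟩, ht0⟩ := (h1.and self_mem_nhdsWithin).exists
  have ht0 : 0 < t := ht0
  have hopen : IsOpen {y : Vec d | inner ℝ n y < γ (y - inner ℝ n y • n)} := by
    have := hγ.continuous
    exact isOpen_lt (by fun_prop) (by fun_prop)
  have hmem : x - t • n ∈ {y : Vec d | inner ℝ n y < γ (y - inner ℝ n y • n)} := by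
    have hnn : inner ℝ n n = (1 : ℝ) := by rw [real_inner_self_eq_norm_sq, hn]; norm_num
    have e1 : inner ℝ n (x - t • n) = inner ℝ n x - t := by
      rw [inner_sub_right, real_inner_smul_right, hnn, mul_one]
    have e2 : x - t • n - (inner ℝ n x - t) • n = x - inner ℝ n x • n := by
      rw [sub_smul]; abel
    rw [Set.mem_ofPred_eq, e1, e2]
    linarith
  obtain ⟨y, ⟨hy1, hy2⟩, hyΩ⟩ := mem_closure_iff.1 (interior_subset htΩ) _
    (hopen.inter isOpen_interior) ⟨hmem, htU⟩
  exact lt_asymm hy1 ((h y (interior_subset hy2)).1 hyΩ)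

namespace Triangulation

variable (𝒯 : Triangulation Ω) {T T' : Finset (Vec d)}

theorem isSimplex (hT : T ∈ 𝒯.elements) : IsSimplex T :=
  ⟨𝒯.card_eq T hT, 𝒯.affineIndependent T hT⟩

theorem convexHull_subset_closure (hT : T ∈ 𝒯.elements) :
    convexHull ℝ (T : Set (Vec d)) ⊆ closure Ω := by
  rw [← 𝒯.cover]
  exact Set.subset_biUnion_of_mem (u := fun T : Finset (Vec d) => convexHull ℝ (T : Set (Vec d))) hT

theorem cell_subset (hΩ : interior (closure Ω) = Ω) (hT : T ∈ 𝒯.elements) : cell T ⊆ Ω := by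
  rw [← hΩ]
  exact interior_mono (𝒯.convexHull_subset_closure hT)

variable {𝒯}

/-- By conformity `x` is in the hull of the common vertices. A vertex of `T` outside `T'` would have
coordinate zero at `x`, but interior points have only positive coordinates. -/
theorem eq_of_mem_cell (hT : T ∈ 𝒯.elements) (hT' : T' ∈ 𝒯.elements) {x : Vec d}
    (hx : x ∈ cell T) (hx' : x ∈ convexHull ℝ (T' : Set (Vec d))) : T = T' := by
  have h := 𝒯.isSimplex hT
  have h1 : x ∈ convexHull ℝ ((T ∩ T' : Finset (Vec d)) : Set (Vec d)) := by
    rw [Finset.coe_inter, ← 𝒯.conforming T hT T' hT']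
    exact ⟨interior_subset hx, hx'⟩
  refine Finset.eq_of_subset_of_card_le (fun v hv => ?_)
    (by rw [𝒯.card_eq T hT, 𝒯.card_eq T' hT'])
  by_contra hvT'
  have h2 := h.coord_eq_zero_of_mem_convexHull Finset.inter_subset_left h1 hv
    (fun hv' => hvT' (Finset.mem_inter.1 hv').2)
  exact ((h.mem_cell.1 hx) v hv).ne' h2

theorem disjoint_cell (hT : T ∈ 𝒯.elements) (hT' : T' ∈ 𝒯.elements) (hne : T ≠ T') :
    Disjoint (cell T) (cell T') :=
  Set.disjoint_left.2 fun _ hx hx' => hne (eq_of_mem_cell hT hT' hx (interior_subset hx'))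

variable {a a' : Vec d}

/-- Two elements lie on opposite sides of a common face. Otherwise they would overlap at a point
with positive coordinate at `a`, whereas conformity confines the overlap to the hull of common
vertices, and `a` is not one of them. -/
theorem coord_opposite_neg (hT : T ∈ 𝒯.elements) (hT' : T' ∈ 𝒯.elements) (hne : T ≠ T')
    (ha : a ∈ T) (ha' : a' ∈ T') (he : T.erase a = T'.erase a') :
    (𝒯.isSimplex hT).coord a a' < 0 := by
  have h := 𝒯.isSimplex hT
  refine lt_of_le_of_ne (not_lt.1 fun hpos => ?_)
    (h.coord_opposite_ne_zero (𝒯.isSimplex hT') ha' he)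
  obtain ⟨x, hx, hxa⟩ := h.exists_mem_inter (𝒯.isSimplex hT') ha ha' he hpos
  have haT' : a ∉ T' := fun haT' => by
    refine hne (Finset.eq_of_subset_of_card_le (fun v hv => ?_)
      (by rw [𝒯.card_eq T hT, 𝒯.card_eq T' hT']))
    by_cases hva : v = a
    · rwa [hva]
    · exact Finset.mem_of_mem_erase (he ▸ Finset.mem_erase.2 ⟨hva, hv⟩)
  rw [𝒯.conforming T hT T' hT', ← Finset.coe_inter] at hx
  exact hxa.ne' (h.coord_eq_zero_of_mem_convexHull Finset.inter_subset_left hx ha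
    fun hv' => haT' (Finset.mem_inter.1 hv').2)

/-- A face belongs to at most two elements. -/
theorem eq_of_common_face {T'' : Finset (Vec d)} {a'' : Vec d} (hT : T ∈ 𝒯.elements)
    (hT' : T' ∈ 𝒯.elements) (hT'' : T'' ∈ 𝒯.elements) (hne : T ≠ T') (hne' : T ≠ T'')
    (ha : a ∈ T) (ha' : a' ∈ T') (ha'' : a'' ∈ T'') (he : T.erase a = T'.erase a')
    (he' : T.erase a = T''.erase a'') : T' = T'' := by
  by_contra hne''
  have h1 := coord_opposite_neg hT hT' hne ha ha' he
  have h2 := coord_opposite_neg hT hT'' hne' ha ha'' he'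
  have h3 := coord_opposite_neg hT' hT'' hne'' ha' ha'' (he.symm.trans he')
  -- Three opposite vertices cannot lie pairwise on opposite sides of one hyperplane: this change of
  -- coordinates writes a negative number as a product of two negative ones.
  have h4 := ((𝒯.isSimplex hT).coord_eq_of_erase_eq (𝒯.isSimplex hT') ha ha' he a'').1
  have := mul_pos_of_neg_of_neg h3 h1
  linarith

/-- The relative interior of a face shared by two elements lies in the domain. -/
theorem mem_domain_of_mem_face (hΩ : interior (closure Ω) = Ω) (hT : T ∈ 𝒯.elements)
    (hT' : T' ∈ 𝒯.elements) (hne : T ≠ T') (ha : a ∈ T) (ha' : a' ∈ T')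
    (he : T.erase a = T'.erase a') {x : Vec d} (hxa : (𝒯.isSimplex hT).coord a x = 0)
    (hx : ∀ v ∈ T.erase a, 0 < (𝒯.isSimplex hT).coord v x) : x ∈ Ω := by
  have h := 𝒯.isSimplex hT
  have h' := 𝒯.isSimplex hT'
  have hneg : h.coord a a' < 0 := coord_opposite_neg hT hT' hne ha ha' he
  have hx0 : h'.coord a' x = 0 := by
    have := (h.coord_eq_of_erase_eq h' ha ha' he x).1
    rw [hxa] at this
    exact (mul_eq_zero.1 this.symm).resolve_right hneg.ne
  rw [← hΩ, mem_interior_iff_mem_nhds]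
  -- Near `x` only the coordinate at `a` can change sign, and its sign decides which of the two
  -- elements contains `y`. So a neighbourhood of `x` lies in the closure of `Ω`.
  have hev : ∀ᶠ y in 𝓝 x, ∀ v ∈ T.erase a, 0 < h.coord v y ∧ 0 < h'.coord v y := by
    rw [Finset.eventually_all]
    intro v hv
    have hv' : 0 < h'.coord v x := by
      have := (h.coord_eq_of_erase_eq h' ha ha' he x).2 v hv
      rw [hx0, zero_mul, add_zero] at this
      rw [← this]
      exact hx v hv
    exact ((h.continuous_coord v).continuousAt.eventually_const_lt (hx v hv)).and
      ((h'.continuous_coord v).continuousAt.eventually_const_lt hv')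
  filter_upwards [hev] with y hy
  rcases le_or_gt 0 (h.coord a y) with hya | hya
  · refine 𝒯.convexHull_subset_closure hT (h.mem_convexHull.2 fun v hv => ?_)
    by_cases hva : v = a
    · rwa [hva]
    · exact (hy v (Finset.mem_erase.2 ⟨hva, hv⟩)).1.le
  · refine 𝒯.convexHull_subset_closure hT' (h'.mem_convexHull.2 fun v hv => ?_)
    by_cases hva : v = a'
    · rw [hva]
      have := (h.coord_eq_of_erase_eq h' ha ha' he y).1
      nlinarith
    · exact (hy v (he ▸ Finset.mem_erase.2 ⟨hva, hv⟩)).2.le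

/-- The cone over a set of at most `d - 1` points is negligible. -/
theorem volume_affineSpan_insert_eq_zero {S : Finset (Vec d)} (hS : S.card + 1 ≤ d) (z : Vec d) :
    volume (affineSpan ℝ (insert z (S : Set (Vec d))) : Set (Vec d)) = 0 := by
  refine Measure.addHaar_affineSubspace _ _ fun htop => ?_
  have h1 : Module.finrank ℝ (vectorSpan ℝ (((insert z S).image id : Finset (Vec d)) : Set (Vec d))) ≤
      (insert z S).card - 1 :=
    finrank_vectorSpan_image_finset_le ℝ id (insert z S) (by
      have : 0 < (insert z S).card := Finset.card_pos.2 (Finset.insert_nonempty _ _)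
      omega)
  have h2 : (insert z S).card ≤ S.card + 1 := Finset.card_insert_le _ _
  rw [Finset.image_id, Finset.coe_insert, ← direction_affineSpan, htop, AffineSubspace.direction_top,
    finrank_top, finrank_euclideanSpace_fin] at h1
  have : 0 < (insert z S).card := Finset.card_pos.2 (Finset.insert_nonempty _ _)
  omega

/-- A function on the elements that takes the same value on any two elements meeting at a point of
a preconnected set `s` is constant on the elements that meet `s`. -/
theorem eq_of_isPreconnected {β : Type*} {p : Finset (Vec d) → β} {s : Set (Vec d)}
    (hs : IsPreconnected s) (hsΩ : s ⊆ closure Ω)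
    (hp : ∀ x ∈ s, ∀ T ∈ 𝒯.elements, ∀ T' ∈ 𝒯.elements, x ∈ convexHull ℝ (T : Set (Vec d)) →
      x ∈ convexHull ℝ (T' : Set (Vec d)) → p T = p T')
    (hT : T ∈ 𝒯.elements) (hT' : T' ∈ 𝒯.elements) {x y : Vec d} (hx : x ∈ s) (hy : y ∈ s)
    (hxT : x ∈ convexHull ℝ (T : Set (Vec d))) (hyT' : y ∈ convexHull ℝ (T' : Set (Vec d))) :
    p T = p T' := by
  by_contra hne
  have hcl : ∀ (Q : Finset (Vec d) → Prop) [DecidablePred Q],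
      IsClosed (⋃ S ∈ 𝒯.elements.filter Q, convexHull ℝ (S : Set (Vec d))) := fun Q _ =>
    Set.Finite.isClosed_biUnion (Finset.finite_toSet _) fun S _ =>
      IsSimplex.isCompact_convexHull.isClosed
  -- The elements with value `p T` and the others form two closed sets covering `s`. If both meet
  -- `s`, they meet each other inside `s`, where `p` has to agree.
  obtain ⟨w, hws, hw1, hw2⟩ := isPreconnected_closed_iff.1 hs _ _ (hcl fun S => p S = p T)
    (hcl fun S => p S ≠ p T) (fun w hw => by
      have hw' := hsΩ hw
      rw [← 𝒯.cover] at hw'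
      obtain ⟨S, hS, hwS⟩ := Set.mem_iUnion₂.1 hw'
      by_cases hSp : p S = p T
      · exact Or.inl (Set.mem_biUnion (Finset.mem_coe.2 (Finset.mem_filter.2 ⟨hS, hSp⟩)) hwS)
      · exact Or.inr (Set.mem_biUnion (Finset.mem_coe.2 (Finset.mem_filter.2 ⟨hS, hSp⟩)) hwS))
    ⟨x, hx, Set.mem_biUnion (Finset.mem_coe.2 (Finset.mem_filter.2 ⟨hT, rfl⟩)) hxT⟩
    ⟨y, hy, Set.mem_biUnion (Finset.mem_coe.2 (Finset.mem_filter.2 ⟨hT', Ne.symm hne⟩)) hyT'⟩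
  obtain ⟨S, hS, hwS⟩ := Set.mem_iUnion₂.1 hw1
  obtain ⟨S', hS', hwS'⟩ := Set.mem_iUnion₂.1 hw2
  rw [Finset.mem_filter] at hS hS'
  exact hS'.2 ((hp w hws S' hS'.1 S hS.1 hwS' hwS).trans hS.2)

/-- A function on the elements that takes the same value on elements sharing a face is constant
on the elements meeting a ball contained in the domain. -/
theorem eq_of_mem_ball {β : Type*} {p : Finset (Vec d) → β}
    (hp : ∀ T ∈ 𝒯.elements, ∀ T' ∈ 𝒯.elements, d ≤ (T ∩ T').card → p T = p T')
    {x : Vec d} {r : ℝ} (hr : Metric.ball x r ⊆ closure Ω) (hT : T ∈ 𝒯.elements)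
    (hT' : T' ∈ 𝒯.elements) {y z : Vec d} (hy : y ∈ Metric.ball x r) (hyT : y ∈ cell T)
    (hz : z ∈ Metric.ball x r) (hzT' : z ∈ cell T') : p T = p T' := by
  -- The bad pairs meet in codimension at least two. The cones over their intersections with apex
  -- `z` are null sets, so a generic segment ending at `z` avoids these intersections, except
  -- possibly at `z` itself.
  set P := (𝒯.elements ×ˢ 𝒯.elements).filter fun S => (S.1 ∩ S.2).card + 1 ≤ d with hP
  have hnull : volume (⋃ S ∈ P, (affineSpan ℝ (insert z ((S.1 ∩ S.2 : Finset (Vec d)) : Set (Vec d))) :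
      Set (Vec d))) = 0 := by
    refine (measure_biUnion_null_iff P.countable_toSet).2 fun S hS => ?_
    exact volume_affineSpan_insert_eq_zero (Finset.mem_filter.1 hS).2 z
  have hopen : IsOpen (Metric.ball x r ∩ cell T) := Metric.isOpen_ball.inter IsSimplex.isOpen_cell
  obtain ⟨y', ⟨hy'b, hy'T⟩, hy'⟩ : ∃ y' ∈ Metric.ball x r ∩ cell T, y' ∉ ⋃ S ∈ P,
      (affineSpan ℝ (insert z ((S.1 ∩ S.2 : Finset (Vec d)) : Set (Vec d))) : Set (Vec d)) := by
    by_contra! hcon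
    exact (hopen.measure_pos volume ⟨y, hy, hyT⟩).ne' (measure_mono_null hcon hnull)
  have hsub : ∀ w ∈ segment ℝ y' z, w ∈ closure Ω := fun w hw =>
    hr ((convex_ball x r).segment_subset hy'b hz hw)
  have hw_of : ∀ w ∈ segment ℝ y' z, ∀ T₁ ∈ 𝒯.elements, ∀ T₂ ∈ 𝒯.elements,
      w ∈ convexHull ℝ (T₁ : Set (Vec d)) → w ∈ convexHull ℝ (T₂ : Set (Vec d)) → p T₁ = p T₂ := by
    intro w hw T₁ hT₁ T₂ hT₂ h1 h2
    rcases eq_or_ne w z with rfl | hwz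
    · rw [← eq_of_mem_cell hT' hT₁ hzT' h1, ← eq_of_mem_cell hT' hT₂ hzT' h2]
    by_contra hne
    have hcard : (T₁ ∩ T₂).card + 1 ≤ d := by
      by_contra hcard
      exact hne (hp T₁ hT₁ T₂ hT₂ (by omega))
    have hwS : w ∈ convexHull ℝ ((T₁ ∩ T₂ : Finset (Vec d)) : Set (Vec d)) := by
      rw [Finset.coe_inter, ← 𝒯.conforming T₁ hT₁ T₂ hT₂]
      exact ⟨h1, h2⟩
    refine hy' (Set.mem_biUnion (x := (T₁, T₂))
      (Finset.mem_filter.2 ⟨Finset.mem_product.2 ⟨hT₁, hT₂⟩, hcard⟩) ?_)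
    rw [segment_eq_image_lineMap] at hw
    obtain ⟨t, ht, rfl⟩ := hw
    have ht1 : 1 - t ≠ 0 := fun h => hwz (by rw [show t = 1 by linarith, AffineMap.lineMap_apply_one])
    have hwA := affineSpan_mono ℝ (Set.subset_insert z ((T₁ ∩ T₂ : Finset (Vec d)) : Set (Vec d)))
      (convexHull_subset_affineSpan _ hwS)
    have hzA := subset_affineSpan ℝ _ (Set.mem_insert z ((T₁ ∩ T₂ : Finset (Vec d)) : Set (Vec d)))
    -- Solving `w = (1 - t) y' + t z` for `y'` would place `y'` in the excluded span of `z` and the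
    -- common vertices.
    have := AffineMap.lineMap_mem (1 - t)⁻¹ hzA hwA
    rw [SetLike.mem_coe]
    convert this using 1
    rw [AffineMap.lineMap_apply_module, AffineMap.lineMap_apply_module]
    rw [smul_add, smul_smul, smul_smul, inv_mul_cancel₀ ht1, one_smul, add_left_comm, ← add_smul]
    have : (1 - (1 - t)⁻¹ + (1 - t)⁻¹ * t) = 0 := by field_simp; ring
    rw [this, zero_smul, add_zero]
  exact eq_of_isPreconnected (convex_segment y' z).isPreconnected hsub hw_of hT hT'
    (left_mem_segment ℝ y' z) (right_mem_segment ℝ y' z) (interior_subset hy'T)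
    (interior_subset hzT')

/-- A function on the elements that takes the same value on elements sharing a face is constant. -/
theorem eq_of_eq_of_common_face (hΩ : interior (closure Ω) = Ω) (ho : IsOpen Ω)
    (hconn : IsPreconnected Ω) {β : Type*} {p : Finset (Vec d) → β}
    (hp : ∀ T ∈ 𝒯.elements, ∀ T' ∈ 𝒯.elements, d ≤ (T ∩ T').card → p T = p T')
    (hT : T ∈ 𝒯.elements) (hT' : T' ∈ 𝒯.elements) : p T = p T' := by
  obtain ⟨x, hx⟩ := (𝒯.isSimplex hT).cell_nonempty
  obtain ⟨y, hy⟩ := (𝒯.isSimplex hT').cell_nonempty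
  refine eq_of_isPreconnected hconn subset_closure (fun w hw S hS S' hS' hwS hwS' => ?_) hT hT'
    (𝒯.cell_subset hΩ hT hx) (𝒯.cell_subset hΩ hT' hy) (interior_subset hx) (interior_subset hy)
  -- Elements that meet at `w` in a vertex or an edge only are compared through the other elements
  -- in a ball around `w`; each element containing `w` has interior points in that ball.
  obtain ⟨r, hr0, hr⟩ := Metric.isOpen_iff.1 ho w hw
  have hmeet : ∀ S ∈ 𝒯.elements, w ∈ convexHull ℝ (S : Set (Vec d)) →
      ∃ y ∈ Metric.ball w r, y ∈ cell S := fun S hS hwS =>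
    mem_closure_iff.1 ((𝒯.isSimplex hS).convexHull_subset_closure_cell hwS) _ Metric.isOpen_ball
      (Metric.mem_ball_self hr0)
  obtain ⟨u, hu, huS⟩ := hmeet S hS hwS
  obtain ⟨u', hu', huS'⟩ := hmeet S' hS' hwS'
  exact eq_of_mem_ball hp (hr.trans subset_closure) hS hS' hu huS hu' huS'


end Triangulation

end TriangulationGeometry

/-! ### Fluxes through faces without surface integrals -/

section FaceFlux

open scoped Classical

variable {d : ℕ} {T T' : Finset (Vec d)} {a a' : Vec d} {χ : Vec d → ℝ}

/-- The flux of the field `χ(x) (x - a)` out of the simplex `T` (through the face opposite to the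
vertex `a`), written as the integral of its divergence. -/
noncomputable def faceFlux (T : Finset (Vec d)) (a : Vec d) (χ : Vec d → ℝ) : ℝ :=
  ∫ x in cell T, (inner ℝ (x - a) (gradient χ x) + d * χ x)

theorem integrableOn_cell {E : Type*} [NormedAddCommGroup E] {f : Vec d → E} (hf : Continuous f) :
    IntegrableOn f (cell T) :=
  (hf.continuousOn.integrableOn_compact IsSimplex.isCompact_convexHull).mono_set interior_subset

theorem continuous_gradient (hχ : ContDiff ℝ 1 χ) : Continuous (gradient χ) :=
  (InnerProductSpace.toDual ℝ (Vec d)).symm.continuous.comp (hχ.continuous_fderiv (by simp))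

theorem inner_gradient_eq (χ : Vec d → ℝ) (x y : Vec d) :
    inner ℝ y (gradient χ x) = fderiv ℝ χ x y := by
  rw [real_inner_comm, gradient, InnerProductSpace.toDual_symm_apply]

theorem hasDerivAt_comp_homothety (hχ : ContDiff ℝ 1 χ) (a x : Vec d) (t : ℝ) :
    HasDerivAt (fun t : ℝ => χ (a + t • (x - a))) (inner ℝ (x - a) (gradient χ (a + t • (x - a)))) t := by
  rw [inner_gradient_eq]
  have h1 : HasDerivAt (fun t : ℝ => a + t • (x - a)) (x - a) t := by
    simpa using ((hasDerivAt_id t).smul_const (x - a)).const_add a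
  exact ((hχ.differentiable (by simp)) _).hasFDerivAt.comp_hasDerivAt t h1

/-- For `t > 0` the differentiated quantity is the integral of `χ` over `T` scaled by `t` about `a`.
The derivative of `t ^ d` at `1` supplies the term `d χ` of the divergence, and differentiation
under the integral supplies the gradient term. -/
theorem hasDerivAt_integral_homothety (hχ : ContDiff ℝ 1 χ) (T : Finset (Vec d)) (a : Vec d) :
    HasDerivAt (fun t : ℝ => t ^ d * ∫ x in cell T, χ (a + t • (x - a))) (faceFlux T a χ) 1 := by
  have hcg := continuous_gradient hχ
  have hcχ := hχ.continuous
  have hc : Continuous fun q : ℝ × Vec d => inner ℝ (q.2 - a) (gradient χ (a + q.1 • (q.2 - a))) := by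
    fun_prop
  obtain ⟨C, hC⟩ := ((isCompact_Icc (a := (0 : ℝ)) (b := 2)).prod
    (IsSimplex.isCompact_convexHull (T := T))).exists_bound_of_continuousOn hc.continuousOn
  have h1 := (hasDerivAt_integral_of_dominated_loc_of_deriv_le (μ := volume.restrict (cell T))
    (F := fun (t : ℝ) x => χ (a + t • (x - a)))
    (F' := fun (t : ℝ) x => inner ℝ (x - a) (gradient χ (a + t • (x - a))))
    (x₀ := 1) (bound := fun _ => C) (s := Set.Icc 0 2) (Icc_mem_nhds (by norm_num) (by norm_num))
    (Eventually.of_forall fun t => by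
      have : Continuous fun x : Vec d => χ (a + t • (x - a)) := by fun_prop
      exact this.aestronglyMeasurable)
    (integrableOn_cell (by fun_prop))
    (by
      have : Continuous fun x : Vec d => inner ℝ (x - a) (gradient χ (a + (1 : ℝ) • (x - a))) := by
        fun_prop
      exact this.aestronglyMeasurable)
    (by
      filter_upwards [ae_restrict_mem IsSimplex.measurableSet_cell] with x hx t ht
      exact hC (t, x) ⟨ht, interior_subset hx⟩)
    (integrableOn_cell continuous_const)
    (Eventually.of_forall fun x t _ => hasDerivAt_comp_homothety hχ a x t)).2
  have h2 := (hasDerivAt_pow d (1 : ℝ)).mul h1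
  refine h2.congr_deriv ?_
  simp only [one_pow, mul_one, one_smul, one_mul, add_sub_cancel]
  rw [faceFlux, integral_add (integrableOn_cell (by fun_prop)) (integrableOn_cell (by fun_prop)),
    integral_const_mul, add_comm]

/-- The part of the simplex `T` close to the face opposite to the vertex `a`. -/
def IsSimplex.layer (h : IsSimplex T) (a : Vec d) (s : ℝ) : Set (Vec d) :=
  {x ∈ cell T | h.coord a x ≤ s}

theorem IsSimplex.measurableSet_layer (h : IsSimplex T) (a : Vec d) (s : ℝ) :
    MeasurableSet (h.layer a s) :=
  measurableSet_cell.inter (isClosed_le (h.continuous_coord a) continuous_const).measurableSet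

theorem IsSimplex.layer_subset (h : IsSimplex T) (a : Vec d) (s : ℝ) : h.layer a s ⊆ cell T :=
  fun _ hx => hx.1

theorem integral_image_affine {f : Vec d → Vec d} {L : Vec d →L[ℝ] Vec d}
    (hf : ∀ x, HasFDerivAt f L x) {s : Set (Vec d)} (hs : MeasurableSet s) (hinj : Set.InjOn f s)
    (g : Vec d → ℝ) : ∫ x in f '' s, g x = |L.det| * ∫ x in s, g (f x) := by
  rw [integral_image_eq_integral_abs_det_fderiv_smul volume hs
    (fun x _ => (hf x).hasFDerivWithinAt) hinj]
  simp only [smul_eq_mul, integral_const_mul]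

theorem hasFDerivAt_homothety (a : Vec d) (t : ℝ) (x : Vec d) :
    HasFDerivAt (fun x : Vec d => a + t • (x - a)) (t • ContinuousLinearMap.id ℝ (Vec d)) x :=
  (((hasFDerivAt_id x).sub_const a).const_smul t).const_add a

theorem integral_image_homothety (a : Vec d) {t : ℝ} (ht : 0 < t) {s : Set (Vec d)}
    (hs : MeasurableSet s) (g : Vec d → ℝ) :
    ∫ x in (fun x => a + t • (x - a)) '' s, g x = t ^ d * ∫ x in s, g (a + t • (x - a)) := by
  rw [integral_image_affine (hasFDerivAt_homothety a t) hs]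
  · congr 1
    rw [ContinuousLinearMap.det, ContinuousLinearMap.toLinearMap_smul, LinearMap.det_smul]
    simp [abs_of_pos (pow_pos ht d)]
  · intro x _ y _ hxy
    simpa [ht.ne'] using hxy

/-- Contraction about `a` multiplies every other coordinate by `t` and sends the coordinate `λ` at
`a` to `1 - t + t λ`. What it leaves uncovered is therefore a layer at the opposite face. -/
theorem IsSimplex.image_homothety_eq (h : IsSimplex T) (ha : a ∈ T) {t : ℝ} (ht : 0 < t)
    (ht1 : t ≤ 1) :
    (fun x => a + t • (x - a)) '' cell T = cell T \ h.layer a (1 - t) := by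
  have hcoord : ∀ v ∈ T, ∀ x, h.coord v (a + t • (x - a)) =
      (if v = a then 1 - t else 0) + t * h.coord v x := fun v hv x => by
    rw [h.coord_lineMap, h.coord_vertex hv ha]
    split_ifs <;> ring
  ext y
  constructor
  · rintro ⟨x, hx, rfl⟩
    have hx := h.mem_cell.1 hx
    refine ⟨h.mem_cell.2 fun v hv => ?_, fun hl => ?_⟩
    · rw [hcoord v hv]
      have := mul_pos ht (hx v hv)
      split_ifs <;> linarith
    · have := hl.2
      rw [hcoord a ha, if_pos rfl] at this
      have := mul_pos ht (hx a ha)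
      linarith
  · rintro ⟨hy, hyl⟩
    have hya : 1 - t < h.coord a y := not_le.1 fun hle => hyl ⟨hy, hle⟩
    have hy' := h.mem_cell.1 hy
    have hyx : a + t • ((a + t⁻¹ • (y - a)) - a) = y := by
      rw [add_sub_cancel_left, smul_inv_smul₀ ht.ne']; abel
    refine ⟨a + t⁻¹ • (y - a), h.mem_cell.2 fun v hv => ?_, hyx⟩
    have := hcoord v hv (a + t⁻¹ • (y - a))
    rw [hyx] at this
    by_contra hcon
    have hcon := mul_nonpos_of_nonneg_of_nonpos ht.le (not_lt.1 hcon)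
    split_ifs at this with hva
    · subst hva; linarith
    · linarith [hy' v hv]

/-- The flux through a face is the limit of averages over layers. -/
theorem IsSimplex.tendsto_integral_layer (h : IsSimplex T) (ha : a ∈ T) (hχ : ContDiff ℝ 1 χ) :
    Tendsto (fun s : ℝ => s⁻¹ * ∫ x in h.layer a s, χ x) (𝓝[>] 0) (𝓝 (faceFlux T a χ)) := by
  have h1 := hasDerivAt_iff_tendsto_slope_zero.1 (hasDerivAt_integral_homothety hχ T a)
  -- The difference quotient at `1` with increment `-s` compares `T` with its contraction by `1 -
  -- s`, and their difference is the layer of thickness `s`.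
  have h2 : Tendsto (fun s : ℝ => -s) (𝓝[>] 0) (𝓝[≠] 0) := by
    refine tendsto_nhdsWithin_iff.2 ⟨?_, ?_⟩
    · have : Tendsto (fun s : ℝ => -s) (𝓝 0) (𝓝 (-0)) := continuous_neg.continuousAt
      rw [neg_zero] at this
      exact this.mono_left nhdsWithin_le_nhds
    · filter_upwards [self_mem_nhdsWithin] with s hs
      have : 0 < s := hs
      simp [this.ne']
  refine (h1.comp h2).congr' ?_
  filter_upwards [Ioo_mem_nhdsGT (zero_lt_one (α := ℝ))] with s ⟨hs0, hs1⟩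
  have ht : 0 < 1 + -s := by linarith
  simp only [Function.comp]
  rw [← integral_image_homothety a ht measurableSet_cell,
    ← integral_image_homothety a one_pos measurableSet_cell, h.image_homothety_eq ha ht (by linarith)]
  have e1 : (fun x : Vec d => a + (1 : ℝ) • (x - a)) '' cell T = cell T := by simp
  have e2 : 1 - (1 + -s) = s := by ring
  rw [e1, e2, setIntegral_sdiff (h.measurableSet_layer a s)
    (integrableOn_cell hχ.continuous) (h.layer_subset a s)]
  rw [smul_eq_mul, inv_neg]
  ring

theorem faceFlux_one (T : Finset (Vec d)) (a : Vec d) :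
    faceFlux T a (fun _ => 1) = d * volume.real (cell T) := by
  simp [faceFlux, gradient, mul_comm]

theorem IsSimplex.tendsto_volume_layer (h : IsSimplex T) (ha : a ∈ T) :
    Tendsto (fun s : ℝ => s⁻¹ * volume.real (h.layer a s)) (𝓝[>] 0)
      (𝓝 (d * volume.real (cell T))) := by
  have := h.tendsto_integral_layer ha (χ := fun _ => 1) contDiff_const
  rw [faceFlux_one] at this
  simpa using this

theorem faceFlux_sub {η : Vec d → ℝ} (hχ : ContDiff ℝ 1 χ) (hη : ContDiff ℝ 1 η) :
    faceFlux T a (χ - η) = faceFlux T a χ - faceFlux T a η := by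
  have hcχ := continuous_gradient hχ
  have hcη := continuous_gradient hη
  have h1 := hχ.continuous
  have h2 := hη.continuous
  rw [faceFlux, faceFlux, faceFlux, ← integral_sub (integrableOn_cell (by fun_prop))
    (integrableOn_cell (by fun_prop))]
  refine integral_congr_ae (Eventually.of_forall fun x => ?_)
  have e : gradient (χ - η) x = gradient χ x - gradient η x := by
    simp [gradient, fderiv_sub ((hχ.differentiable (by simp)) x) ((hη.differentiable (by simp)) x)]
  simp only [e, inner_sub_right, Pi.sub_apply]
  ring

/-- The flux through a face only depends on the values on the face. -/
theorem IsSimplex.faceFlux_eq_zero (h : IsSimplex T) (ha : a ∈ T) (hd : 0 < d)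
    (hχ : ContDiff ℝ 1 χ)
    (h0 : ∀ x ∈ convexHull ℝ ((T.erase a : Finset (Vec d)) : Set (Vec d)), χ x = 0) :
    faceFlux T a χ = 0 := by
  obtain ⟨v₀, hv₀⟩ : (T.erase a).Nonempty := by
    rw [← Finset.card_pos, Finset.card_erase_of_mem ha, h.card_eq]; omega
  have hv₀T := Finset.mem_of_mem_erase hv₀
  have hunif := IsSimplex.isCompact_convexHull.uniformContinuousOn_of_continuous
    (s := convexHull ℝ (T : Set (Vec d))) hχ.continuous.continuousOn
  rw [Metric.uniformContinuousOn_iff] at hunif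
  have hlim := (h.tendsto_integral_layer ha hχ).abs
  suffices H : ∀ ε > 0, |faceFlux T a χ| ≤ ε * (d * volume.real (cell T)) by
    have hV := h.volume_real_cell_pos
    by_contra hne
    have hp := abs_pos.2 hne
    have hdV : 0 < d * volume.real (cell T) := by positivity
    have := H (|faceFlux T a χ| / 2 / (d * volume.real (cell T))) (by positivity)
    rw [div_mul_cancel₀ _ hdV.ne'] at this
    linarith
  intro ε hε
  obtain ⟨δ, hδ, hun⟩ := hunif ε hε
  refine le_of_tendsto_of_tendsto hlim ((h.tendsto_volume_layer ha).const_mul ε) ?_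
  have hs0 : 0 < δ / (‖v₀ - a‖ + 1) := by positivity
  filter_upwards [Ioo_mem_nhdsGT hs0] with s ⟨hs, hsδ⟩
  have hb : ∀ x ∈ h.layer a s, ‖χ x‖ ≤ ε := fun x hx => by
    have hxT := h.mem_cell.1 hx.1
    -- Transferring the weight of `a` to the face vertex `v₀` projects `x` onto the face. The
    -- displacement is at most `s ‖v₀ - a‖`, so uniform continuity makes `χ` small on the layer.
    have hy : x + h.coord a x • (v₀ - a) ∈
        convexHull ℝ ((T.erase a : Finset (Vec d)) : Set (Vec d)) := by
      have hcy : ∀ v ∈ T, h.coord v (x + h.coord a x • (v₀ - a)) = h.coord v x +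
          h.coord a x * ((if v = v₀ then 1 else 0) - (if v = a then 1 else 0)) := fun v hv => by
        rw [h.coord_add_smul, h.linear_sub, h.coord_vertex hv hv₀T, h.coord_vertex hv ha]
      have hav₀ : a ≠ v₀ := (Finset.ne_of_mem_erase hv₀).symm
      refine h.mem_convexHull_of_coord (Finset.erase_subset _ _) (fun v hv => ?_) fun v hv hva => ?_
      · rw [hcy v (Finset.mem_of_mem_erase hv), if_neg (Finset.ne_of_mem_erase hv)]
        have := hxT v (Finset.mem_of_mem_erase hv)
        have := hxT a ha
        split_ifs <;> linarith
      · have hva : v = a := by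
          by_contra hne
          exact hva (Finset.mem_erase.2 ⟨hne, hv⟩)
        rw [hcy v hv, hva, if_neg hav₀, if_pos rfl]
        ring
    have hd' : dist x (x + h.coord a x • (v₀ - a)) < δ := by
      rw [dist_eq_norm, sub_add_cancel_left, norm_neg, norm_smul, Real.norm_of_nonneg (hxT a ha).le]
      have h1 : h.coord a x * ‖v₀ - a‖ ≤ s * ‖v₀ - a‖ :=
        mul_le_mul_of_nonneg_right hx.2 (norm_nonneg _)
      have h2 : s * (‖v₀ - a‖ + 1) < δ := (lt_div_iff₀ (by positivity)).1 hsδ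
      nlinarith
    have := hun x (interior_subset hx.1) _
      (convexHull_mono (Finset.coe_subset.2 (Finset.erase_subset _ _)) hy) hd'
    rw [h0 _ hy, dist_zero_right] at this
    exact this.le
  have hfin : volume (h.layer a s) < ⊤ :=
    (measure_mono (h.layer_subset a s)).trans_lt volume_cell_lt_top
  have := norm_setIntegral_le_of_norm_le_const hfin hb
  rw [Real.norm_eq_abs] at this
  rw [abs_mul, abs_of_pos (inv_pos.2 hs)]
  calc s⁻¹ * |∫ x in h.layer a s, χ x| ≤ s⁻¹ * (ε * volume.real (h.layer a s)) := by gcongr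
    _ = _ := by ring

theorem IsSimplex.faceFlux_congr {η : Vec d → ℝ} (h : IsSimplex T) (ha : a ∈ T) (hd : 0 < d)
    (hχ : ContDiff ℝ 1 χ) (hη : ContDiff ℝ 1 η)
    (h0 : ∀ x ∈ convexHull ℝ ((T.erase a : Finset (Vec d)) : Set (Vec d)), χ x = η x) :
    faceFlux T a χ = faceFlux T a η := by
  have := h.faceFlux_eq_zero ha hd (hχ.sub hη) fun x hx => by simp [h0 x hx]
  change faceFlux T a (χ - η) = 0 at this
  rw [faceFlux_sub hχ hη] at this
  linarith

/-- The flux of a nonnegative function that is positive at the centroid of the face is positive. -/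
theorem IsSimplex.faceFlux_pos (h : IsSimplex T) (ha : a ∈ T) (hd : 0 < d)
    (hχ : ContDiff ℝ 1 χ) (h0 : ∀ x, 0 ≤ χ x) (hc : 0 < χ (centroid (T.erase a))) :
    0 < faceFlux T a χ := by
  have hne : (T.erase a).Nonempty := by
    rw [← Finset.card_pos, Finset.card_erase_of_mem ha, h.card_eq]; omega
  set c := centroid (T.erase a) with hc_def
  have hcoord : ∀ v ∈ T, 0 ≤ h.coord v c := fun v hv => by
    rw [h.coord_centroid hne (Finset.erase_subset _ _) hv]; split_ifs <;> positivity
  have hcoorda : h.coord a c = 0 := by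
    rw [h.coord_centroid hne (Finset.erase_subset _ _) ha, if_neg (Finset.notMem_erase _ _)]
  set ε := χ c / 2 with hε_def
  have hε : 0 < ε := by positivity
  obtain ⟨δ, hδ, hball⟩ := Metric.eventually_nhds_iff.1
    (hχ.continuous.continuousAt.eventually_const_lt (show ε < χ c by rw [hε_def]; linarith))
  obtain ⟨R, hR⟩ := (IsSimplex.isCompact_convexHull (T := T)).isBounded.subset_closedBall c
  -- Contracting the simplex by `r` about the centroid `c` brings it into the ball where `χ` exceeds
  -- `ε`.
  set r := min 1 (δ / (|R| + 1) / 2) with hr_def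
  have hr0 : 0 < r := by positivity
  have hr1 : r ≤ 1 := min_le_left _ _
  have hrR : r * (|R| + 1) < δ := by
    have : r * (|R| + 1) ≤ δ / (|R| + 1) / 2 * (|R| + 1) := by gcongr; exact min_le_right _ _
    have e : δ / (|R| + 1) / 2 * (|R| + 1) = δ / 2 := by field_simp
    linarith
  have hV := h.volume_real_cell_pos
  have hlim : Tendsto (fun s : ℝ => (ε * r ^ d * r⁻¹) * ((s / r)⁻¹ * volume.real (h.layer a (s / r))))
      (𝓝[>] 0) (𝓝 ((ε * r ^ d * r⁻¹) * (d * volume.real (cell T)))) := by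
    refine Tendsto.const_mul _ ((h.tendsto_volume_layer ha).comp (tendsto_nhdsWithin_iff.2 ⟨?_, ?_⟩))
    · have : Tendsto (fun s : ℝ => s / r) (𝓝 0) (𝓝 (0 / r)) :=
        (continuous_id.div_const r).continuousAt
      rw [zero_div] at this
      exact this.mono_left nhdsWithin_le_nhds
    · filter_upwards [self_mem_nhdsWithin] with s hs
      exact div_pos hs hr0
  have hpos : 0 < (ε * r ^ d * r⁻¹) * (d * volume.real (cell T)) := by positivity
  refine hpos.trans_le (le_of_tendsto_of_tendsto hlim (h.tendsto_integral_layer ha hχ) ?_)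
  filter_upwards [self_mem_nhdsWithin] with s hs
  have hs : 0 < s := hs
  -- As `c` lies on the face, contracting the layer of thickness `s / r` about `c` lands in the
  -- layer of thickness `s`. This piece has volume `r ^ d` times the original and `χ ≥ ε` on it, so
  -- the layer averages stay bounded away from zero.
  set C := (fun x => c + r • (x - c)) '' h.layer a (s / r) with hC
  have hCl : C ⊆ h.layer a s := by
    rintro _ ⟨x, hx, rfl⟩
    refine ⟨h.mem_cell.2 fun v hv => ?_, ?_⟩
    · rw [h.coord_lineMap]
      have h1 := mul_pos hr0 (h.mem_cell.1 hx.1 v hv)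
      have h2 := mul_nonneg (sub_nonneg.2 hr1) (hcoord v hv)
      linarith
    · rw [h.coord_lineMap, hcoorda, mul_zero, zero_add, mul_comm]
      exact (le_div_iff₀ hr0).1 hx.2
  have hCε : ∀ y ∈ C, ε ≤ χ y := by
    rintro _ ⟨x, hx, rfl⟩
    refine (hball ?_).le
    have h1 := hR (interior_subset hx.1)
    rw [Metric.mem_closedBall, dist_eq_norm] at h1
    rw [dist_eq_norm, add_sub_cancel_left, norm_smul, Real.norm_of_nonneg hr0.le]
    have h2 := le_abs_self R
    calc r * ‖x - c‖ ≤ r * (|R| + 1) := by gcongr; linarith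
      _ < δ := hrR
  have hCm : volume.real C = r ^ d * volume.real (h.layer a (s / r)) := by
    have := integral_image_homothety c hr0 (h.measurableSet_layer a (s / r)) (fun _ => 1)
    simpa using this
  have hCmeas : MeasurableSet C :=
    measurable_image_of_fderivWithin (h.measurableSet_layer a (s / r))
      (fun x _ => (hasFDerivAt_homothety c r x).hasFDerivWithinAt)
      (fun x _ y _ hxy => by simpa [hr0.ne'] using hxy)
  have hintl : IntegrableOn χ (h.layer a s) :=
    (integrableOn_cell hχ.continuous).mono_set (h.layer_subset a s)
  have hfin : volume C ≠ ⊤ := ((measure_mono (hCl.trans (h.layer_subset a s))).trans_lt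
    volume_cell_lt_top).ne
  have h1 : ε * volume.real C ≤ ∫ x in h.layer a s, χ x := by
    calc ε * volume.real C = ∫ x in C, ε := by simp [mul_comm]
      _ ≤ ∫ x in C, χ x := setIntegral_mono_on (integrableOn_const hfin) (hintl.mono_set hCl)
          hCmeas hCε
      _ ≤ _ := setIntegral_mono_set hintl (Eventually.of_forall h0) hCl.eventuallyLE
  rw [hCm] at h1
  calc _ = s⁻¹ * (ε * (r ^ d * volume.real (h.layer a (s / r)))) := by field_simp
    _ ≤ _ := by gcongr

/-- The affine map that carries `T` to a simplex with a common face, fixing the face and mapping the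
opposite vertex `a` to `a'`. -/
noncomputable def IsSimplex.shear (h : IsSimplex T) (a a' : Vec d) (x : Vec d) : Vec d :=
  x + h.coord a x • (a' - a)

/-- The shear keeps the barycentric weights and only replaces the vertex `a` by `a'`. Hence it
carries each layer of `T` onto the layer of `T'` of the same thickness. -/
theorem IsSimplex.coord_shear (h : IsSimplex T) (h' : IsSimplex T') (ha : a ∈ T) (ha' : a' ∈ T')
    (he : T.erase a = T'.erase a') (x : Vec d) :
    h'.coord a' (h.shear a a' x) = h.coord a x ∧
      ∀ v ∈ T.erase a, h'.coord v (h.shear a a' x) = h.coord v x := by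
  have hx : h.shear a a' x = ∑ u ∈ T, h.coord u x • (if u = a then a' else u) := by
    have : ∀ u ∈ T, h.coord u x • (if u = a then a' else u) =
        h.coord u x • u + (if u = a then h.coord u x • (a' - a) else 0) := fun u _ => by
      split_ifs with hu
      · rw [hu, ← smul_add]; congr 1; abel
      · rw [add_zero]
    rw [Finset.sum_congr rfl this, Finset.sum_add_distrib, h.sum_coord_smul,
      Finset.sum_ite_eq' T a, if_pos ha, shear]
  rw [hx]
  have hmem : ∀ u ∈ T, (if u = a then a' else u) ∈ T' := fun u hu => by
    split_ifs with hua
    · exact ha'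
    · exact Finset.mem_of_mem_erase (he ▸ Finset.mem_erase.2 ⟨hua, hu⟩)
  refine ⟨?_, fun v hv => ?_⟩
  · rw [h'.coord_sum (h.sum_coord x), Finset.sum_eq_single_of_mem a ha, if_pos rfl,
      h'.coord_self ha', mul_one]
    intro u hu hua
    have : u ∈ T'.erase a' := he ▸ Finset.mem_erase.2 ⟨hua, hu⟩
    rw [if_neg hua, h'.coord_ne ha' (Finset.mem_of_mem_erase this)
      (Finset.ne_of_mem_erase this).symm, mul_zero]
  · have hv' : v ∈ T'.erase a' := he ▸ hv
    have hvT' := Finset.mem_of_mem_erase hv'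
    rw [h'.coord_sum (h.sum_coord x), Finset.sum_eq_single_of_mem v (Finset.mem_of_mem_erase hv),
      if_neg (Finset.ne_of_mem_erase hv), h'.coord_self hvT', mul_one]
    intro u hu huv
    refine mul_eq_zero_of_right _ (h'.coord_ne hvT' (hmem u hu) ?_)
    split_ifs with hua
    · exact Finset.ne_of_mem_erase hv'
    · exact huv.symm

theorem IsSimplex.shear_shear (h : IsSimplex T) (h' : IsSimplex T') (ha : a ∈ T) (ha' : a' ∈ T')
    (he : T.erase a = T'.erase a') (x : Vec d) : h'.shear a' a (h.shear a a' x) = x := by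
  refine h.ext_coord fun v hv => ?_
  by_cases hva : v = a
  · rw [hva, (h'.coord_shear h ha' ha he.symm _).1, (h.coord_shear h' ha ha' he _).1]
  · have hve : v ∈ T.erase a := Finset.mem_erase.2 ⟨hva, hv⟩
    rw [(h'.coord_shear h ha' ha he.symm _).2 v (he ▸ hve), (h.coord_shear h' ha ha' he _).2 v hve]

theorem IsSimplex.shear_mem_layer (h : IsSimplex T) (h' : IsSimplex T') (ha : a ∈ T)
    (ha' : a' ∈ T') (he : T.erase a = T'.erase a') {s : ℝ} {x : Vec d} (hx : x ∈ h.layer a s) :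
    h.shear a a' x ∈ h'.layer a' s := by
  obtain ⟨e1, e2⟩ := h.coord_shear h' ha ha' he x
  refine ⟨h'.mem_cell.2 fun v hv => ?_, by rw [e1]; exact hx.2⟩
  by_cases hva : v = a'
  · rw [hva, e1]; exact h.mem_cell.1 hx.1 a ha
  · have hve : v ∈ T.erase a := he ▸ Finset.mem_erase.2 ⟨hva, hv⟩
    rw [e2 v hve]; exact h.mem_cell.1 hx.1 v (Finset.mem_of_mem_erase hve)

theorem IsSimplex.image_shear_layer (h : IsSimplex T) (h' : IsSimplex T') (ha : a ∈ T)
    (ha' : a' ∈ T') (he : T.erase a = T'.erase a') (s : ℝ) :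
    h.shear a a' '' h.layer a s = h'.layer a' s := by
  refine subset_antisymm ?_ fun y hy => ?_
  · rintro _ ⟨x, hx, rfl⟩
    exact h.shear_mem_layer h' ha ha' he hx
  · exact ⟨h'.shear a' a y, h'.shear_mem_layer h ha' ha he.symm hy,
      h'.shear_shear h ha' ha he.symm y⟩

theorem IsSimplex.hasFDerivAt_coord (h : IsSimplex T) (a x : Vec d) :
    HasFDerivAt (h.coord a) (LinearMap.toContinuousLinearMap (h.coord a).linear) x := by
  have : ⇑(h.coord a) = fun y => LinearMap.toContinuousLinearMap (h.coord a).linear y +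
      h.coord a 0 := funext fun y => by
    have := h.linear_sub a y 0
    rw [sub_zero] at this
    rw [LinearMap.coe_toContinuousLinearMap', this, sub_add_cancel]
  rw [this]
  exact (ContinuousLinearMap.hasFDerivAt _).add_const _

theorem IsSimplex.contDiff_coord (h : IsSimplex T) (a : Vec d) {n : WithTop ℕ∞} :
    ContDiff ℝ n (h.coord a) :=
  (⟨h.coord a, h.continuous_coord a⟩ : Vec d →ᴬ[ℝ] ℝ).contDiff

theorem IsSimplex.contDiff_shear (h : IsSimplex T) (a a' : Vec d) {n : WithTop ℕ∞} :
    ContDiff ℝ n (h.shear a a') :=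
  contDiff_id.add ((h.contDiff_coord a).smul contDiff_const)

theorem IsSimplex.layer_one (h : IsSimplex T) (ha : a ∈ T) : h.layer a 1 = cell T := by
  refine subset_antisymm (h.layer_subset a 1) fun x hx => ⟨hx, ?_⟩
  rw [← h.sum_coord x]
  exact Finset.single_le_sum (fun v hv => (h.mem_cell.1 hx v hv).le) ha

/-- The average flux through a common face does not depend on the element. -/
theorem IsSimplex.faceFlux_div_eq (h : IsSimplex T) (h' : IsSimplex T') (ha : a ∈ T)
    (ha' : a' ∈ T') (he : T.erase a = T'.erase a') (hd : 0 < d) (hχ : ContDiff ℝ 1 χ) :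
    faceFlux T' a' χ / volume.real (cell T') = faceFlux T a χ / volume.real (cell T) := by
  set L : Vec d →L[ℝ] Vec d := ContinuousLinearMap.id ℝ (Vec d) +
    (LinearMap.toContinuousLinearMap (h.coord a).linear).smulRight (a' - a) with hL
  have hM : ∀ x, HasFDerivAt (h.shear a a') L x := fun x =>
    (hasFDerivAt_id x).add ((h.hasFDerivAt_coord a x).smul_const (a' - a))
  have himg : ∀ (s : ℝ) (g : Vec d → ℝ), ∫ x in h'.layer a' s, g x =
      |L.det| * ∫ x in h.layer a s, g (h.shear a a' x) := fun s g => by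
    rw [← h.image_shear_layer h' ha ha' he s, integral_image_affine hM (h.measurableSet_layer a s)]
    intro x _ y _ hxy
    rw [← h.shear_shear h' ha ha' he x, hxy, h.shear_shear h' ha ha' he y]
  -- The layer of thickness `1` is the whole cell, so the Jacobian is the ratio of the volumes; the
  -- flux picks up the same factor.
  have hvol : volume.real (cell T') = |L.det| * volume.real (cell T) := by
    have := himg 1 (fun _ => 1)
    rw [h.layer_one ha, h'.layer_one ha'] at this
    simpa using this
  have hflux : faceFlux T' a' χ = |L.det| * faceFlux T a (χ ∘ h.shear a a') := by
    refine tendsto_nhds_unique (h'.tendsto_integral_layer ha' hχ) ?_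
    refine ((h.tendsto_integral_layer ha (hχ.comp (h.contDiff_shear a a'))).const_mul
      |L.det|).congr fun s => ?_
    rw [himg, mul_left_comm]; rfl
  -- The shear is the identity on the common face, and the flux depends only on the values there.
  have hcongr : faceFlux T a (χ ∘ h.shear a a') = faceFlux T a χ := by
    refine h.faceFlux_congr ha hd (hχ.comp (h.contDiff_shear a a')) hχ fun x hx => ?_
    rw [Function.comp, shear, h.coord_eq_zero_of_mem_convexHull (Finset.erase_subset _ _) hx ha
      (Finset.notMem_erase _ _), zero_smul, add_zero]
  have hV := h.volume_real_cell_pos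
  have hV' := h'.volume_real_cell_pos
  rw [hflux, hcongr, hvol, mul_div_mul_left]
  intro h0
  rw [hvol, h0, zero_mul] at hV'
  exact hV'.ne rfl

end FaceFlux

/-! ### Weak derivatives, Poincaré's inequality and integration by parts -/

section WeakDerivatives

variable {d : ℕ} {U V : Set (Vec d)}

theorem IsTest.mono {φ : Vec d → ℝ} (h : IsTest U φ) (hUV : U ⊆ V) : IsTest V φ :=
  ⟨h.1, h.2.1, h.2.2.trans hUV⟩

theorem IsTest.eq_zero {φ : Vec d → ℝ} (h : IsTest U φ) {x : Vec d} (hx : x ∉ U) : φ x = 0 :=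
  image_eq_zero_of_notMem_tsupport fun hx' => hx (h.2.2 hx')

theorem IsTest.gradient_eq_zero {φ : Vec d → ℝ} (h : IsTest U φ) {x : Vec d} (hx : x ∉ U) :
    gradient φ x = 0 := by
  rw [gradient, fderiv_of_notMem_tsupport (𝕜 := ℝ) fun hx' => hx (h.2.2 hx'), map_zero]

theorem gradient_apply (φ : Vec d → ℝ) (x : Vec d) (i : Fin d) :
    gradient φ x i = fderiv ℝ φ x (EuclideanSpace.single i 1) := by
  rw [← inner_gradient_eq, EuclideanSpace.inner_single_left]
  simp

theorem memLp_apply {g : Vec d → Vec d} {μ : Measure (Vec d)} (hg : MemLp g 2 μ) (i : Fin d) :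
    MemLp (fun x => g x i) 2 μ :=
  (EuclideanSpace.proj i : Vec d →L[ℝ] ℝ).comp_memLp' hg

theorem integral_apply {g : Vec d → Vec d} {μ : Measure (Vec d)} (hg : Integrable g μ) (i : Fin d) :
    (∫ x, g x ∂μ) i = ∫ x, g x i ∂μ :=
  ((EuclideanSpace.proj i : Vec d →L[ℝ] ℝ).integral_comp_comm hg).symm

/-- A test function on `U`, and its gradient, vanish off `U`, so the defining integrals over `U` and
`V` coincide. -/
theorem HasWeakGrad.mono {w : Vec d → ℝ} {g : Vec d → Vec d} (h : HasWeakGrad V w g)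
    (hV : MeasurableSet V) (hUV : U ⊆ V) : HasWeakGrad U w g := by
  refine ⟨h.1.mono_measure (Measure.restrict_mono hUV le_rfl),
    h.2.1.mono_measure (Measure.restrict_mono hUV le_rfl), fun φ hφ => ?_⟩
  have := h.2.2 φ (hφ.mono hUV)
  rwa [setIntegral_eq_of_subset_of_forall_sdiff_eq_zero hV hUV fun x hx => by
      rw [hφ.gradient_eq_zero hx.2, smul_zero],
    setIntegral_eq_of_subset_of_forall_sdiff_eq_zero hV hUV fun x hx => by
      rw [hφ.eq_zero hx.2, zero_smul]] at this

theorem HasWeakDiv.mono {v : Vec d → Vec d} {δ : Vec d → ℝ} (h : HasWeakDiv V v δ)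
    (hV : MeasurableSet V) (hUV : U ⊆ V) : HasWeakDiv U v δ := by
  refine ⟨h.1.mono_measure (Measure.restrict_mono hUV le_rfl),
    h.2.1.mono_measure (Measure.restrict_mono hUV le_rfl), fun φ hφ => ?_⟩
  have := h.2.2 φ (hφ.mono hUV)
  rwa [setIntegral_eq_of_subset_of_forall_sdiff_eq_zero hV hUV fun x hx => by
      rw [hφ.gradient_eq_zero hx.2, inner_zero_right],
    setIntegral_eq_of_subset_of_forall_sdiff_eq_zero hV hUV fun x hx => by
      rw [hφ.eq_zero hx.2, mul_zero]] at this

/-- The fundamental lemma of the calculus of variations, from which the uniqueness of weak gradients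
and divergences follows. -/
theorem ae_eq_of_integral_test_eq {E : Type*} [NormedAddCommGroup E] [NormedSpace ℝ E]
    [CompleteSpace E] (hU : IsOpen U) {f g : Vec d → E} (hf : MemLp f 2 (volume.restrict U))
    (hg : MemLp g 2 (volume.restrict U))
    (h : ∀ φ, IsTest U φ → ∫ x in U, φ x • f x = ∫ x in U, φ x • g x) :
    f =ᵐ[volume.restrict U] g := by
  have hloc : LocallyIntegrableOn (f - g) U := by
    have := (hf.sub hg).locallyIntegrable (by norm_num)
    exact locallyIntegrableOn_of_locallyIntegrable_restrict this
  have := hU.ae_eq_zero_of_integral_contDiff_smul_eq_zero hloc fun φ h1 h2 h3 => by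
    have hφ : IsTest U φ := ⟨h1, h2, h3⟩
    rw [← setIntegral_eq_integral_of_forall_compl_eq_zero (s := U) fun x hx => by
      rw [hφ.eq_zero hx, zero_smul]]
    simp only [Pi.sub_apply, smul_sub]
    have i1 : Integrable (fun x => φ x • f x) (volume.restrict U) :=
      memLp_one_iff_integrable.1 (hf.smul hφ.memLp)
    have i2 : Integrable (fun x => φ x • g x) (volume.restrict U) :=
      memLp_one_iff_integrable.1 (hg.smul hφ.memLp)
    rw [integral_sub i1 i2, h φ hφ, sub_self]
  rw [EventuallyEq, ae_restrict_iff' hU.measurableSet]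
  filter_upwards [this] with x hx hxU
  exact sub_eq_zero.1 (hx hxU)

theorem HasWeakGrad.ae_eq {w w' : Vec d → ℝ} {g g' : Vec d → Vec d} (hU : IsOpen U)
    (h : HasWeakGrad U w g) (h' : HasWeakGrad U w' g') (hw : w =ᵐ[volume.restrict U] w') :
    g =ᵐ[volume.restrict U] g' :=
  ae_eq_of_integral_test_eq hU h.2.1 h'.2.1 fun φ hφ =>
    neg_injective (((h.congr hw).2.2 φ hφ).symm.trans (h'.2.2 φ hφ))

theorem HasWeakDiv.ae_eq {v v' : Vec d → Vec d} {δ δ' : Vec d → ℝ} (hU : IsOpen U)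
    (h : HasWeakDiv U v δ) (h' : HasWeakDiv U v' δ') (hv : v =ᵐ[volume.restrict U] v') :
    δ =ᵐ[volume.restrict U] δ' := by
  refine ae_eq_of_integral_test_eq hU h.2.1 h'.2.1 fun φ hφ => ?_
  have h1 := h.2.2 φ hφ
  have h2 := h'.2.2 φ hφ
  have h3 : ∫ x in U, inner ℝ (v x) (gradient φ x) = ∫ x in U, inner ℝ (v' x) (gradient φ x) :=
    integral_congr_ae (by filter_upwards [hv] with x hx; rw [hx])
  simp only [smul_eq_mul, mul_comm (φ _)]
  linarith

theorem weakGrad_ae_eq {w : Vec d → ℝ} {g : Vec d → Vec d} (hU : IsOpen U)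
    (h : HasWeakGrad U w g) : weakGrad U w =ᵐ[volume.restrict U] g := by
  have hex : ∃ g, HasWeakGrad U w g := ⟨g, h⟩
  rw [weakGrad, dif_pos hex]
  exact hex.choose_spec.ae_eq hU h (ae_eq_refl _)

theorem weakDiv_ae_eq {v : Vec d → Vec d} {δ : Vec d → ℝ} (hU : IsOpen U)
    (h : HasWeakDiv U v δ) : weakDiv U v =ᵐ[volume.restrict U] δ := by
  have hex : ∃ δ, HasWeakDiv U v δ := ⟨δ, h⟩
  rw [weakDiv, dif_pos hex]
  exact hex.choose_spec.ae_eq hU h (ae_eq_refl _)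

theorem memLp_of_continuous {E : Type*} [NormedAddCommGroup E] {f : Vec d → E}
    (hf : Continuous f) (hU : Bornology.IsBounded U) (p : ℝ≥0∞) : MemLp f p (volume.restrict U) := by
  obtain ⟨C, hC⟩ := hU.isCompact_closure.exists_bound_of_continuousOn hf.continuousOn
  have : IsFiniteMeasure (volume.restrict U) :=
    ⟨by rw [Measure.restrict_apply_univ]; exact hU.measure_lt_top⟩
  have : MemLp f p (volume.restrict (closure U)) := by
    have : IsFiniteMeasure (volume.restrict (closure U)) :=
      ⟨by rw [Measure.restrict_apply_univ]; exact hU.isCompact_closure.measure_lt_top⟩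
    refine MemLp.of_bound hf.aestronglyMeasurable C ?_
    filter_upwards [ae_restrict_mem isClosed_closure.measurableSet] with x hx
    exact hC x hx
  exact this.mono_measure (Measure.restrict_mono subset_closure le_rfl)

/-- The classical gradient is a weak gradient. -/
theorem hasWeakGrad_of_contDiff {χ : Vec d → ℝ} (hχ : ContDiff ℝ 1 χ)
    (hU : Bornology.IsBounded U) : HasWeakGrad U χ (gradient χ) := by
  have hg := continuous_gradient hχ
  have m1 := memLp_of_continuous hχ.continuous hU 2
  have m2 := memLp_of_continuous hg hU 2
  refine ⟨m1, m2, fun φ hφ => ?_⟩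
  refine ext_inner_left ℝ fun v => ?_
  rw [inner_neg_right, ← integral_inner (integrable_smul_of_memLp m1 hφ.memLp_gradient),
    ← integral_inner (integrable_smul_of_memLp hφ.memLp m2)]
  simp only [real_inner_smul_right, inner_gradient_eq]
  rw [setIntegral_eq_integral_of_forall_compl_eq_zero (s := U) fun x hx => by
      rw [← inner_gradient_eq, hφ.gradient_eq_zero hx, inner_zero_right, mul_zero],
    setIntegral_eq_integral_of_forall_compl_eq_zero (s := U) fun x hx => by
      rw [hφ.eq_zero hx, zero_mul]]
  have c1 := hχ.continuous
  have c2 := hφ.1.continuous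
  have c3 : Continuous fun x => fderiv ℝ χ x v := by
    have := hχ.continuous_fderiv (by simp); fun_prop
  have c4 : Continuous fun x => fderiv ℝ φ x v := by
    have := hφ.1.continuous_fderiv (by simp); fun_prop
  have s4 : HasCompactSupport fun x => fderiv ℝ φ x v := hφ.2.1.fderiv_apply (𝕜 := ℝ) v
  rw [integral_mul_fderiv_eq_neg_fderiv_mul_of_integrable]
  · simp only [mul_comm]
  · exact (c3.mul c2).integrable_of_hasCompactSupport hφ.2.1.mul_left
  · exact (c1.mul c4).integrable_of_hasCompactSupport s4.mul_left
  · exact (c1.mul c2).integrable_of_hasCompactSupport hφ.2.1.mul_left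
  · exact fun x _ => (hχ.differentiable (by simp)) x
  · exact fun x _ => (hφ.1.differentiable (by simp)) x

/-- The divergence is the trace of the weak Jacobian: take the `i`-th component of the identity for
`v i` and sum over `i`. -/
theorem HasWeakDiv.of_hasWeakGrad {v : Vec d → Vec d} {g : Fin d → Vec d → Vec d}
    (hv : MemLp v 2 (volume.restrict U)) (h : ∀ i, HasWeakGrad U (fun x => v x i) (g i)) :
    HasWeakDiv U v (fun x => ∑ i, g i x i) := by
  refine ⟨hv, memLp_finsetSum _ fun i _ => memLp_apply (h i).2.1 i, fun φ hφ => ?_⟩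
  have key : ∀ i, ∫ x in U, v x i * gradient φ x i = -∫ x in U, g i x i * φ x := fun i => by
    have := congrArg (fun y : Vec d => y i) ((h i).2.2 φ hφ)
    simp only [PiLp.neg_apply] at this
    rw [integral_apply (integrable_smul_of_memLp (h i).1 hφ.memLp_gradient),
      integral_apply (integrable_smul_of_memLp hφ.memLp (h i).2.1)] at this
    simpa [mul_comm] using this
  simp only [PiLp.inner_apply, RCLike.inner_apply, conj_trivial, Finset.sum_mul]
  rw [integral_finsetSum _ fun i _ =>
      integrable_mul_of_memLp (memLp_apply hφ.memLp_gradient i) (h i).1,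
    integral_finsetSum _ fun i _ => integrable_mul_of_memLp (memLp_apply (h i).2.1 i) hφ.memLp,
    ← Finset.sum_neg_distrib]
  exact Finset.sum_congr rfl fun i _ => by rw [← key i]; simp only [mul_comm]

theorem gradient_inner_add (c : Vec d) (b : ℝ) (x : Vec d) :
    gradient (fun x => inner ℝ c x + b) x = c := by
  have : HasFDerivAt (fun x => inner ℝ c x + b) (innerSL ℝ c) x :=
    (innerSL ℝ c).hasFDerivAt.add_const b
  rw [gradient, this.fderiv]
  exact (InnerProductSpace.toDual ℝ (Vec d)).symm_apply_apply c

/-- The weak gradient of an affine function. -/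
theorem hasWeakGrad_affine (c : Vec d) (b : ℝ) (hU : Bornology.IsBounded U) :
    HasWeakGrad U (fun x => inner ℝ c x + b) (fun _ => c) := by
  have h : ContDiff ℝ 1 fun x : Vec d => inner ℝ c x + b :=
    ((innerSL ℝ c).contDiff).add contDiff_const
  have := hasWeakGrad_of_contDiff h hU
  rwa [show gradient (fun x : Vec d => inner ℝ c x + b) = fun _ => c from
    funext (gradient_inner_add c b)] at this

theorem IsTest.mul_self {φ : Vec d → ℝ} (h : IsTest U φ) : IsTest U (φ * φ) :=
  ⟨h.1.mul h.1, h.2.1.mul_left, (tsupport_mul_subset_left).trans h.2.2⟩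

/-- Poincaré's inequality in a coordinate direction. -/
theorem IsTest.integral_sq_le {φ : Vec d → ℝ} (h : IsTest U φ) (ho : IsOpen U) {R : ℝ}
    (hU : ∀ x ∈ U, ‖x‖ ≤ R) (j : Fin d) :
    ∫ x in U, φ x ^ 2 ≤ (2 * R) ^ 2 * ∫ x in U, gradient φ x j ^ 2 := by
  have hm := memLp_apply h.memLp_gradient j
  set e : Vec d := EuclideanSpace.single j 1 with he
  have hb : Bornology.IsBounded U := isBounded_iff_forall_norm_le.2 ⟨R, hU⟩
  have hw := hasWeakGrad_affine e 0 hb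
  have hex : ∀ x, inner ℝ e x + 0 = x j := fun x => by
    rw [he, EuclideanSpace.inner_single_left]; simp
  have hgrad : ∀ x, gradient (φ * φ) x j = 2 * (φ x * gradient φ x j) := fun x => by
    have hdφ := (h.1.differentiable (by simp)) x
    rw [gradient_apply, gradient_apply, fderiv_mul hdφ hdφ]
    simp only [add_apply, smul_apply, smul_eq_mul]
    ring
  -- The coordinate function `x j` has gradient `e`; testing it with `φ²` gives `∫ φ² = -∫ 2 x_j φ
  -- ∂_j φ`.
  have hparts := congrArg (fun y : Vec d => y j) (hw.2.2 _ h.mul_self)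
  simp only [PiLp.neg_apply] at hparts
  rw [integral_apply (integrable_smul_of_memLp hw.1 h.mul_self.memLp_gradient),
    integral_apply (integrable_smul_of_memLp h.mul_self.memLp hw.2.1)] at hparts
  have hej : e j = 1 := by simp [he]
  simp only [hex, PiLp.smul_apply, hgrad, smul_eq_mul, hej, mul_one, Pi.mul_apply] at hparts
  have hi1 : Integrable (fun x => φ x * φ x) (volume.restrict U) :=
    integrable_mul_of_memLp h.memLp h.memLp
  have hi2 : Integrable (fun x => gradient φ x j * gradient φ x j) (volume.restrict U) :=
    integrable_mul_of_memLp hm hm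
  have hle : ∫ x in U, φ x * φ x ≤
      ∫ x in U, (1 / 2 * (φ x * φ x) + 2 * R ^ 2 * (gradient φ x j * gradient φ x j)) := by
    have e1 : ∫ x in U, φ x * φ x = ∫ x in U, -(x j * (2 * (φ x * gradient φ x j))) := by
      rw [integral_neg, hparts, neg_neg]
    rw [e1]
    refine integral_mono_ae ?_ ((hi1.const_mul _).add (hi2.const_mul _)) ?_
    · have : Integrable (fun x => x j * gradient (φ * φ) x j) (volume.restrict U) := by
        have := integrable_mul_of_memLp hw.1 (memLp_apply h.mul_self.memLp_gradient j)
        simpa only [hex] using this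
      simp only [hgrad] at this
      exact this.neg
    · filter_upwards [ae_restrict_mem ho.measurableSet] with x hx
      have hxj : |x j| ≤ R := (PiLp.norm_apply_le x j).trans (hU x hx)
      have h1 : x j ^ 2 ≤ R ^ 2 := sq_le_sq' (abs_le.1 hxj).1 (abs_le.1 hxj).2
      have h2 := mul_le_mul_of_nonneg_right h1 (sq_nonneg (gradient φ x j))
      -- Young's inequality with weight `1 / 2` on `φ²`; absorbing that half produces the constant
      -- `4 R² = (2 R)²`.
      nlinarith [sq_nonneg (φ x + 2 * (x j * gradient φ x j))]
  simp only [pow_two]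
  rw [integral_add (hi1.const_mul _) (hi2.const_mul _), integral_const_mul,
    integral_const_mul] at hle
  linarith

theorem IsTest.eLpNorm_le {φ : Vec d → ℝ} (h : IsTest U φ) (ho : IsOpen U) {R : ℝ} (hR : 0 ≤ R)
    (hU : ∀ x ∈ U, ‖x‖ ≤ R) (j : Fin d) :
    eLpNorm φ 2 (volume.restrict U) ≤
      ENNReal.ofReal (2 * R) * eLpNorm (fun x => gradient φ x j) 2 (volume.restrict U) := by
  have hm := memLp_apply h.memLp_gradient j
  rw [h.memLp.eLpNorm_eq_integral_rpow_norm (by norm_num) (by norm_num),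
    hm.eLpNorm_eq_integral_rpow_norm (by norm_num) (by norm_num),
    ← ENNReal.ofReal_mul (by positivity)]
  refine ENNReal.ofReal_le_ofReal ?_
  simp only [ENNReal.toReal_ofNat, Real.rpow_ofNat, Real.norm_eq_abs, sq_abs]
  rw [← one_div, ← Real.sqrt_eq_rpow, ← Real.sqrt_eq_rpow]
  refine Real.sqrt_le_iff.2 ⟨by positivity, ?_⟩
  rw [mul_pow, Real.sq_sqrt (integral_nonneg fun _ => sq_nonneg _)]
  exact h.integral_sq_le ho hU j

/-- A function in `H¹₀` of a bounded set is zero if one of its partial derivatives vanishes. -/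
theorem MemH10.ae_eq_zero {w : Vec d → ℝ} {g : Vec d → Vec d} (h : MemH10 U w) (hU : IsOpen U)
    (hb : Bornology.IsBounded U) (hg : HasWeakGrad U w g) (j : Fin d)
    (hj : ∀ᵐ x ∂volume.restrict U, g x j = 0) : w =ᵐ[volume.restrict U] 0 := by
  obtain ⟨g', hg', φ, hφ, h1, h2⟩ := h
  have hgg := hg'.ae_eq hU hg (ae_eq_refl _)
  obtain ⟨R, hR0, hR⟩ : ∃ R, 0 ≤ R ∧ ∀ x ∈ U, ‖x‖ ≤ R := by
    obtain ⟨R, hR⟩ := hb.exists_norm_le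
    exact ⟨|R|, abs_nonneg _, fun x hx => (hR x hx).trans (le_abs_self _)⟩
  -- Poincaré's inequality is applied to the approximating test functions. Since `∂_j w = 0`, the
  -- derivative `∂_j φ_n` is, up to sign, a component of the gradient error, so both terms tend to
  -- zero.
  have hle : ∀ n, eLpNorm w 2 (volume.restrict U) ≤ eLpNorm (w - φ n) 2 (volume.restrict U) +
      ENNReal.ofReal (2 * R) * eLpNorm (g' - gradient (φ n)) 2 (volume.restrict U) := fun n => by
    have e : w = (w - φ n) + φ n := by abel
    conv_lhs => rw [e]
    refine (eLpNorm_add_le (hg.1.sub (hφ n).memLp).1 (hφ n).memLp.1 (by norm_num)).trans ?_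
    gcongr
    refine ((hφ n).eLpNorm_le hU hR0 hR j).trans ?_
    gcongr
    refine eLpNorm_mono_ae ?_
    filter_upwards [hgg, hj] with x hx1 hx2
    have : ‖(g' x - gradient (φ n) x) j‖ ≤ ‖g' x - gradient (φ n) x‖ := PiLp.norm_apply_le _ j
    rw [PiLp.sub_apply, hx1, hx2, zero_sub, norm_neg] at this
    rw [Pi.sub_apply, hx1]
    exact this
  have hlim : Tendsto (fun n => eLpNorm (w - φ n) 2 (volume.restrict U) +
      ENNReal.ofReal (2 * R) * eLpNorm (g' - gradient (φ n)) 2 (volume.restrict U)) atTop (𝓝 0) := by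
    have := h1.add (ENNReal.Tendsto.const_mul (a := ENNReal.ofReal (2 * R)) h2
      (Or.inr ENNReal.ofReal_ne_top))
    simpa using this
  have h0 : eLpNorm w 2 (volume.restrict U) = 0 :=
    le_antisymm (ge_of_tendsto' hlim hle) zero_le
  exact (eLpNorm_eq_zero_iff hg.1.1 (by norm_num)).1 h0

/-- Integration by parts against a function in `H¹₀`. -/
theorem MemH10.integral_parts {w φ : Vec d → ℝ} {g γ : Vec d → Vec d} (h : MemH10 U w)
    (hU : IsOpen U) (hg : HasWeakGrad U w g) (hφ : HasWeakGrad U φ γ) :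
    ∫ x in U, (w x • γ x + φ x • g x) = 0 := by
  obtain ⟨g', hg', η, hη, h1, h2⟩ := h
  have hgg := hg'.ae_eq hU hg (ae_eq_refl _)
  have hi : ∀ n, Integrable (fun x => η n x • γ x + φ x • gradient (η n) x) (volume.restrict U) :=
    fun n => (integrable_smul_of_memLp (hη n).memLp hφ.2.1).add
      (integrable_smul_of_memLp hφ.1 (hη n).memLp_gradient)
  have hzero : ∀ n, ∫ x in U, (η n x • γ x + φ x • gradient (η n) x) = 0 := fun n => by
    rw [integral_add (integrable_smul_of_memLp (hη n).memLp hφ.2.1)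
      (integrable_smul_of_memLp hφ.1 (hη n).memLp_gradient), hφ.2.2 _ (hη n), add_neg_cancel]
  -- For a test function `η n` the identity is the definition of the weak gradient of `φ`. Hölder's
  -- inequality turns the `L²` convergence of `η n` and its gradient into `L¹` convergence of the
  -- products.
  have hlim := tendsto_integral_of_L1' (μ := volume.restrict U) (l := atTop)
    (F := fun n x => η n x • γ x + φ x • gradient (η n) x)
    (fun x => w x • γ x + φ x • g x)
    ((integrable_smul_of_memLp hg.1 hφ.2.1).add (integrable_smul_of_memLp hφ.1 hg.2.1)).1
    (Eventually.of_forall hi) (by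
      have hb : Tendsto (fun n => eLpNorm (w - η n) 2 (volume.restrict U) *
          eLpNorm γ 2 (volume.restrict U) + eLpNorm φ 2 (volume.restrict U) *
          eLpNorm (g' - gradient (η n)) 2 (volume.restrict U)) atTop (𝓝 0) := by
        have := (ENNReal.Tendsto.mul_const h1 (Or.inr hφ.2.1.2.ne)).add
          (ENNReal.Tendsto.const_mul h2 (Or.inr hφ.1.2.ne))
        simpa using this
      refine tendsto_of_tendsto_of_tendsto_of_le_of_le tendsto_const_nhds hb (fun _ => zero_le)
        fun n => ?_
      have e : (fun x => η n x • γ x + φ x • gradient (η n) x) - (fun x => w x • γ x + φ x • g x)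
          =ᵐ[volume.restrict U] -((w - η n) • γ + φ • (g' - gradient (η n))) := by
        filter_upwards [hgg] with x hx
        simp only [Pi.sub_apply, Pi.neg_apply, Pi.add_apply, Pi.smul_apply', hx, sub_smul, smul_sub]
        abel
      dsimp only
      rw [eLpNorm_congr_ae e, eLpNorm_neg]
      refine (eLpNorm_add_le ((hg.1.sub (hη n).memLp).1.smul hφ.2.1.1)
        (hφ.1.1.smul (hg'.2.1.sub (hη n).memLp_gradient).1) le_rfl).trans ?_
      exact add_le_add (eLpNorm_smul_le_mul_eLpNorm hφ.2.1.1 (hg.1.sub (hη n).memLp).1)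
        (eLpNorm_smul_le_mul_eLpNorm (hg'.2.1.sub (hη n).memLp_gradient).1 hφ.1.1))
  simp only [hzero] at hlim
  exact (tendsto_nhds_unique hlim tendsto_const_nhds)

theorem MemH10.exists_hasWeakGrad {w : Vec d → ℝ} (h : MemH10 U w) : ∃ g, HasWeakGrad U w g :=
  ⟨_, h.choose_spec.1⟩

/-- `[H¹₀]^d` is contained in `H₀(div)`. -/
theorem memH0Div_of_memH10 {v : Vec d → Vec d} (hU : IsOpen U)
    (hv : MemLp v 2 (volume.restrict U)) (h : ∀ i, MemH10 U fun x => v x i) : MemH0Div U v := by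
  choose g hg using fun i => (h i).exists_hasWeakGrad
  refine ⟨_, HasWeakDiv.of_hasWeakGrad hv hg, fun φ γ hφ => ?_⟩
  have key : ∀ i, ∫ x in U, (v x i * γ x i + g i x i * φ x) = 0 := fun i => by
    have := congrArg (fun y : Vec d => y i) ((h i).integral_parts hU (hg i) hφ)
    have hint : Integrable (fun x => v x i • γ x + φ x • g i x) (volume.restrict U) :=
      (integrable_smul_of_memLp (hg i).1 hφ.2.1).add (integrable_smul_of_memLp hφ.1 (hg i).2.1)
    rw [integral_apply hint] at this
    simpa [mul_comm (φ _)] using this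
  have : ∀ x, inner ℝ (v x) (γ x) + (∑ i, g i x i) * φ x =
      ∑ i, (v x i * γ x i + g i x i * φ x) := fun x => by
    simp only [PiLp.inner_apply, RCLike.inner_apply, conj_trivial, Finset.sum_mul,
      Finset.sum_add_distrib, mul_comm (γ x _)]
  simp only [this]
  have hint : ∀ i, Integrable (fun x => v x i * γ x i + g i x i * φ x) (volume.restrict U) :=
    fun i => (integrable_mul_of_memLp (hg i).1 (memLp_apply hφ.2.1 i)).add
      (integrable_mul_of_memLp (memLp_apply (hg i).2.1 i) hφ.1)
  rw [integral_finsetSum _ fun i _ => hint i]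
  exact Finset.sum_eq_zero fun i _ => key i

end WeakDerivatives

/-! ### Mollification and vanishing normal traces -/

section Mollification

variable {d : ℕ} {U : Set (Vec d)}

/-- The convolution of `f` with the kernel `ρ`. -/
noncomputable def mollify (ρ f : Vec d → ℝ) : Vec d → ℝ :=
  convolution f ρ (ContinuousLinearMap.mul ℝ ℝ) volume

theorem mollify_apply (ρ f : Vec d → ℝ) (x : Vec d) : mollify ρ f x = ∫ t, f t * ρ (x - t) := rfl

theorem norm_mollify_le {ρ f : Vec d → ℝ} {C : ℝ} (hf : ∀ x, ‖f x‖ ≤ C) (hρ : ∀ x, 0 ≤ ρ x)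
    (hρi : Integrable ρ) (hρ1 : ∫ x, ρ x = 1) (x : Vec d) : ‖mollify ρ f x‖ ≤ C := by
  have h1 : ∫ t, C * ρ (x - t) = C := by
    rw [integral_const_mul, integral_sub_left_eq_self (fun t => ρ t) volume x, hρ1, mul_one]
  rw [← h1, mollify_apply]
  refine norm_integral_le_of_norm_le ((hρi.comp_sub_left x).const_mul C) ?_
  refine Eventually.of_forall fun t => ?_
  rw [norm_mul, Real.norm_of_nonneg (hρ _)]
  exact mul_le_mul_of_nonneg_right (hf t) (hρ _)

theorem isTest_mollify {ρ f : Vec d → ℝ} {K : Set (Vec d)} {r : ℝ} (hK : IsCompact K)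
    (hKU : Metric.cthickening r K ⊆ U) (hf : LocallyIntegrable f) (hf0 : ∀ x, x ∉ K → f x = 0)
    (hρ : ContDiff ℝ ∞ ρ) (hρr : Function.support ρ ⊆ Metric.closedBall 0 r) :
    IsTest U (mollify ρ f) := by
  have hρc : HasCompactSupport ρ :=
    HasCompactSupport.of_support_subset_isCompact (isCompact_closedBall 0 r) hρr
  have hsupp : tsupport (mollify ρ f) ⊆ Metric.cthickening r K := by
    refine closure_minimal ?_ Metric.isClosed_cthickening
    refine (support_convolution_subset (ContinuousLinearMap.mul ℝ ℝ)).trans ?_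
    rintro _ ⟨x, hx, y, hy, rfl⟩
    have hxK : x ∈ K := by
      by_contra hxK
      exact hx (hf0 x hxK)
    refine Metric.mem_cthickening_of_dist_le _ x r K hxK ?_
    simpa using hρr hy
  refine ⟨?_, ?_, hsupp.trans hKU⟩
  · exact hρc.contDiff_convolution_right (n := ⊤) _ hf hρ
  · exact hK.cthickening.of_isClosed_subset (isClosed_tsupport _) hsupp

theorem gradient_mollify {ρ f : Vec d → ℝ} (hf : LocallyIntegrable f) (hρ : ContDiff ℝ ∞ ρ)
    (hρc : HasCompactSupport ρ) (x : Vec d) (i : Fin d) :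
    gradient (mollify ρ f) x i = ∫ t, f t * gradient ρ (x - t) i := by
  have hρ1 : ContDiff ℝ 1 ρ := hρ.of_le (by simp)
  rw [gradient_apply, mollify, (hρc.hasFDerivAt_convolution_right _ hf hρ1 x).fderiv,
    convolution_precompR_apply _ hf (hρc.fderiv (𝕜 := ℝ)) (hρ1.continuous_fderiv (by simp)),
    convolution_def]
  simp only [gradient_apply, ContinuousLinearMap.mul_apply']

theorem gradient_comp_sub_left {ρ : Vec d → ℝ} (hρ : ContDiff ℝ 1 ρ) (x t : Vec d) :
    gradient (fun t => ρ (x - t)) t = -gradient ρ (x - t) := by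
  have h1 : HasFDerivAt (fun t : Vec d => x - t) (-ContinuousLinearMap.id ℝ (Vec d)) t :=
    (hasFDerivAt_id t).const_sub x
  have h2 := ((hρ.differentiable (by simp)) (x - t)).hasFDerivAt.comp t h1
  rw [gradient, show (fun t => ρ (x - t)) = ρ ∘ fun t => x - t from rfl, h2.fderiv, gradient]
  rw [← map_neg]
  congr 1
  ext v
  simp

theorem integrable_mul_comp_sub_left {f η : Vec d → ℝ} (hf : LocallyIntegrable f)
    (hη : Continuous η) (hηc : HasCompactSupport η) (x : Vec d) :
    Integrable fun t => f t * η (x - t) :=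
  hηc.convolutionExists_right (ContinuousLinearMap.mul ℝ ℝ) hf hη x

/-- If `δ` is the divergence of `Ψ` on the whole space, then mollification preserves this. -/
theorem sum_gradient_mollify {ρ δ : Vec d → ℝ} {Ψ : Vec d → Vec d} (hρ : ContDiff ℝ ∞ ρ)
    (hρc : HasCompactSupport ρ) (hΨ : ∀ i, LocallyIntegrable fun x => Ψ x i)
    (hδ : LocallyIntegrable δ)
    (hdiv : ∀ χ, ContDiff ℝ ∞ χ → ∫ x, (inner ℝ (Ψ x) (gradient χ x) + δ x * χ x) = 0)
    (x : Vec d) : ∑ i, gradient (mollify ρ fun x => Ψ x i) x i = mollify ρ δ x := by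
  have hρ1 : ContDiff ℝ 1 ρ := hρ.of_le (by simp)
  have hgc : ∀ i, Continuous fun y => gradient ρ y i := fun i => by
    have := continuous_gradient hρ1; fun_prop
  have hgs : ∀ i, HasCompactSupport fun y => gradient ρ y i := fun i => by
    simp only [gradient_apply]
    exact hρc.fderiv_apply (𝕜 := ℝ) _
  have hint : ∀ i, Integrable fun t => Ψ t i * gradient ρ (x - t) i := fun i =>
    integrable_mul_comp_sub_left (hΨ i) (hgc i) (hgs i) x
  have hint' : Integrable fun t => δ t * ρ (x - t) :=
    integrable_mul_comp_sub_left hδ hρ.continuous hρc x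
  -- The reflected and translated kernel is itself used as the test function; its gradient in `t`
  -- carries a minus sign.
  have h := hdiv (fun t => ρ (x - t)) (by fun_prop)
  have e : ∀ t, inner ℝ (Ψ t) (gradient (fun t => ρ (x - t)) t) =
      -∑ i, Ψ t i * gradient ρ (x - t) i := fun t => by
    rw [gradient_comp_sub_left hρ1, inner_neg_right]
    simp only [PiLp.inner_apply, RCLike.inner_apply, conj_trivial, mul_comm (gradient ρ (x - t) _)]
  simp only [e] at h
  have hsum : Integrable fun t => -∑ i, Ψ t i * gradient ρ (x - t) i :=
    (integrable_finsetSum _ fun i _ => hint i).neg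
  rw [integral_add hsum hint', integral_neg, integral_finsetSum _ fun i _ => hint i] at h
  rw [Finset.sum_congr rfl fun i _ => gradient_mollify (hΨ i) hρ hρc x i, mollify_apply]
  linarith

/-- A bounded field with compact support in `U` that has a bounded divergence on the whole space
has zero normal trace on the boundary of `U`. -/
theorem integral_inner_add_eq_zero (hb : Bornology.IsBounded U) (hU : IsOpen U)
    {K : Set (Vec d)} (hK : IsCompact K) (hKU : K ⊆ U) {Ψ : Vec d → Vec d} {δ : Vec d → ℝ}
    (hΨ : AEStronglyMeasurable Ψ volume) (hδ : AEStronglyMeasurable δ volume) {C : ℝ}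
    (hΨC : ∀ x, ‖Ψ x‖ ≤ C) (hδC : ∀ x, ‖δ x‖ ≤ C) (hΨ0 : ∀ x, x ∉ K → Ψ x = 0)
    (hdiv : ∀ χ, ContDiff ℝ ∞ χ → ∫ x, (inner ℝ (Ψ x) (gradient χ x) + δ x * χ x) = 0)
    {φ : Vec d → ℝ} {γ : Vec d → Vec d} (hφ : HasWeakGrad U φ γ) :
    ∫ x in U, (inner ℝ (Ψ x) (γ x) + δ x * φ x) = 0 := by
  have : IsFiniteMeasure (volume.restrict U) :=
    ⟨by rw [Measure.restrict_apply_univ]; exact hb.measure_lt_top⟩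
  obtain ⟨r, hr, hrU⟩ := hK.exists_cthickening_subset_open hU hKU
  have hC : 0 ≤ C := (norm_nonneg _).trans (hδC 0)
  -- Outer radii at most `r` keep the mollified fields supported in `U`. The fixed ratio `2` of
  -- outer to inner radius is what almost everywhere convergence of the convolutions requires.
  let B : ℕ → ContDiffBump (0 : Vec d) := fun n =>
    ⟨r / (n + 1) / 2, r / (n + 1), by positivity, half_lt_self (by positivity)⟩
  let ρ : ℕ → Vec d → ℝ := fun n => (B n).normed volume
  have hρ : ∀ n, ContDiff ℝ ∞ (ρ n) := fun n => (B n).contDiff_normed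
  have hρr : ∀ n, Function.support (ρ n) ⊆ Metric.closedBall 0 r := fun n => by
    rw [(B n).support_normed_eq]
    refine (Metric.ball_subset_closedBall).trans (Metric.closedBall_subset_closedBall ?_)
    exact div_le_self hr.le (by simp)
  have hρc : ∀ n, HasCompactSupport (ρ n) := fun n => (B n).hasCompactSupport_normed
  have hΨi : ∀ i, AEStronglyMeasurable (fun x => Ψ x i) volume := fun i =>
    (EuclideanSpace.proj i : Vec d →L[ℝ] ℝ).continuous.comp_aestronglyMeasurable hΨ
  have hΨiC : ∀ i x, ‖Ψ x i‖ ≤ C := fun i x => (PiLp.norm_apply_le _ i).trans (hΨC x)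
  have hloc : ∀ {f : Vec d → ℝ}, AEStronglyMeasurable f volume → (∀ x, ‖f x‖ ≤ C) →
      LocallyIntegrable f := fun h1 h2 =>
    (memLp_top_of_bound h1 C (Eventually.of_forall h2)).locallyIntegrable le_top
  have htest : ∀ n i, IsTest U (mollify (ρ n) fun x => Ψ x i) := fun n i =>
    isTest_mollify hK hrU (hloc (hΨi i) (hΨiC i)) (fun x hx => by rw [hΨ0 x hx]; rfl) (hρ n) (hρr n)
  -- Each mollified component is a test function on `U`, so the definition of the weak gradient of
  -- `φ` applies. The partial derivatives sum to the mollified divergence.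
  have hzero : ∀ n, ∫ x in U, (∑ i, mollify (ρ n) (fun x => Ψ x i) x * γ x i +
      mollify (ρ n) δ x * φ x) = 0 := fun n => by
    have h1 : ∀ i, ∫ x in U, (mollify (ρ n) (fun x => Ψ x i) x * γ x i +
        gradient (mollify (ρ n) fun x => Ψ x i) x i * φ x) = 0 := fun i => by
      have h2 := congrArg (fun y : Vec d => y i) (hφ.2.2 _ (htest n i))
      simp only [PiLp.neg_apply] at h2
      rw [integral_apply (integrable_smul_of_memLp hφ.1 (htest n i).memLp_gradient),
        integral_apply (integrable_smul_of_memLp (htest n i).memLp hφ.2.1)] at h2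
      rw [integral_add (integrable_mul_of_memLp (htest n i).memLp (memLp_apply hφ.2.1 i))
        (integrable_mul_of_memLp (memLp_apply (htest n i).memLp_gradient i) hφ.1)]
      simp only [PiLp.smul_apply, smul_eq_mul] at h2
      simp only [mul_comm _ (φ _), h2, add_neg_cancel]
    have hint : ∀ i, Integrable (fun x => mollify (ρ n) (fun x => Ψ x i) x * γ x i +
        gradient (mollify (ρ n) fun x => Ψ x i) x i * φ x) (volume.restrict U) := fun i =>
      (integrable_mul_of_memLp (htest n i).memLp (memLp_apply hφ.2.1 i)).add
        (integrable_mul_of_memLp (memLp_apply (htest n i).memLp_gradient i) hφ.1)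
    rw [← Finset.sum_eq_zero fun i _ => h1 i, ← integral_finsetSum _ fun i _ => hint i]
    refine integral_congr_ae (Eventually.of_forall fun x => ?_)
    simp only
    rw [← sum_gradient_mollify (hρ n) (hρc n) (fun i => hloc (hΨi i) (hΨiC i)) (hloc hδ hδC) hdiv x,
      Finset.sum_mul, Finset.sum_add_distrib]
  have hbound : ∀ {f : Vec d → ℝ} (n), (∀ x, ‖f x‖ ≤ C) → ∀ x, ‖mollify (ρ n) f x‖ ≤ C :=
    fun n hf x => norm_mollify_le hf (fun x => (B n).nonneg_normed x)
      (((B n).continuous_normed).integrable_of_hasCompactSupport (hρc n)) (B n).integral_normed x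
  have hconv : ∀ {f : Vec d → ℝ}, LocallyIntegrable f →
      ∀ᵐ x ∂volume.restrict U, Tendsto (fun n => mollify (ρ n) f x) atTop (𝓝 (f x)) := fun {f} hf => by
    have hlim : Tendsto (fun n => (B n).rOut) atTop (𝓝 0) := by
      have := (tendsto_const_div_atTop_nhds_zero_nat r).comp (tendsto_add_atTop_nat 1)
      refine this.congr fun n => ?_
      simp [B]
    have := ContDiffBump.ae_convolution_tendsto_right_of_locallyIntegrable (K := 2) hlim
      (Eventually.of_forall fun n => by simp only [B]; linarith) hf
    refine ae_restrict_of_ae ?_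
    filter_upwards [this] with x hx
    refine hx.congr fun n => ?_
    rw [convolution_lsmul_swap, mollify_apply]
    simp only [smul_eq_mul, mul_comm, ρ]
  have hγi : ∀ i, Integrable (fun x => γ x i) (volume.restrict U) := fun i =>
    (memLp_apply hφ.2.1 i).integrable (by norm_num)
  have hφi : Integrable φ (volume.restrict U) := hφ.1.integrable (by norm_num)
  have hmeas : ∀ {f : Vec d → ℝ} (n), LocallyIntegrable f →
      AEStronglyMeasurable (mollify (ρ n) f) (volume.restrict U) := fun n hf =>
    (((hρc n).contDiff_convolution_right (n := ⊤) (ContinuousLinearMap.mul ℝ ℝ) hf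
      (hρ n)).continuous).aestronglyMeasurable
  have hlim := tendsto_integral_of_dominated_convergence (μ := volume.restrict U)
    (F := fun n x => ∑ i, mollify (ρ n) (fun x => Ψ x i) x * γ x i + mollify (ρ n) δ x * φ x)
    (f := fun x => ∑ i, Ψ x i * γ x i + δ x * φ x)
    (fun x => ∑ i, C * ‖γ x i‖ + C * ‖φ x‖)
    (fun n => (Finset.aestronglyMeasurable_fun_sum _ fun i _ =>
      (hmeas n (hloc (hΨi i) (hΨiC i))).mul (hγi i).1).add ((hmeas n (hloc hδ hδC)).mul hφi.1))
    ((integrable_finsetSum _ fun i _ => (hγi i).norm.const_mul C).add (hφi.norm.const_mul C))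
    (fun n => Eventually.of_forall fun x => by
      refine (norm_add_le _ _).trans (add_le_add ((norm_sum_le _ _).trans
        (Finset.sum_le_sum fun i _ => ?_)) ?_)
      · rw [norm_mul]
        exact mul_le_mul_of_nonneg_right (hbound n (hΨiC i) x) (norm_nonneg _)
      · rw [norm_mul]
        exact mul_le_mul_of_nonneg_right (hbound n hδC x) (norm_nonneg _))
    (by
      have h1 : ∀ᵐ x ∂volume.restrict U, ∀ i,
          Tendsto (fun n => mollify (ρ n) (fun x => Ψ x i) x) atTop (𝓝 (Ψ x i)) :=
        eventually_all.2 fun i => hconv (hloc (hΨi i) (hΨiC i))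
      filter_upwards [h1, hconv (hloc hδ hδC)] with x hx hx'
      exact (tendsto_finsetSum _ fun i _ => (hx i).mul_const _).add (hx'.mul_const _))
  simp only [hzero] at hlim
  rw [← tendsto_nhds_unique hlim tendsto_const_nhds]
  refine integral_congr_ae (Eventually.of_forall fun x => ?_)
  simp [PiLp.inner_apply, mul_comm]

end Mollification

/-! ### The Raviart–Thomas basis functions and their normal traces -/

section RaviartThomas

open scoped Classical

variable {d : ℕ} {Ω : Set (Vec d)}

theorem exists_erase_eq {S e : Finset (Vec d)} (h : S.card = e.card + 1) (heS : e ⊆ S) :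
    ∃ a ∈ S, S.erase a = e ∧ S \ e = {a} := by
  have h1 : (S \ e).card = 1 := by rw [Finset.card_sdiff_of_subset heS]; omega
  obtain ⟨a, ha⟩ := Finset.card_eq_one.1 h1
  have haS : a ∈ S \ e := by rw [ha]; exact Finset.mem_singleton_self a
  refine ⟨a, (Finset.mem_sdiff.1 haS).1, ?_, ha⟩
  rw [Finset.erase_eq, ← ha, Finset.sdiff_sdiff_eq_self heS]

namespace Triangulation

variable (𝒯 : Triangulation Ω) {e : Finset (Vec d)}

theorem mem_interiorFaces : e ∈ 𝒯.interiorFaces ↔ e.card = d ∧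
    ∃ T ∈ 𝒯.elements, ∃ T' ∈ 𝒯.elements, T ≠ T' ∧ e ⊆ T ∧ e ⊆ T' := by
  rw [interiorFaces, Finset.mem_filter]
  refine and_congr_left fun h => ?_
  obtain ⟨T, hT, _, _, _, heT, _⟩ := h
  rw [Finset.mem_biUnion]
  constructor
  · rintro ⟨S, -, hS⟩
    exact (Finset.mem_powersetCard.1 hS).2
  · exact fun h => ⟨T, hT, Finset.mem_powersetCard.2 ⟨heT, h⟩⟩

/-- The two elements adjacent to an interior face, with their opposite vertices; the first one is
the element that the normal points out of. -/
structure Adjacent (e T T' : Finset (Vec d)) (a a' : Vec d) : Prop where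
  hT : T ∈ 𝒯.elements
  hT' : T' ∈ 𝒯.elements
  ne : T ≠ T'
  ha : a ∈ T
  ha' : a' ∈ T'
  erase_eq : T.erase a = e
  erase_eq' : T'.erase a' = e
  plus_eq : 𝒯.plusElement e = T
  eq_or_eq : ∀ S ∈ 𝒯.elements, e ⊆ S → S = T ∨ S = T'

variable {𝒯}

/-- `eq_of_common_face` excludes a third element at `e`, so whichever element `plusElement` chose,
exactly one other remains. -/
theorem exists_adjacent (he : e ∈ 𝒯.interiorFaces) :
    ∃ T T' a a', 𝒯.Adjacent e T T' a a' := by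
  obtain ⟨hcard, T₁, hT₁, T₂, hT₂, hne, he1, he2⟩ := 𝒯.mem_interiorFaces.1 he
  have hex : ∃ T ∈ 𝒯.elements, e ⊆ T := ⟨T₁, hT₁, he1⟩
  have hP : 𝒯.plusElement e = hex.choose := by rw [plusElement, dif_pos hex]
  obtain ⟨hPm, heP⟩ := hex.choose_spec
  rw [← hP] at hPm heP
  obtain ⟨T', hT', hne', heT'⟩ : ∃ T' ∈ 𝒯.elements, 𝒯.plusElement e ≠ T' ∧ e ⊆ T' := by
    by_cases h1 : 𝒯.plusElement e = T₁
    · exact ⟨T₂, hT₂, by rw [h1]; exact hne, he2⟩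
    · exact ⟨T₁, hT₁, h1, he1⟩
  have hface : ∀ S ∈ 𝒯.elements, e ⊆ S → ∃ a ∈ S, S.erase a = e ∧ S \ e = {a} := fun S hS heS =>
    exists_erase_eq (by rw [𝒯.card_eq S hS, hcard]) heS
  obtain ⟨a, ha, hae, -⟩ := hface _ hPm heP
  obtain ⟨a', ha', hae', -⟩ := hface _ hT' heT'
  refine ⟨_, T', a, a', hPm, hT', hne', ha, ha', hae, hae', rfl, fun S hS heS => ?_⟩
  by_contra! hcon
  obtain ⟨b, hb, hbe, -⟩ := hface S hS heS
  exact hcon.2 (eq_of_common_face hPm hS hT' hcon.1.symm hne' ha hb ha' (hae.trans hbe.symm)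
    (hae.trans hae'.symm))

theorem Adjacent.subset {T T' : Finset (Vec d)} {a a' : Vec d} (h : 𝒯.Adjacent e T T' a a') :
    e ⊆ T := by rw [← h.erase_eq]; exact Finset.erase_subset _ _

theorem Adjacent.subset' {T T' : Finset (Vec d)} {a a' : Vec d} (h : 𝒯.Adjacent e T T' a a') :
    e ⊆ T' := by rw [← h.erase_eq']; exact Finset.erase_subset _ _

theorem sdiff_eq_of_erase_eq {S e : Finset (Vec d)} {a : Vec d} (ha : a ∈ S) (h : S.erase a = e) :
    S \ e = {a} := by
  rw [← h, Finset.erase_eq, Finset.sdiff_sdiff_eq_self (Finset.singleton_subset_iff.2 ha)]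

/-- The values of a basis function on an element. -/
theorem rtBasis_apply {S : Finset (Vec d)} (hS : S ∈ 𝒯.elements) {x : Vec d} (hx : x ∈ cell S) :
    𝒯.rtBasis e x = if e ⊆ S then ((if S = 𝒯.plusElement e then 1 else -1) /
      (d * volume.real (cell S))) • (x - ∑ a ∈ S \ e, a) else 0 := by
  rw [rtBasis, Finset.sum_filter, Finset.sum_eq_single_of_mem S hS]
  · simp only [Set.indicator_of_mem hx]
  · intro T hT hne
    rw [Set.indicator_of_notMem fun hxT => hne (eq_of_mem_cell hT hS hxT (interior_subset hx))]
    simp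

theorem Adjacent.rtBasis_eq {T T' : Finset (Vec d)} {a a' : Vec d} (h : 𝒯.Adjacent e T T' a a')
    (x : Vec d) : 𝒯.rtBasis e x =
      (cell T).indicator (fun y => (d * volume.real (cell T))⁻¹ • (y - a)) x -
      (cell T').indicator (fun y => (d * volume.real (cell T'))⁻¹ • (y - a')) x := by
  have hfil : 𝒯.elements.filter (fun S => e ⊆ S) = {T, T'} := by
    ext S
    rw [Finset.mem_filter, Finset.mem_insert, Finset.mem_singleton]
    constructor
    · exact fun hS => h.eq_or_eq S hS.1 hS.2
    · rintro (rfl | rfl)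
      · exact ⟨h.hT, h.subset⟩
      · exact ⟨h.hT', h.subset'⟩
  have e1 : ∀ S b, b ∈ S → S.erase b = e → ∑ c ∈ S \ e, c = b := fun S b hb hbe => by
    rw [sdiff_eq_of_erase_eq hb hbe, Finset.sum_singleton]
  rw [rtBasis, hfil, Finset.sum_pair h.ne, h.plus_eq, e1 T a h.ha h.erase_eq,
    e1 T' a' h.ha' h.erase_eq', if_pos rfl, if_neg h.ne.symm, sub_eq_add_neg]
  simp only [one_div, neg_div, neg_smul, Set.indicator_apply]
  split_ifs <;> simp

/-- The divergence of a basis function. -/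
noncomputable def rtDiv (T T' : Finset (Vec d)) (x : Vec d) : ℝ :=
  (cell T).indicator (fun _ => (volume.real (cell T))⁻¹) x -
    (cell T').indicator (fun _ => (volume.real (cell T'))⁻¹) x

/-- The two halves of `Φ_e` contribute `faceFlux` divided by `d` times the volume, and these
quotients agree from the two sides of `e`. Hence `rtDiv` is the divergence of `Φ_e` on the whole
space, with no singular part on the face. -/
theorem Adjacent.integral_rtBasis {T T' : Finset (Vec d)} {a a' : Vec d}
    (h : 𝒯.Adjacent e T T' a a') (hd : 0 < d) {χ : Vec d → ℝ} (hχ : ContDiff ℝ 1 χ) :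
    ∫ x, (inner ℝ (𝒯.rtBasis e x) (gradient χ x) + rtDiv T T' x * χ x) = 0 := by
  have hd' : (d : ℝ) ≠ 0 := by positivity
  have hg := continuous_gradient hχ
  have hc := hχ.continuous
  have key : ∀ x, inner ℝ (𝒯.rtBasis e x) (gradient χ x) + rtDiv T T' x * χ x =
      (cell T).indicator (fun x => (d * volume.real (cell T))⁻¹ *
        (inner ℝ (x - a) (gradient χ x) + d * χ x)) x -
      (cell T').indicator (fun x => (d * volume.real (cell T'))⁻¹ *
        (inner ℝ (x - a') (gradient χ x) + d * χ x)) x := fun x => by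
    rw [h.rtBasis_eq, rtDiv, inner_sub_left]
    simp only [Set.indicator_apply]
    split_ifs <;>
      simp only [real_inner_smul_left, inner_zero_left, mul_inv] <;> field_simp <;> ring
  simp only [key]
  have hi : ∀ (S : Finset (Vec d)) (b : Vec d), IntegrableOn (fun x => (d * volume.real (cell S))⁻¹ *
      (inner ℝ (x - b) (gradient χ x) + d * χ x)) (cell S) := fun S b =>
    integrableOn_cell (by fun_prop)
  rw [integral_sub ((hi T a).integrable_indicator IsSimplex.measurableSet_cell)
      ((hi T' a').integrable_indicator IsSimplex.measurableSet_cell),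
    integral_indicator IsSimplex.measurableSet_cell, integral_indicator IsSimplex.measurableSet_cell,
    integral_const_mul, integral_const_mul]
  have := (𝒯.isSimplex h.hT).faceFlux_div_eq (𝒯.isSimplex h.hT') h.ha h.ha'
    (h.erase_eq.trans h.erase_eq'.symm) hd hχ
  rw [faceFlux, faceFlux, div_eq_inv_mul, div_eq_inv_mul] at this
  rw [mul_inv, mul_inv, mul_assoc, mul_assoc, this, sub_self]

/-- Contracting an element towards the centroid of an interior face moves it into the domain. -/
theorem homothety_mem (hΩ : interior (closure Ω) = Ω) (hd : 0 < d) {T T' : Finset (Vec d)}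
    {a a' : Vec d} (hT : T ∈ 𝒯.elements) (hT' : T' ∈ 𝒯.elements) (hne : T ≠ T') (ha : a ∈ T)
    (ha' : a' ∈ T') (he : T.erase a = T'.erase a') {t : ℝ} (ht : 0 < t)
    (ht1 : t < 1) {x : Vec d} (hx : x ∈ convexHull ℝ (T : Set (Vec d))) :
    centroid (T.erase a) + t • (x - centroid (T.erase a)) ∈ Ω := by
  have hs := 𝒯.isSimplex hT
  have hne' : (T.erase a).Nonempty := by
    rw [← Finset.card_pos, Finset.card_erase_of_mem ha, hs.card_eq]; omega
  have hsub : T.erase a ⊆ T := Finset.erase_subset _ _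
  have hx := hs.mem_convexHull.1 hx
  have hce : ∀ v ∈ T.erase a,
      0 < hs.coord v (centroid (T.erase a) + t • (x - centroid (T.erase a))) := fun v hv => by
    rw [hs.coord_lineMap, hs.coord_centroid hne' hsub (hsub hv), if_pos hv]
    have h1 := mul_nonneg ht.le (hx v (hsub hv))
    have h2 : 0 < (1 - t) * ((T.erase a).card : ℝ)⁻¹ := by
      have := hne'.card_pos
      have := sub_pos.2 ht1
      positivity
    linarith
  have hca : hs.coord a (centroid (T.erase a) + t • (x - centroid (T.erase a))) =
      t * hs.coord a x := by
    rw [hs.coord_lineMap, hs.coord_centroid hne' hsub ha, if_neg (Finset.notMem_erase _ _)]; ring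
  rcases (hx a ha).eq_or_lt with h0 | h0
  · exact mem_domain_of_mem_face hΩ hT hT' hne ha ha' he (by rw [hca, ← h0, mul_zero]) hce
  · refine 𝒯.cell_subset hΩ hT (hs.mem_cell.2 fun v hv => ?_)
    by_cases hva : v = a
    · rw [hva, hca]; positivity
    · exact hce v (Finset.mem_erase.2 ⟨hva, hv⟩)

/-- Frontiers of cells are null sets, so `Φ_e` and its divergence are continuous almost everywhere.
This lets contracted copies converge to them pointwise almost everywhere. -/
theorem continuousAt_indicator_cell {E : Type*} [NormedAddCommGroup E] (T : Finset (Vec d))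
    {f : Vec d → E} (hf : Continuous f) {x : Vec d} (hx : x ∉ frontier (cell T)) :
    ContinuousAt ((cell T).indicator f) x := by
  by_cases hxT : x ∈ cell T
  · exact hf.continuousAt.congr (by
      filter_upwards [IsSimplex.isOpen_cell.mem_nhds hxT] with y hy
      rw [Set.indicator_of_mem hy])
  · have hxc : x ∉ closure (cell T) := fun hxc => hx ⟨hxc, by
      rwa [IsSimplex.isOpen_cell.interior_eq]⟩
    refine (continuousAt_const (y := (0 : E))).congr ?_
    filter_upwards [isClosed_closure.isOpen_compl.mem_nhds hxc] with y hy
    rw [Set.indicator_of_notMem fun hy' => hy (subset_closure hy')]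

theorem ae_notMem_frontier_cell (T : Finset (Vec d)) : ∀ᵐ x : Vec d, x ∉ frontier (cell T) :=
  measure_eq_zero_iff_ae_notMem.1 ((convex_convexHull ℝ _).interior.addHaar_frontier volume)

theorem exists_bound_indicator_cell {E : Type*} [NormedAddCommGroup E] (T : Finset (Vec d))
    {f : Vec d → E} (hf : Continuous f) : ∃ C, 0 ≤ C ∧ ∀ x, ‖(cell T).indicator f x‖ ≤ C := by
  obtain ⟨C, hC⟩ := (IsSimplex.isCompact_convexHull (T := T)).exists_bound_of_continuousOn
    hf.continuousOn
  refine ⟨|C|, abs_nonneg _, fun x => ?_⟩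
  by_cases hx : x ∈ cell T
  · rw [Set.indicator_of_mem hx]
    exact (hC x (interior_subset hx)).trans (le_abs_self C)
  · rw [Set.indicator_of_notMem hx, norm_zero]
    exact abs_nonneg _

variable {T T' : Finset (Vec d)} {a a' : Vec d}

theorem Adjacent.measurable_rtBasis (h : 𝒯.Adjacent e T T' a a') : Measurable (𝒯.rtBasis e) := by
  rw [show 𝒯.rtBasis e = _ from funext h.rtBasis_eq]
  exact ((by fun_prop : Measurable fun y : Vec d => (d * volume.real (cell T))⁻¹ • (y - a)).indicator
    IsSimplex.measurableSet_cell).sub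
    ((by fun_prop : Measurable fun y : Vec d => (d * volume.real (cell T'))⁻¹ • (y - a')).indicator
    IsSimplex.measurableSet_cell)

theorem measurable_rtDiv (T T' : Finset (Vec d)) : Measurable (rtDiv T T') :=
  (measurable_const.indicator IsSimplex.measurableSet_cell).sub
    (measurable_const.indicator IsSimplex.measurableSet_cell)

theorem Adjacent.exists_bound_rtBasis (h : 𝒯.Adjacent e T T' a a') :
    ∃ C, 0 ≤ C ∧ ∀ x, ‖𝒯.rtBasis e x‖ ≤ C := by
  obtain ⟨C, hC0, hC⟩ := exists_bound_indicator_cell T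
    (f := fun y : Vec d => (d * volume.real (cell T))⁻¹ • (y - a)) (by fun_prop)
  obtain ⟨C', hC0', hC'⟩ := exists_bound_indicator_cell T'
    (f := fun y : Vec d => (d * volume.real (cell T'))⁻¹ • (y - a')) (by fun_prop)
  refine ⟨C + C', add_nonneg hC0 hC0', fun x => ?_⟩
  rw [h.rtBasis_eq]
  exact (norm_sub_le _ _).trans (add_le_add (hC x) (hC' x))

theorem exists_bound_rtDiv (T T' : Finset (Vec d)) : ∃ C, 0 ≤ C ∧ ∀ x, ‖rtDiv T T' x‖ ≤ C := by
  obtain ⟨C, hC0, hC⟩ := exists_bound_indicator_cell T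
    (f := fun _ : Vec d => (volume.real (cell T))⁻¹) continuous_const
  obtain ⟨C', hC0', hC'⟩ := exists_bound_indicator_cell T'
    (f := fun _ : Vec d => (volume.real (cell T'))⁻¹) continuous_const
  exact ⟨C + C', add_nonneg hC0 hC0', fun x => (norm_sub_le _ _).trans (add_le_add (hC x) (hC' x))⟩

/-- The divergence identity for a basis function contracted towards a point. -/
theorem Adjacent.integral_rtBasis_homothety (h : 𝒯.Adjacent e T T' a a') (hd : 0 < d) (c : Vec d)
    {t : ℝ} (ht : 0 < t) {χ : Vec d → ℝ} (hχ : ContDiff ℝ 1 χ) :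
    ∫ x, (inner ℝ (𝒯.rtBasis e (c + t⁻¹ • (x - c))) (gradient χ x) +
      t⁻¹ * rtDiv T T' (c + t⁻¹ • (x - c)) * χ x) = 0 := by
  have himg : (fun x : Vec d => c + t • (x - c)) '' Set.univ = Set.univ := by
    refine Set.image_univ_of_surjective fun y => ⟨c + t⁻¹ • (y - c), ?_⟩
    simp only [add_sub_cancel_left, smul_inv_smul₀ ht.ne', add_sub_cancel]
  have h1 := integral_image_homothety c ht MeasurableSet.univ
    (fun x => inner ℝ (𝒯.rtBasis e (c + t⁻¹ • (x - c))) (gradient χ x) +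
      t⁻¹ * rtDiv T T' (c + t⁻¹ • (x - c)) * χ x)
  rw [himg, setIntegral_univ, setIntegral_univ] at h1
  rw [h1]
  have hη : ContDiff ℝ 1 fun x : Vec d => χ (c + t • (x - c)) := by fun_prop
  have hgrad : ∀ x, gradient (fun x : Vec d => χ (c + t • (x - c))) x =
      t • gradient χ (c + t • (x - c)) := fun x => by
    have := (((hχ.differentiable (by simp)) (c + t • (x - c))).hasFDerivAt.comp x
      (hasFDerivAt_homothety c t x)).fderiv
    refine ext_inner_left ℝ fun y => ?_
    rw [inner_gradient_eq, real_inner_smul_right, inner_gradient_eq]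
    have e : (fun x : Vec d => χ (c + t • (x - c))) = χ ∘ fun x => c + t • (x - c) := rfl
    rw [e, this]
    simp
  have h2 := h.integral_rtBasis hd hη
  simp only [hgrad, real_inner_smul_right] at h2
  have h3 : ∀ x, inner ℝ (𝒯.rtBasis e (c + t⁻¹ • (c + t • (x - c) - c))) (gradient χ (c + t • (x - c))) +
      t⁻¹ * rtDiv T T' (c + t⁻¹ • (c + t • (x - c) - c)) * χ (c + t • (x - c)) =
      t⁻¹ * (t * inner ℝ (𝒯.rtBasis e x) (gradient χ (c + t • (x - c))) +
        rtDiv T T' x * χ (c + t • (x - c))) := fun x => by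
    rw [add_sub_cancel_left, inv_smul_smul₀ ht.ne', add_sub_cancel]
    field_simp
  simp only [h3]
  rw [integral_const_mul, h2, mul_zero, mul_zero]

/-- The basis function of an interior face has zero normal trace on the boundary. -/
theorem Adjacent.integral_domain_rtBasis (h : 𝒯.Adjacent e T T' a a') (hd : 0 < d)
    (hΩ : interior (closure Ω) = Ω) (ho : IsOpen Ω) (hb : Bornology.IsBounded Ω)
    {φ : Vec d → ℝ} {γ : Vec d → Vec d} (hφ : HasWeakGrad Ω φ γ) :
    ∫ x in Ω, (inner ℝ (𝒯.rtBasis e x) (γ x) + rtDiv T T' x * φ x) = 0 := by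
  have hfin : IsFiniteMeasure (volume.restrict Ω) :=
    ⟨by rw [Measure.restrict_apply_univ]; exact hb.measure_lt_top⟩
  obtain ⟨C₁, hC₁0, hC₁⟩ := h.exists_bound_rtBasis
  obtain ⟨C₂, hC₂0, hC₂⟩ := exists_bound_rtDiv T T'
  set c := centroid e with hc
  -- The factors start at `1 / 2`, which bounds their inverses by `2`. They stay below `1`, so that
  -- the contracted support is compact inside `Ω`, and they tend to `1`.
  let t : ℕ → ℝ := fun n => 1 - 1 / ((n : ℝ) + 1 + 1)
  have ht0 : ∀ n, 1 / 2 ≤ t n := fun n => by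
    have : 1 / ((n : ℝ) + 1 + 1) ≤ 1 / 2 := by
      apply one_div_le_one_div_of_le <;> linarith [Nat.cast_nonneg (α := ℝ) n]
    simp only [t]; linarith
  have htp : ∀ n, 0 < t n := fun n => by linarith [ht0 n]
  have ht1 : ∀ n, t n < 1 := fun n => by
    have : (0 : ℝ) < 1 / ((n : ℝ) + 1 + 1) := by positivity
    simp only [t]; linarith
  have hti : ∀ n, (t n)⁻¹ ≤ 2 := fun n => by
    rw [inv_le_comm₀ (htp n) two_pos]; simpa using ht0 n
  have htlim : Tendsto (fun n => (t n)⁻¹) atTop (𝓝 1) := by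
    have h1 : Tendsto (fun n : ℕ => 1 / ((n : ℝ) + 1 + 1)) atTop (𝓝 0) := by
      have := (tendsto_one_div_add_atTop_nhds_zero_nat (𝕜 := ℝ)).comp (tendsto_add_atTop_nat 1)
      refine this.congr fun n => ?_
      simp
    have h2 : Tendsto t atTop (𝓝 (1 - 0)) := tendsto_const_nhds.sub h1
    rw [sub_zero] at h2
    simpa using h2.inv₀ one_ne_zero
  have hzero : ∀ n, ∫ x in Ω, (inner ℝ (𝒯.rtBasis e (c + (t n)⁻¹ • (x - c))) (γ x) +
      (t n)⁻¹ * rtDiv T T' (c + (t n)⁻¹ • (x - c)) * φ x) = 0 := fun n => by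
    have hcomp : Measurable fun x : Vec d => c + (t n)⁻¹ • (x - c) := by fun_prop
    set K : Set (Vec d) := (fun x => c + t n • (x - c)) ''
      (convexHull ℝ (T : Set (Vec d)) ∪ convexHull ℝ (T' : Set (Vec d))) with hKdef
    have hK : IsCompact K := (IsSimplex.isCompact_convexHull.union
      IsSimplex.isCompact_convexHull).image (by fun_prop)
    have hKΩ : K ⊆ Ω := by
      rintro _ ⟨x, hx | hx, rfl⟩
      · have := homothety_mem hΩ hd h.hT h.hT' h.ne h.ha h.ha' (h.erase_eq.trans h.erase_eq'.symm)
          (htp n) (ht1 n) hx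
        rwa [h.erase_eq] at this
      · have := homothety_mem hΩ hd h.hT' h.hT h.ne.symm h.ha' h.ha
          (h.erase_eq'.trans h.erase_eq.symm) (htp n) (ht1 n) hx
        rwa [h.erase_eq'] at this
    refine integral_inner_add_eq_zero (C := C₁ + 2 * C₂) hb ho hK hKΩ
      (Ψ := fun x => 𝒯.rtBasis e (c + (t n)⁻¹ • (x - c)))
      (δ := fun x => (t n)⁻¹ * rtDiv T T' (c + (t n)⁻¹ • (x - c)))
      (h.measurable_rtBasis.comp hcomp).aestronglyMeasurable
      (((measurable_rtDiv T T').comp hcomp).const_mul _).aestronglyMeasurable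
      (fun x => (hC₁ _).trans (by linarith)) (fun x => ?_) (fun x hx => ?_)
      (fun χ hχ => h.integral_rtBasis_homothety hd c (htp n) (hχ.of_le (by simp))) hφ
    · rw [norm_mul, Real.norm_of_nonneg (inv_pos.2 (htp n)).le]
      have := mul_le_mul (hti n) (hC₂ (c + (t n)⁻¹ • (x - c))) (norm_nonneg _) zero_le_two
      linarith
    · have hx' : c + (t n)⁻¹ • (x - c) ∉
          convexHull ℝ (T : Set (Vec d)) ∪ convexHull ℝ (T' : Set (Vec d)) := fun hmem =>
        hx ⟨_, hmem, by
          simp only [add_sub_cancel_left, smul_inv_smul₀ (htp n).ne', add_sub_cancel]⟩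
      rw [Set.mem_union, not_or] at hx'
      simp only [h.rtBasis_eq]
      rw [Set.indicator_of_notMem fun hm => hx'.1 (IsSimplex.cell_subset hm),
        Set.indicator_of_notMem fun hm => hx'.2 (IsSimplex.cell_subset hm), sub_zero]
  -- The contraction is undone in the limit; only the field and its divergence move, while `φ` and
  -- `γ` are fixed, so bounds on the former give the domination.
  have hlim := tendsto_integral_of_dominated_convergence (μ := volume.restrict Ω)
    (F := fun n x => inner ℝ (𝒯.rtBasis e (c + (t n)⁻¹ • (x - c))) (γ x) +
      (t n)⁻¹ * rtDiv T T' (c + (t n)⁻¹ • (x - c)) * φ x)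
    (f := fun x => inner ℝ (𝒯.rtBasis e x) (γ x) + rtDiv T T' x * φ x)
    (fun x => C₁ * ‖γ x‖ + 2 * C₂ * ‖φ x‖)
    (fun n => by
      have hcomp : Measurable fun x : Vec d => c + (t n)⁻¹ • (x - c) := by fun_prop
      exact ((h.measurable_rtBasis.comp hcomp).aestronglyMeasurable.inner hφ.2.1.1).add
        ((((measurable_rtDiv T T').comp hcomp).const_mul _).aestronglyMeasurable.mul hφ.1.1))
    (((hφ.2.1.integrable (by norm_num)).norm.const_mul _).add
      ((hφ.1.integrable (by norm_num)).norm.const_mul _))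
    (fun n => Eventually.of_forall fun x => by
      refine (norm_add_le _ _).trans (add_le_add ?_ ?_)
      · exact (norm_inner_le_norm _ _).trans
          (mul_le_mul_of_nonneg_right (hC₁ _) (norm_nonneg _))
      · rw [norm_mul, norm_mul, Real.norm_of_nonneg (inv_pos.2 (htp n)).le]
        exact mul_le_mul_of_nonneg_right
          (mul_le_mul (hti n) (hC₂ _) (norm_nonneg _) zero_le_two) (norm_nonneg _))
    (by
      filter_upwards [ae_restrict_of_ae (ae_notMem_frontier_cell T),
        ae_restrict_of_ae (ae_notMem_frontier_cell T')] with x hx hx'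
      have hcv : Tendsto (fun n => c + (t n)⁻¹ • (x - c)) atTop (𝓝 x) := by
        have := (htlim.smul_const (x - c)).const_add c
        rwa [one_smul, add_sub_cancel] at this
      have hc1 : ContinuousAt (𝒯.rtBasis e) x := by
        rw [show 𝒯.rtBasis e = _ from funext h.rtBasis_eq]
        exact (continuousAt_indicator_cell T (by fun_prop) hx).sub
          (continuousAt_indicator_cell T' (by fun_prop) hx')
      have hc2 : ContinuousAt (rtDiv T T') x :=
        (continuousAt_indicator_cell T continuous_const hx).sub
          (continuousAt_indicator_cell T' continuous_const hx')
      have l1 := (hc1.tendsto.comp hcv).inner (𝕜 := ℝ) (tendsto_const_nhds (x := γ x))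
      have l2 := (htlim.mul (hc2.tendsto.comp hcv)).mul_const (φ x)
      rw [one_mul] at l2
      exact l1.add l2)
  simp only [hzero] at hlim
  exact tendsto_nhds_unique hlim tendsto_const_nhds

end Triangulation

end RaviartThomas

/-! ### Local structure of `RT0` fields and affine fields -/

section RaviartThomasBasis

open scoped Classical

variable {d : ℕ} {Ω : Set (Vec d)}

theorem isFiniteMeasure_restrict (hb : Bornology.IsBounded Ω) :
    IsFiniteMeasure (volume.restrict Ω) :=
  ⟨by rw [Measure.restrict_apply_univ]; exact hb.measure_lt_top⟩

namespace Triangulation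

variable {𝒯 : Triangulation Ω} {e T T' : Finset (Vec d)} {a a' : Vec d}

theorem Adjacent.memLp_rtBasis (h : 𝒯.Adjacent e T T' a a') (hb : Bornology.IsBounded Ω) :
    MemLp (𝒯.rtBasis e) 2 (volume.restrict Ω) := by
  have := isFiniteMeasure_restrict hb
  obtain ⟨C, -, hC⟩ := h.exists_bound_rtBasis
  exact MemLp.of_bound h.measurable_rtBasis.aestronglyMeasurable C (Eventually.of_forall hC)

theorem Adjacent.hasWeakDiv_rtBasis (h : 𝒯.Adjacent e T T' a a') (hd : 0 < d)
    (hΩ : interior (closure Ω) = Ω) (ho : IsOpen Ω) (hb : Bornology.IsBounded Ω) :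
    HasWeakDiv Ω (𝒯.rtBasis e) (rtDiv T T') := by
  have := isFiniteMeasure_restrict hb
  obtain ⟨C, -, hC⟩ := exists_bound_rtDiv T T'
  have hδ : MemLp (rtDiv T T') 2 (volume.restrict Ω) :=
    MemLp.of_bound (measurable_rtDiv T T').aestronglyMeasurable C (Eventually.of_forall hC)
  refine ⟨h.memLp_rtBasis hb, hδ, fun φ hφ => ?_⟩
  have h1 := h.integral_domain_rtBasis hd hΩ ho hb
    (hasWeakGrad_of_contDiff (hφ.1.of_le (by simp)) hb)
  rw [integral_add (integrable_inner_of_memLp (h.memLp_rtBasis hb) hφ.memLp_gradient)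
    (integrable_mul_of_memLp hδ hφ.memLp)] at h1
  linarith

theorem Adjacent.memH0Div_rtBasis (h : 𝒯.Adjacent e T T' a a') (hd : 0 < d)
    (hΩ : interior (closure Ω) = Ω) (ho : IsOpen Ω) (hb : Bornology.IsBounded Ω) :
    MemH0Div Ω (𝒯.rtBasis e) :=
  ⟨_, h.hasWeakDiv_rtBasis hd hΩ ho hb, fun _ _ hφ => h.integral_domain_rtBasis hd hΩ ho hb hφ⟩

/-- The basis functions belong to `RT0`. -/
theorem Adjacent.toLp_mem_RT0 (h : 𝒯.Adjacent e T T' a a') (hd : 0 < d)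
    (hΩ : interior (closure Ω) = Ω) (ho : IsOpen Ω) (hb : Bornology.IsBounded Ω) :
    (h.memLp_rtBasis hb).toLp _ ∈ 𝒯.RT0 := by
  have hae := (h.memLp_rtBasis hb).coeFn_toLp
  refine ⟨(h.memH0Div_rtBasis hd hΩ ho hb).congr hae.symm, fun S hS => ?_⟩
  obtain ⟨κ, hκ⟩ : ∃ κ, κ = (if S = 𝒯.plusElement e then 1 else -1) /
    (d * volume.real (cell S)) := ⟨_, rfl⟩
  refine ⟨if e ⊆ S then -(κ • ∑ a ∈ S \ e, a) else 0, if e ⊆ S then κ else 0, ?_⟩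
  filter_upwards [hae] with x hx hxS
  rw [hx, rtBasis_apply hS hxS, ← hκ]
  by_cases heS : e ⊆ S
  · simp only [if_pos heS, smul_sub]; abel
  · simp only [if_neg heS, zero_smul, add_zero]

theorem ae_domain_of_ae_cell {p : Vec d → Prop}
    (h : ∀ T ∈ 𝒯.elements, ∀ᵐ x ∂volume.restrict Ω, x ∈ cell T → p x) :
    ∀ᵐ x ∂volume.restrict Ω, p x := by
  have h1 : ∀ᵐ x ∂volume.restrict Ω, ∀ T ∈ 𝒯.elements, x ∈ cell T → p x :=
    (Finset.eventually_all _).2 h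
  filter_upwards [h1, 𝒯.ae_mem_cell] with x hx ⟨T, hT, hxT⟩
  exact hx T hT hxT

theorem ae_cell_of_ae_domain (hΩ : interior (closure Ω) = Ω) (hT : T ∈ 𝒯.elements)
    {p : Vec d → Prop} (h : ∀ᵐ x ∂volume.restrict Ω, x ∈ cell T → p x) :
    ∀ᵐ x ∂volume.restrict (cell T), p x := by
  have h1 := ae_restrict_of_ae_restrict_of_subset (𝒯.cell_subset hΩ hT) h
  filter_upwards [h1, ae_restrict_mem IsSimplex.measurableSet_cell] with x hx hxT
  exact hx hxT

theorem ae_domain_of_ae_restrict_cell {p : Vec d → Prop}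
    (h : ∀ᵐ x ∂volume.restrict (cell T), p x) :
    ∀ᵐ x ∂volume.restrict Ω, x ∈ cell T → p x :=
  ae_restrict_of_ae ((ae_restrict_iff' IsSimplex.measurableSet_cell).1 h)

/-- An integral over the domain is the sum of the integrals over the elements. -/
theorem integral_eq_sum_cell (hΩ : interior (closure Ω) = Ω) (ho : IsOpen Ω) {f : Vec d → ℝ}
    (hf : Integrable f (volume.restrict Ω)) :
    ∫ x in Ω, f x = ∑ T ∈ 𝒯.elements, ∫ x in cell T, f x := by
  have hsub : (⋃ T ∈ 𝒯.elements, cell T) ⊆ Ω := Set.iUnion₂_subset fun T hT => 𝒯.cell_subset hΩ hT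
  have h1 : ((⋃ T ∈ 𝒯.elements, cell T : Set (Vec d)) : Set (Vec d)) =ᵐ[volume] Ω := by
    have hae := 𝒯.ae_mem_cell
    refine hsub.eventuallyLE.antisymm ?_
    have h2 : ∀ᵐ x ∂volume.restrict Ω, x ∈ ⋃ T ∈ 𝒯.elements, cell T := by
      filter_upwards [hae] with x ⟨T, hT, hx⟩
      exact Set.mem_biUnion hT hx
    exact (ae_restrict_iff' ho.measurableSet).1 h2
  rw [← setIntegral_congr_set h1, integral_biUnion_finset]
  · exact fun T _ => IsSimplex.measurableSet_cell
  · exact fun S hS S' hS' hne => disjoint_cell hS hS' hne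
  · exact fun S hS => IntegrableOn.mono_set hf (𝒯.cell_subset hΩ hS)

/-- On a simplex, the field `b + c x` is a combination of the fields `x - v`, where `v` is a
vertex. -/
theorem _root_.StokesFEM.IsSimplex.affine_eq_sum (h : IsSimplex T) (b : Vec d) (c : ℝ) :
    ∃ k : Vec d → ℝ, (∑ v ∈ T, k v = c) ∧ ∀ x, b + c • x = ∑ v ∈ T, k v • (x - v) := by
  -- The weights must satisfy `∑ k_v = c` and `∑ k_v v = -b`. Coordinates of `-b` give the second
  -- condition with total weight `1`; adding `c - 1` times those of the origin corrects the total
  -- without changing the moment.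
  have hk : ∑ v ∈ T, (h.coord v (-b) + (c - 1) * h.coord v 0) = c := by
    rw [Finset.sum_add_distrib, ← Finset.mul_sum, h.sum_coord, h.sum_coord]; ring
  refine ⟨fun v => h.coord v (-b) + (c - 1) * h.coord v 0, hk, fun x => ?_⟩
  simp only [smul_sub, Finset.sum_sub_distrib, ← Finset.sum_smul, hk]
  simp only [add_smul, mul_smul, Finset.sum_add_distrib, ← Finset.smul_sum, h.sum_coord_smul]
  rw [smul_zero, add_zero, sub_neg_eq_add, add_comm]

/-- By continuity the identity extends to the vertices `u`, where it reads `(∑ k_v) u = ∑ k_v v`.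
Two distinct vertices force both sums to vanish, and affine independence finishes. -/
theorem _root_.StokesFEM.IsSimplex.coeff_eq_zero (h : IsSimplex T) (hd : 0 < d) {k : Vec d → ℝ}
    (hk : ∀ᵐ x ∂volume.restrict (cell T), ∑ v ∈ T, k v • (x - v) = 0) : ∀ v ∈ T, k v = 0 := by
  have hc : Continuous fun x : Vec d => ∑ v ∈ T, k v • (x - v) := by fun_prop
  have h1 : Set.EqOn (fun x : Vec d => ∑ v ∈ T, k v • (x - v)) (fun _ => 0) (cell T) :=
    Measure.eqOn_open_of_ae_eq (μ := volume) hk IsSimplex.isOpen_cell hc.continuousOn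
      continuousOn_const
  have h2 : ∀ u ∈ T, (∑ v ∈ T, k v) • u = ∑ v ∈ T, k v • v := fun u hu => by
    have h3 := h1.closure hc continuous_const
      (h.convexHull_subset_closure_cell (subset_convexHull ℝ _ (Finset.mem_coe.2 hu)))
    simpa [smul_sub, ← Finset.sum_smul, sub_eq_zero] using h3
  obtain ⟨u, hu, u', hu', hne⟩ : ∃ u ∈ T, ∃ u' ∈ T, u ≠ u' :=
    Finset.one_lt_card.1 (by rw [h.card_eq]; omega)
  have h3 : ∑ v ∈ T, k v = 0 := by
    have : (∑ v ∈ T, k v) • (u - u') = 0 := by rw [smul_sub, h2 u hu, h2 u' hu', sub_self]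
    exact (smul_eq_zero.1 this).resolve_right (sub_ne_zero.2 hne)
  have h4 : ∑ v ∈ T, k v • v = 0 := by rw [← h2 u hu, h3, zero_smul]
  have h5 := affineIndependent_iff.1 h.affineIndependent Finset.univ (fun v => k v)
    (by rw [Finset.sum_coe_sort T k, h3]) (by rw [Finset.sum_coe_sort T fun v => k v • v, h4])
  exact fun v hv => h5 ⟨v, hv⟩ (Finset.mem_univ _)

/-- The gradient of the `i`-th component of a linear map. -/
noncomputable def _root_.StokesFEM.rowVec (A : Vec d →ₗ[ℝ] Vec d) (i : Fin d) : Vec d :=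
  (InnerProductSpace.toDual ℝ (Vec d)).symm
    ((EuclideanSpace.proj i : Vec d →L[ℝ] ℝ).comp (LinearMap.toContinuousLinearMap A))

theorem _root_.StokesFEM.inner_rowVec (A : Vec d →ₗ[ℝ] Vec d) (i : Fin d) (x : Vec d) :
    inner ℝ (rowVec A i) x = A x i := by
  rw [rowVec, InnerProductSpace.toDual_symm_apply]
  rfl

theorem _root_.StokesFEM.rowVec_apply (A : Vec d →ₗ[ℝ] Vec d) (i j : Fin d) :
    rowVec A i j = A (EuclideanSpace.single j 1) i := by
  rw [← inner_rowVec, real_inner_comm, EuclideanSpace.inner_single_left]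
  simp

theorem _root_.StokesFEM.hasWeakGrad_component {U : Set (Vec d)} (hU : Bornology.IsBounded U)
    (A : Vec d →ₗ[ℝ] Vec d) (b : Vec d) (i : Fin d) :
    HasWeakGrad U (fun x => (A x + b) i) (fun _ => rowVec A i) := by
  have := hasWeakGrad_affine (rowVec A i) (b i) hU
  simpa only [inner_rowVec, ← PiLp.add_apply] using this

/-- The weak divergence of an affine field. -/
theorem _root_.StokesFEM.hasWeakDiv_affine {U : Set (Vec d)} (hU : Bornology.IsBounded U)
    (A : Vec d →ₗ[ℝ] Vec d) (b : Vec d) :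
    HasWeakDiv U (fun x => A x + b) (fun _ => ∑ i, rowVec A i i) := by
  have hA : Continuous A := A.continuous_of_finiteDimensional
  exact HasWeakDiv.of_hasWeakGrad (memLp_of_continuous (by fun_prop) hU 2)
    (hasWeakGrad_component hU A b)

theorem _root_.StokesFEM.hasWeakDiv_radial {U : Set (Vec d)} (hU : Bornology.IsBounded U)
    (b : Vec d) (c : ℝ) : HasWeakDiv U (fun x => b + c • x) (fun _ => d * c) := by
  have := hasWeakDiv_affine hU (c • LinearMap.id) b
  convert this using 1
  · funext x; simp [add_comm]
  · funext x; simp [rowVec_apply]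

end Triangulation

end RaviartThomasBasis

/-! ### Expansion of `RT0` fields in the basis -/

section RaviartThomasExpansion

open scoped Classical

variable {d : ℕ} {Ω : Set (Vec d)}

namespace Triangulation

variable {𝒯 : Triangulation Ω} {e T T' : Finset (Vec d)} {a a' : Vec d}

theorem isBounded_cell (T : Finset (Vec d)) : Bornology.IsBounded (cell T) :=
  IsSimplex.isCompact_convexHull.isBounded.subset interior_subset

theorem sum_smul_sub (k : Vec d → ℝ) (T : Finset (Vec d)) (x : Vec d) :
    ∑ u ∈ T, k u • (x - u) = -(∑ u ∈ T, k u • u) + (∑ u ∈ T, k u) • x := by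
  simp only [smul_sub, Finset.sum_sub_distrib, Finset.sum_smul]
  abel

/-- Balance of the fluxes of a piecewise `RT0` field in `H₀(div)`. -/
theorem sum_faceFlux_eq_zero (hΩ : interior (closure Ω) = Ω) (ho : IsOpen Ω)
    (hb : Bornology.IsBounded Ω) {v : Vec d → Vec d} (hv : MemH0Div Ω v)
    {k : Finset (Vec d) → Vec d → ℝ} (hk : ∀ T ∈ 𝒯.elements,
      ∀ᵐ x ∂volume.restrict Ω, x ∈ cell T → v x = ∑ u ∈ T, k T u • (x - u))
    {χ : Vec d → ℝ} (hχ : ContDiff ℝ 1 χ) :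
    ∑ T ∈ 𝒯.elements, ∑ u ∈ T, k T u * faceFlux T u χ = 0 := by
  obtain ⟨δ, hδ, h0⟩ := hv
  have hw := hasWeakGrad_of_contDiff hχ hb
  have hint : Integrable (fun x => inner ℝ (v x) (gradient χ x) + δ x * χ x) (volume.restrict Ω) :=
    (integrable_inner_of_memLp hδ.1 hw.2.1).add (integrable_mul_of_memLp hδ.2.1 hw.1)
  rw [← h0 χ _ hw, integral_eq_sum_cell (𝒯 := 𝒯) hΩ ho hint]
  refine Finset.sum_congr rfl fun T hT => ?_
  have h1 := ae_cell_of_ae_domain hΩ hT (hk T hT)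
  -- With this local divergence, the contribution of `T` to the trace identity is a sum of integrals
  -- of the divergences of `χ(x) (x - u)`, that is, of face fluxes.
  have h2 : δ =ᵐ[volume.restrict (cell T)] fun _ => d * ∑ u ∈ T, k T u := by
    refine (hδ.mono ho.measurableSet (𝒯.cell_subset hΩ hT)).ae_eq IsSimplex.isOpen_cell
      (hasWeakDiv_radial (isBounded_cell T) (-(∑ u ∈ T, k T u • u)) (∑ u ∈ T, k T u)) ?_
    filter_upwards [h1] with x hx
    rw [hx, sum_smul_sub]
  have hg := continuous_gradient hχ
  have hc := hχ.continuous
  simp only [faceFlux, ← integral_const_mul]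
  rw [← integral_finsetSum _ fun u _ => integrableOn_cell (by fun_prop)]
  refine integral_congr_ae ?_
  filter_upwards [h1, h2] with x hx hx'
  rw [hx, hx', sum_inner, Finset.mul_sum, Finset.sum_mul, ← Finset.sum_add_distrib]
  refine Finset.sum_congr rfl fun u _ => ?_
  rw [real_inner_smul_left]
  ring

/-- The centroid of a face lies on no other face. -/
theorem centroid_notMem_face (hd : 0 < d) (hT : T ∈ 𝒯.elements) (ha : a ∈ T)
    (hT' : T' ∈ 𝒯.elements) (ha' : a' ∈ T') (hne : T'.erase a' ≠ T.erase a) :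
    centroid (T.erase a) ∉ convexHull ℝ ((T'.erase a' : Finset (Vec d)) : Set (Vec d)) := by
  intro hc
  have h := 𝒯.isSimplex hT
  have h' := 𝒯.isSimplex hT'
  have hcard : (T.erase a).card = d := by
    rw [Finset.card_erase_of_mem ha, h.card_eq, Nat.add_sub_cancel]
  have hcard' : (T'.erase a').card = d := by
    rw [Finset.card_erase_of_mem ha', h'.card_eq, Nat.add_sub_cancel]
  have hne' : (T.erase a).Nonempty := by rw [← Finset.card_pos]; omega
  have hcc : (((T.erase a).card : ℝ)⁻¹) ≠ 0 := by rw [hcard]; positivity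
  have hmem : centroid (T.erase a) ∈ convexHull ℝ ((T ∩ T' : Finset (Vec d)) : Set (Vec d)) := by
    rw [Finset.coe_inter, ← 𝒯.conforming T hT T' hT']
    refine ⟨h.mem_convexHull.2 fun v hv => ?_,
      convexHull_mono (Finset.coe_subset.2 (Finset.erase_subset _ _)) hc⟩
    rw [h.coord_centroid hne' (Finset.erase_subset _ _) hv]
    split_ifs <;> positivity
  -- The centroid has positive coordinates at all vertices of its face, so conformity puts these
  -- vertices in `T'`. Since the coordinate at `a'` vanishes at the centroid, `a'` is not among
  -- them, and equal cardinality identifies the faces.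
  have hsub : T.erase a ⊆ T' := fun v hv => by
    by_contra hvT'
    have hvT := Finset.mem_of_mem_erase hv
    have h0 := h.coord_eq_zero_of_mem_convexHull Finset.inter_subset_left hmem hvT
      fun hv' => hvT' (Finset.mem_inter.1 hv').2
    rw [h.coord_centroid hne' (Finset.erase_subset _ _) hvT, if_pos hv] at h0
    exact hcc h0
  have ha'e : a' ∉ T.erase a := fun ha'e => by
    have h0 := h'.coord_eq_zero_of_mem_convexHull (Finset.erase_subset _ _) hc ha'
      (Finset.notMem_erase _ _)
    rw [h'.coord_centroid hne' hsub ha', if_pos ha'e] at h0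
    exact hcc h0
  refine hne (Finset.eq_of_subset_of_card_le (fun v hv => ?_) (by rw [hcard, hcard'])).symm
  exact Finset.mem_erase.2 ⟨fun hva => ha'e (hva ▸ hv), hsub hv⟩

/-- The normal components of a piecewise `RT0` field in `H₀(div)` are balanced on every face. -/
theorem sum_coeff_mul_volume_eq_zero (hd : 0 < d) (hΩ : interior (closure Ω) = Ω) (ho : IsOpen Ω)
    (hb : Bornology.IsBounded Ω) {v : Vec d → Vec d} (hv : MemH0Div Ω v)
    {k : Finset (Vec d) → Vec d → ℝ} (hk : ∀ T ∈ 𝒯.elements,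
      ∀ᵐ x ∂volume.restrict Ω, x ∈ cell T → v x = ∑ u ∈ T, k T u • (x - u))
    (hT : T ∈ 𝒯.elements) (ha : a ∈ T) :
    ∑ S ∈ 𝒯.elements, ∑ u ∈ S with S.erase u = T.erase a, k S u * volume.real (cell S) = 0 := by
  have h := 𝒯.isSimplex hT
  set c := centroid (T.erase a) with hc
  -- A bump at the centroid that vanishes on all other faces isolates the fluxes through this one.
  set Z : Set (Vec d) := ⋃ q ∈ (𝒯.elements.sigma fun S => S.filter fun u => S.erase u ≠ T.erase a),
    convexHull ℝ ((q.1.erase q.2 : Finset (Vec d)) : Set (Vec d)) with hZ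
  have hZc : IsClosed Z := Set.Finite.isClosed_biUnion (Finset.finite_toSet _) fun q _ =>
    IsSimplex.isCompact_convexHull.isClosed
  have hcZ : c ∉ Z := by
    intro hcZ
    obtain ⟨q, hq, hcq⟩ := Set.mem_iUnion₂.1 hcZ
    rw [Finset.mem_sigma, Finset.mem_filter] at hq
    exact centroid_notMem_face hd hT ha hq.1 hq.2.1 hq.2.2 hcq
  obtain ⟨r, hr, hrZ⟩ := Metric.isOpen_iff.1 hZc.isOpen_compl c hcZ
  let B : ContDiffBump c := ⟨r / 2, r, by positivity, half_lt_self hr⟩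
  have hB : ContDiff ℝ 1 B := B.contDiff
  have hB0 : ∀ x ∈ Z, B x = 0 := fun x hx => B.zero_of_le_dist (by
    by_contra hlt
    exact hrZ (Metric.mem_ball.2 (not_le.1 hlt)) hx)
  have hpos : 0 < faceFlux T a B := h.faceFlux_pos ha hd hB (fun x => B.nonneg)
    (B.pos_of_mem_ball (Metric.mem_ball_self hr))
  have hV := h.volume_real_cell_pos
  have hsum := sum_faceFlux_eq_zero hΩ ho hb hv hk hB
  have hS : ∀ S ∈ 𝒯.elements, ∑ u ∈ S, k S u * faceFlux S u B =
      faceFlux T a B / volume.real (cell T) *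
        ∑ u ∈ S with S.erase u = T.erase a, k S u * volume.real (cell S) := fun S hS => by
    rw [Finset.mul_sum, Finset.sum_filter]
    refine Finset.sum_congr rfl fun u hu => ?_
    have hs := 𝒯.isSimplex hS
    split_ifs with hue
    · rw [← h.faceFlux_div_eq hs ha hu hue.symm hd hB]
      have := hs.volume_real_cell_pos
      field_simp
    · rw [hs.faceFlux_eq_zero hu hd hB fun x hx => hB0 x ?_, mul_zero]
      exact Set.mem_biUnion (x := (⟨S, u⟩ : Σ _ : Finset (Vec d), Vec d))
        (Finset.mem_coe.2 (Finset.mem_sigma.2 ⟨hS, Finset.mem_filter.2 ⟨hu, hue⟩⟩)) hx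
  rw [Finset.sum_congr rfl hS, ← Finset.mul_sum] at hsum
  exact (mul_eq_zero.1 hsum).resolve_left (div_pos hpos hV).ne'

theorem filter_erase_eq_singleton {S : Finset (Vec d)} {u : Vec d} (hu : u ∈ S) {e : Finset (Vec d)}
    (he : S.erase u = e) : (S.filter fun w => S.erase w = e) = {u} := by
  ext w
  rw [Finset.mem_filter, Finset.mem_singleton]
  constructor
  · rintro ⟨hw, hwe⟩
    by_contra hne
    have : w ∈ S.erase u := Finset.mem_erase.2 ⟨hne, hw⟩
    rw [he, ← hwe] at this
    exact Finset.notMem_erase _ _ this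
  · rintro rfl
    exact ⟨hu, he⟩

/-- Every function in `RT0` is a combination of the basis functions. -/
theorem exists_rtCoeff (hd : 0 < d) (hΩ : interior (closure Ω) = Ω) (ho : IsOpen Ω)
    (hb : Bornology.IsBounded Ω) {v : LTwoVec Ω} (hv : v ∈ 𝒯.RT0) :
    ∃ c : 𝒯.interiorFaces → ℝ,
      ∀ᵐ x ∂volume.restrict Ω, v x = ∑ e, c e • 𝒯.rtBasis e.1 x := by
  have hk : ∃ k : Finset (Vec d) → Vec d → ℝ, ∀ T ∈ 𝒯.elements,
      ∀ᵐ x ∂volume.restrict Ω, x ∈ cell T → v x = ∑ u ∈ T, k T u • (x - u) := by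
    have : ∀ T : Finset (Vec d), ∃ k : Vec d → ℝ, T ∈ 𝒯.elements →
        ∀ᵐ x ∂volume.restrict Ω, x ∈ cell T → v x = ∑ u ∈ T, k u • (x - u) := fun T => by
      by_cases hT : T ∈ 𝒯.elements
      · obtain ⟨b, c, hbc⟩ := hv.2 T hT
        obtain ⟨k, -, hk⟩ := (𝒯.isSimplex hT).affine_eq_sum b c
        refine ⟨k, fun _ => ?_⟩
        filter_upwards [hbc] with x hx hxT
        rw [hx hxT, hk]
      · exact ⟨0, fun h => absurd h hT⟩
    choose k hk using this
    exact ⟨k, hk⟩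
  obtain ⟨k, hk⟩ := hk
  have hbal := fun {T : Finset (Vec d)} {a : Vec d} (hT : T ∈ 𝒯.elements) (ha : a ∈ T) =>
    sum_coeff_mul_volume_eq_zero hd hΩ ho hb hv.1 hk hT ha
  have hsingle : ∀ {S e : Finset (Vec d)} {u : Vec d}, u ∈ S → S.erase u = e →
      ∑ u ∈ S with S.erase u = e, k S u * volume.real (cell S) = k S u * volume.real (cell S) :=
    fun hu he => by rw [filter_erase_eq_singleton hu he, Finset.sum_singleton]
  have hempty : ∀ {S e : Finset (Vec d)}, ¬ e ⊆ S →
      ∑ u ∈ S with S.erase u = e, k S u * volume.real (cell S) = 0 := fun {S e} he => by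
    rw [Finset.filter_false_of_mem, Finset.sum_empty]
    rintro u - rfl
    exact he (Finset.erase_subset _ _)
  -- A face of only one element contributes a single term to the balance.
  have hbdry : ∀ T ∈ 𝒯.elements, ∀ a ∈ T, T.erase a ∉ 𝒯.interiorFaces → k T a = 0 := by
    intro T hT a ha hne
    have h := hbal hT ha
    rw [Finset.sum_eq_single_of_mem T hT, hsingle ha rfl] at h
    · exact (mul_eq_zero.1 h).resolve_right (𝒯.isSimplex hT).volume_real_cell_pos.ne'
    · intro S hS hST
      refine hempty fun hsub => hne (𝒯.mem_interiorFaces.2 ⟨?_, T, hT, S, hS, hST.symm,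
        Finset.erase_subset _ _, hsub⟩)
      rw [Finset.card_erase_of_mem ha, 𝒯.card_eq T hT, Nat.add_sub_cancel]
  have hint : ∀ {e T T' a a'}, 𝒯.Adjacent e T T' a a' →
      k T a * volume.real (cell T) + k T' a' * volume.real (cell T') = 0 := by
    intro e T T' a a' h
    have h1 := hbal h.hT h.ha
    rw [Finset.sum_eq_add_of_mem T T' h.hT h.hT' h.ne, hsingle h.ha rfl,
      hsingle h.ha' (h.erase_eq'.trans h.erase_eq.symm)] at h1
    · exact h1
    · intro S hS hne
      refine hempty fun hsub => ?_
      rw [h.erase_eq] at hsub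
      exact (h.eq_or_eq S hS hsub).elim hne.1 hne.2
  choose P P' b b' hadj using fun e : 𝒯.interiorFaces => exists_adjacent e.2
  -- The coefficient is the flux out of the plus element: there `Φ_e = (x - b) / (d |P|)`. On the
  -- other element the balance `hint` provides the matching value and sign.
  refine ⟨fun e => k (P e) (b e) * (d * volume.real (cell (P e))),
    ae_domain_of_ae_cell (𝒯 := 𝒯) fun S hS => ?_⟩
  filter_upwards [hk S hS] with x hx hxS
  rw [hx hxS]
  have hterm : ∀ e : 𝒯.interiorFaces, (k (P e) (b e) * (d * volume.real (cell (P e)))) •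
      𝒯.rtBasis e.1 x = ∑ u ∈ S with S.erase u = e.1, k S u • (x - u) := fun e => by
    have hd' : (d : ℝ) ≠ 0 := by positivity
    by_cases heS : e.1 ⊆ S
    · have hV := (𝒯.isSimplex (hadj e).hT).volume_real_cell_pos.ne'
      have hV' := (𝒯.isSimplex (hadj e).hT').volume_real_cell_pos.ne'
      rw [rtBasis_apply hS hxS, if_pos heS, (hadj e).plus_eq]
      rcases (hadj e).eq_or_eq S hS heS with rfl | hS'
      · rw [if_pos rfl, sdiff_eq_of_erase_eq (hadj e).ha (hadj e).erase_eq, Finset.sum_singleton,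
          filter_erase_eq_singleton (hadj e).ha (hadj e).erase_eq, Finset.sum_singleton, smul_smul]
        congr 1
        field_simp
      · rw [if_neg (hS' ▸ (hadj e).ne.symm), hS',
          sdiff_eq_of_erase_eq (hadj e).ha' (hadj e).erase_eq', Finset.sum_singleton,
          filter_erase_eq_singleton (hadj e).ha' (hadj e).erase_eq', Finset.sum_singleton, smul_smul]
        congr 1
        have := hint (hadj e)
        field_simp
        linarith
    · rw [rtBasis_apply hS hxS, if_neg heS, smul_zero, Finset.filter_false_of_mem, Finset.sum_empty]
      intro u _ hue
      exact heS (hue ▸ Finset.erase_subset _ _)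
  simp only [hterm]
  rw [Finset.sum_coe_sort 𝒯.interiorFaces fun e => ∑ u ∈ S with S.erase u = e, k S u • (x - u)]
  simp only [Finset.sum_filter]
  -- Exchanging the sums indexes the faces of `S` by their opposite vertices. Boundary faces are
  -- absent from the sum, but their coefficients vanish by `hbdry`.
  rw [Finset.sum_comm]
  refine Finset.sum_congr rfl fun u hu => ?_
  rw [Finset.sum_ite_eq]
  split_ifs with hmem
  · rfl
  · rw [hbdry S hS u hu hmem, zero_smul]

/-- The basis functions are linearly independent. -/
theorem rtCoeff_unique (hd : 0 < d) (hΩ : interior (closure Ω) = Ω) {c : 𝒯.interiorFaces → ℝ}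
    (hc : ∀ᵐ x ∂volume.restrict Ω, ∑ e, c e • 𝒯.rtBasis e.1 x = 0) : c = 0 := by
  funext ⟨e, he⟩
  obtain ⟨T, T', a, a', h⟩ := exists_adjacent he
  obtain rfl := h.erase_eq
  have hs := 𝒯.isSimplex h.hT
  have h1 := ae_cell_of_ae_domain (p := fun x => ∑ e, c e • 𝒯.rtBasis e.1 x = 0) hΩ h.hT
    (by filter_upwards [hc] with x hx _ using hx)
  -- On `T` the combination is rewritten over opposite vertices, with `0` for boundary faces, so
  -- that `IsSimplex.coeff_eq_zero` applies.
  let k : Vec d → ℝ := fun u => if hu : T.erase u ∈ 𝒯.interiorFaces then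
    c ⟨T.erase u, hu⟩ * ((if T = 𝒯.plusElement (T.erase u) then 1 else -1) /
      (d * volume.real (cell T))) else 0
  have h2 : ∀ᵐ x ∂volume.restrict (cell T), ∑ u ∈ T, k u • (x - u) = 0 := by
    filter_upwards [h1, ae_restrict_mem IsSimplex.measurableSet_cell] with x hx hxT
    rw [← hx]
    have hterm : ∀ e : 𝒯.interiorFaces, c e • 𝒯.rtBasis e.1 x =
        ∑ u ∈ T with T.erase u = e.1, k u • (x - u) := fun ⟨e, he⟩ => by
      rw [rtBasis_apply h.hT hxT]
      by_cases heT : e ⊆ T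
      · obtain ⟨u, hu, rfl, hsd⟩ := exists_erase_eq
          (by rw [hs.card_eq, (𝒯.mem_interiorFaces.1 he).1]) heT
        rw [if_pos heT, hsd, Finset.sum_singleton, filter_erase_eq_singleton hu rfl,
          Finset.sum_singleton, smul_smul]
        simp only [k, dif_pos he]
      · rw [if_neg heT, smul_zero, Finset.filter_false_of_mem, Finset.sum_empty]
        intro u _ hue
        have hue : T.erase u = e := hue
        exact heT (hue ▸ Finset.erase_subset _ _)
    simp only [hterm]
    rw [Finset.sum_coe_sort 𝒯.interiorFaces fun e => ∑ u ∈ T with T.erase u = e, k u • (x - u)]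
    simp only [Finset.sum_filter]
    rw [Finset.sum_comm]
    refine Finset.sum_congr rfl fun u hu => ?_
    rw [Finset.sum_ite_eq]
    split_ifs with hmem
    · rfl
    · simp only [k, dif_neg hmem, zero_smul]
  have h3 := hs.coeff_eq_zero hd h2 a h.ha
  simp only [k, dif_pos he, if_pos h.plus_eq.symm] at h3
  have hV := hs.volume_real_cell_pos
  exact (mul_eq_zero.1 h3).resolve_right (by positivity)

end Triangulation

end RaviartThomasExpansion

/-! ### The space `V_h`: direct sum, finite dimension, components and coefficients -/

section DiscreteSpaces

open scoped Classical

variable {d : ℕ} {Ω : Set (Vec d)}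

theorem MemH0Div.weakDiv {v : Vec d → Vec d} (ho : IsOpen Ω) (h : MemH0Div Ω v) :
    HasWeakDiv Ω v (weakDiv Ω v) ∧ ∀ φ g, HasWeakGrad Ω φ g →
      ∫ x in Ω, (inner ℝ (v x) (g x) + StokesFEM.weakDiv Ω v x * φ x) = 0 := by
  obtain ⟨δ, hδ, h0⟩ := h
  have hae := weakDiv_ae_eq ho hδ
  refine ⟨⟨hδ.1, (memLp_congr_ae hae).2 hδ.2.1, fun φ hφ => ?_⟩, fun φ g hφ => ?_⟩
  · rw [hδ.2.2 φ hφ]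
    congr 1
    exact integral_congr_ae (by filter_upwards [hae] with x hx; rw [hx])
  · rw [← h0 φ g hφ]
    exact integral_congr_ae (by filter_upwards [hae] with x hx; rw [hx])

theorem HasWeakDiv.add {v v' : Vec d → Vec d} {δ δ' : Vec d → ℝ} (hδ : HasWeakDiv Ω v δ)
    (hδ' : HasWeakDiv Ω v' δ') : HasWeakDiv Ω (v + v') (δ + δ') := by
  refine ⟨hδ.1.add hδ'.1, hδ.2.1.add hδ'.2.1, fun φ hφ => ?_⟩
  simp only [Pi.add_apply, inner_add_left, add_mul]
  rw [integral_add (integrable_inner_of_memLp hδ.1 hφ.memLp_gradient)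
      (integrable_inner_of_memLp hδ'.1 hφ.memLp_gradient),
    integral_add (integrable_mul_of_memLp hδ.2.1 hφ.memLp) (integrable_mul_of_memLp hδ'.2.1 hφ.memLp),
    hδ.2.2 φ hφ, hδ'.2.2 φ hφ, neg_add]

theorem HasWeakDiv.smul {v : Vec d → Vec d} {δ : Vec d → ℝ} (c : ℝ) (hδ : HasWeakDiv Ω v δ) :
    HasWeakDiv Ω (c • v) (c • δ) := by
  refine ⟨hδ.1.const_smul c, hδ.2.1.const_smul c, fun φ hφ => ?_⟩
  simp only [Pi.smul_apply, real_inner_smul_left, smul_eq_mul, mul_assoc]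
  rw [integral_const_mul, integral_const_mul, hδ.2.2 φ hφ, mul_neg]

theorem HasWeakDiv.congr {v v' : Vec d → Vec d} {δ : Vec d → ℝ} (hδ : HasWeakDiv Ω v δ)
    (hv : v =ᵐ[volume.restrict Ω] v') : HasWeakDiv Ω v' δ := by
  refine ⟨(memLp_congr_ae hv).1 hδ.1, hδ.2.1, fun φ hφ => ?_⟩
  rw [← hδ.2.2 φ hφ]
  exact integral_congr_ae (by filter_upwards [hv] with x hx; rw [hx])

namespace Triangulation

variable {𝒯 : Triangulation Ω} {T : Finset (Vec d)}

theorem memH0Div_of_mem_V1 (ho : IsOpen Ω) {v : LTwoVec Ω} (hv : v ∈ 𝒯.V1) : MemH0Div Ω v :=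
  memH0Div_of_memH10 ho (Lp.memLp v) hv.1

theorem memH0Div_of_mem_Vh (ho : IsOpen Ω) {v : LTwoVec Ω} (hv : v ∈ 𝒯.Vh) : MemH0Div Ω v := by
  obtain ⟨y, hy, z, hz, rfl⟩ := Submodule.mem_sup.1 hv
  exact ((memH0Div_of_mem_V1 ho hy).add hz.1).congr (Lp.coeFn_add y z).symm

theorem exists_affine_of_mem_RT0 {v : LTwoVec Ω} (hv : v ∈ 𝒯.RT0) (hT : T ∈ 𝒯.elements) :
    ∃ (A : Vec d →ₗ[ℝ] Vec d) (b : Vec d), ∀ᵐ x ∂volume.restrict Ω, x ∈ cell T → v x = A x + b := by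
  obtain ⟨a, c, h⟩ := hv.2 T hT
  refine ⟨c • LinearMap.id, a, ?_⟩
  filter_upwards [h] with x hx hxT
  rw [hx hxT]
  simp [add_comm]

/-- Functions in `V_h` are piecewise affine. -/
theorem exists_affine_of_mem_Vh {v : LTwoVec Ω} (hv : v ∈ 𝒯.Vh) (hT : T ∈ 𝒯.elements) :
    ∃ (A : Vec d →ₗ[ℝ] Vec d) (b : Vec d), ∀ᵐ x ∂volume.restrict Ω, x ∈ cell T → v x = A x + b := by
  obtain ⟨y, hy, z, hz, rfl⟩ := Submodule.mem_sup.1 hv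
  obtain ⟨A, b, h⟩ := hy.2 T hT
  obtain ⟨A', b', h'⟩ := exists_affine_of_mem_RT0 hz hT
  refine ⟨A + A', b + b', ?_⟩
  filter_upwards [h, h', Lp.coeFn_add y z] with x hx hx' h0 hxT
  rw [h0, Pi.add_apply, hx hxT, hx' hxT, LinearMap.add_apply]
  abel

/-- The weak gradient on an element of an affine function. -/
theorem hasWeakGrad_cell (hΩ : interior (closure Ω) = Ω) (hT : T ∈ 𝒯.elements) {v : LTwoVec Ω}
    {A : Vec d →ₗ[ℝ] Vec d} {b : Vec d}
    (h : ∀ᵐ x ∂volume.restrict Ω, x ∈ cell T → v x = A x + b) (i : Fin d) :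
    HasWeakGrad (cell T) (fun x => v x i) (fun _ => rowVec A i) :=
  (hasWeakGrad_component (isBounded_cell T) A b i).congr (by
    filter_upwards [ae_cell_of_ae_domain hΩ hT h] with x hx
    rw [hx])

theorem exists_hasWeakGrad_cell (hΩ : interior (closure Ω) = Ω) (hT : T ∈ 𝒯.elements)
    {v : LTwoVec Ω} (hv : v ∈ 𝒯.Vh) (i : Fin d) :
    HasWeakGrad (cell T) (fun x => v x i) (weakGrad (cell T) fun x => v x i) := by
  obtain ⟨A, b, h⟩ := exists_affine_of_mem_Vh hv hT
  have h1 := hasWeakGrad_cell hΩ hT h i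
  have hex : ∃ g, HasWeakGrad (cell T) (fun x => v x i) g := ⟨_, h1⟩
  rw [weakGrad, dif_pos hex]
  exact hex.choose_spec

/-- The sum `V_h^1 + RT0` is direct. -/
theorem eq_zero_of_mem_V1_of_mem_RT0 (hd : 2 ≤ d) (hΩ : interior (closure Ω) = Ω) (ho : IsOpen Ω)
    (hb : Bornology.IsBounded Ω) {v : LTwoVec Ω} (h1 : v ∈ 𝒯.V1) (h2 : v ∈ 𝒯.RT0) : v = 0 := by
  have key : ∀ i, (fun x => v x i) =ᵐ[volume.restrict Ω] 0 := fun i => by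
    -- On each element an `RT0` field has Jacobian `c I`, so its off-diagonal entry `∂_j v_i`
    -- vanishes; this is where `d ≥ 2` is needed.
    obtain ⟨j, hj⟩ : ∃ j : Fin d, j ≠ i := by
      have : Nontrivial (Fin d) := Fin.nontrivial_iff_two_le.2 hd
      exact exists_ne i
    obtain ⟨g, hg⟩ := (h1.1 i).exists_hasWeakGrad
    refine (h1.1 i).ae_eq_zero ho hb hg j (ae_domain_of_ae_cell (𝒯 := 𝒯) fun T hT => ?_)
    obtain ⟨a, c, hac⟩ := h2.2 T hT
    have hA : ∀ᵐ x ∂volume.restrict Ω, x ∈ cell T →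
        v x = (c • LinearMap.id : Vec d →ₗ[ℝ] Vec d) x + a := by
      filter_upwards [hac] with x hx hxT
      rw [hx hxT]
      simp [add_comm]
    have hae := (hg.mono ho.measurableSet (𝒯.cell_subset hΩ hT)).ae_eq IsSimplex.isOpen_cell
      (hasWeakGrad_cell hΩ hT hA i) (ae_eq_refl _)
    refine ae_domain_of_ae_restrict_cell ?_
    filter_upwards [hae] with x hx
    rw [hx, rowVec_apply]
    simp [hj.symm]
  refine Lp.ext ?_
  filter_upwards [eventually_all.2 key, Lp.coeFn_zero (Vec d) 2 (volume.restrict Ω)] with x hx h0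
  rw [h0]
  ext i
  simpa using hx i

/-- A function in `V_h^1` whose gradient vanishes on each element is zero. -/
theorem eq_zero_of_weakGrad_eq_zero (hd : 0 < d) (hΩ : interior (closure Ω) = Ω) (ho : IsOpen Ω)
    (hb : Bornology.IsBounded Ω) {v : LTwoVec Ω} (h1 : v ∈ 𝒯.V1)
    (h2 : ∀ T ∈ 𝒯.elements, ∀ i,
      weakGrad (cell T) (fun x => v x i) =ᵐ[volume.restrict (cell T)] 0) : v = 0 := by
  have key : ∀ i, (fun x => v x i) =ᵐ[volume.restrict Ω] 0 := fun i => by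
    obtain ⟨g, hg⟩ := (h1.1 i).exists_hasWeakGrad
    refine (h1.1 i).ae_eq_zero ho hb hg ⟨0, hd⟩ (ae_domain_of_ae_cell (𝒯 := 𝒯) fun T hT => ?_)
    have hae := weakGrad_ae_eq IsSimplex.isOpen_cell
      (hg.mono ho.measurableSet (𝒯.cell_subset hΩ hT))
    refine ae_domain_of_ae_restrict_cell ?_
    filter_upwards [hae, h2 T hT i] with x hx hx'
    rw [← hx, hx']
    rfl
  refine Lp.ext ?_
  filter_upwards [eventually_all.2 key, Lp.coeFn_zero (Vec d) 2 (volume.restrict Ω)] with x hx h0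
  rw [h0]
  ext i
  simpa using hx i

theorem memLp_pwAffine (hb : Bornology.IsBounded Ω)
    (F : 𝒯.elements → (Vec d →ₗ[ℝ] Vec d) × Vec d) :
    MemLp (fun x => ∑ T, (cell T.1).indicator (fun y => (F T).1 y + (F T).2) x) 2
      (volume.restrict Ω) :=
  memLp_finsetSum _ fun T _ => (memLp_of_continuous (by
    have := (F T).1.continuous_of_finiteDimensional
    fun_prop) hb 2).indicator IsSimplex.measurableSet_cell

/-- The piecewise affine fields. -/
noncomputable def pwAffine (𝒯 : Triangulation Ω) (hb : Bornology.IsBounded Ω) :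
    (𝒯.elements → (Vec d →ₗ[ℝ] Vec d) × Vec d) →ₗ[ℝ] LTwoVec Ω where
  toFun := fun F => (memLp_pwAffine hb F).toLp _
  map_add' := fun F G => by
    rw [← MemLp.toLp_add]
    congr 1
    funext x
    simp only [Pi.add_apply, ← Finset.sum_add_distrib]
    refine Finset.sum_congr rfl fun T _ => ?_
    simp only [Set.indicator_apply]
    split_ifs
    · simp only [Prod.fst_add, Prod.snd_add, LinearMap.add_apply]
      abel
    · rw [add_zero]
  map_smul' := fun c F => by
    rw [RingHom.id_apply, ← MemLp.toLp_const_smul]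
    congr 1
    funext x
    simp only [Pi.smul_apply, Finset.smul_sum, Set.indicator_apply, smul_ite, smul_zero,
      Prod.smul_fst, Prod.smul_snd, LinearMap.smul_apply, smul_add]

/-- A function in `V_h` is determined by one affine map per element, so `V_h` lies in the range of
`pwAffine`, whose domain is finite-dimensional. -/
theorem finiteDimensional_Vh (hb : Bornology.IsBounded Ω) : FiniteDimensional ℝ 𝒯.Vh := by
  have hle : 𝒯.Vh ≤ LinearMap.range (𝒯.pwAffine hb) := fun v hv => by
    choose A b h using fun T : 𝒯.elements => exists_affine_of_mem_Vh hv T.2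
    refine ⟨fun T => (A T, b T), Lp.ext ?_⟩
    refine (MemLp.coeFn_toLp (memLp_pwAffine hb _)).trans (ae_domain_of_ae_cell (𝒯 := 𝒯) fun T hT => ?_)
    filter_upwards [h ⟨T, hT⟩] with x hx hxT
    rw [hx hxT, Finset.sum_eq_single_of_mem (⟨T, hT⟩ : 𝒯.elements) (Finset.mem_univ _),
      Set.indicator_of_mem hxT]
    intro S _ hS
    refine Set.indicator_of_notMem (fun hxS => hS ?_) _
    exact Subtype.ext (eq_of_mem_cell S.2 hT hxS (interior_subset hxT))
  exact Submodule.finiteDimensional_of_le hle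

/-- Since the sum is direct, the arbitrary choice in `rtPart` has only one candidate. Linearity of
`rtPart` then follows by exhibiting the obvious candidates. -/
theorem rtPart_eq (hd : 2 ≤ d) (hΩ : interior (closure Ω) = Ω) (ho : IsOpen Ω)
    (hb : Bornology.IsBounded Ω) {v w : LTwoVec Ω} (hw : w ∈ 𝒯.RT0) (hvw : v - w ∈ 𝒯.V1) :
    𝒯.rtPart v = w := by
  have hex : ∃ w ∈ 𝒯.RT0, v - w ∈ 𝒯.V1 := ⟨w, hw, hvw⟩
  rw [rtPart, dif_pos hex]
  obtain ⟨h1, h2⟩ := hex.choose_spec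
  refine sub_eq_zero.1 (eq_zero_of_mem_V1_of_mem_RT0 hd hΩ ho hb ?_ (Submodule.sub_mem _ h1 hw))
  have := Submodule.sub_mem _ hvw h2
  rwa [sub_sub_sub_cancel_left] at this

theorem rtPart_mem {v : LTwoVec Ω} (hv : v ∈ 𝒯.Vh) : 𝒯.rtPart v ∈ 𝒯.RT0 ∧ v - 𝒯.rtPart v ∈ 𝒯.V1 := by
  obtain ⟨y, hy, z, hz, rfl⟩ := Submodule.mem_sup.1 hv
  have hex : ∃ w ∈ 𝒯.RT0, y + z - w ∈ 𝒯.V1 := ⟨z, hz, by rwa [add_sub_cancel_right]⟩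
  rw [rtPart, dif_pos hex]
  exact hex.choose_spec

theorem rtPart_add (hd : 2 ≤ d) (hΩ : interior (closure Ω) = Ω) (ho : IsOpen Ω)
    (hb : Bornology.IsBounded Ω) {v w : LTwoVec Ω} (hv : v ∈ 𝒯.Vh) (hw : w ∈ 𝒯.Vh) :
    𝒯.rtPart (v + w) = 𝒯.rtPart v + 𝒯.rtPart w :=
  rtPart_eq hd hΩ ho hb (Submodule.add_mem _ (rtPart_mem hv).1 (rtPart_mem hw).1) (by
    rw [add_sub_add_comm]
    exact Submodule.add_mem _ (rtPart_mem hv).2 (rtPart_mem hw).2)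

theorem rtPart_smul (hd : 2 ≤ d) (hΩ : interior (closure Ω) = Ω) (ho : IsOpen Ω)
    (hb : Bornology.IsBounded Ω) (c : ℝ) {v : LTwoVec Ω} (hv : v ∈ 𝒯.Vh) :
    𝒯.rtPart (c • v) = c • 𝒯.rtPart v :=
  rtPart_eq hd hΩ ho hb (Submodule.smul_mem _ c (rtPart_mem hv).1) (by
    rw [← smul_sub]
    exact Submodule.smul_mem _ c (rtPart_mem hv).2)

theorem rtCoeff_spec (hd : 0 < d) (hΩ : interior (closure Ω) = Ω) (ho : IsOpen Ω)
    (hb : Bornology.IsBounded Ω) {v : LTwoVec Ω} (hv : v ∈ 𝒯.RT0) :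
    ∀ᵐ x ∂volume.restrict Ω, v x = ∑ e, 𝒯.rtCoeff v e • 𝒯.rtBasis e.1 x := by
  have hex := exists_rtCoeff hd hΩ ho hb hv
  rw [rtCoeff, dif_pos hex]
  exact hex.choose_spec

theorem rtCoeff_eq (hd : 0 < d) (hΩ : interior (closure Ω) = Ω) {v : LTwoVec Ω}
    {c : 𝒯.interiorFaces → ℝ}
    (hc : ∀ᵐ x ∂volume.restrict Ω, v x = ∑ e, c e • 𝒯.rtBasis e.1 x) : 𝒯.rtCoeff v = c := by
  have hex : ∃ c : 𝒯.interiorFaces → ℝ,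
    ∀ᵐ x ∂volume.restrict Ω, v x = ∑ e, c e • 𝒯.rtBasis e.1 x := ⟨c, hc⟩
  rw [rtCoeff, dif_pos hex]
  refine sub_eq_zero.1 (rtCoeff_unique hd hΩ ?_)
  filter_upwards [hex.choose_spec, hc] with x h1 h2
  simp only [Pi.sub_apply, sub_smul, Finset.sum_sub_distrib]
  rw [← h1, ← h2, sub_self]

theorem rtCoeff_add (hd : 0 < d) (hΩ : interior (closure Ω) = Ω) (ho : IsOpen Ω)
    (hb : Bornology.IsBounded Ω) {v w : LTwoVec Ω} (hv : v ∈ 𝒯.RT0) (hw : w ∈ 𝒯.RT0) :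
    𝒯.rtCoeff (v + w) = 𝒯.rtCoeff v + 𝒯.rtCoeff w := by
  refine rtCoeff_eq hd hΩ ?_
  filter_upwards [rtCoeff_spec hd hΩ ho hb hv, rtCoeff_spec hd hΩ ho hb hw,
    Lp.coeFn_add v w] with x h1 h2 h0
  simp only [h0, Pi.add_apply, add_smul, Finset.sum_add_distrib]
  rw [← h1, ← h2]

theorem rtCoeff_smul (hd : 0 < d) (hΩ : interior (closure Ω) = Ω) (ho : IsOpen Ω)
    (hb : Bornology.IsBounded Ω) (c : ℝ) {v : LTwoVec Ω} (hv : v ∈ 𝒯.RT0) :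
    𝒯.rtCoeff (c • v) = c • 𝒯.rtCoeff v := by
  refine rtCoeff_eq hd hΩ ?_
  filter_upwards [rtCoeff_spec hd hΩ ho hb hv, Lp.coeFn_smul c v] with x h1 h0
  simp only [h0, Pi.smul_apply, smul_assoc, ← Finset.smul_sum]
  rw [← h1]

end Triangulation

end DiscreteSpaces

/-! ### The forms `∇_h`, `𝒥` and `a_h` -/

section BilinearForms

open scoped Classical

variable {d : ℕ} {Ω : Set (Vec d)}

theorem ae_eq_zero_of_integral_inner_self_eq_zero {U : Set (Vec d)} {g : Vec d → Vec d}
    (hg : MemLp g 2 (volume.restrict U)) (h : ∫ x in U, inner ℝ (g x) (g x) = 0) :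
    g =ᵐ[volume.restrict U] 0 := by
  have h0 := (integral_eq_zero_iff_of_nonneg (fun x => real_inner_self_nonneg)
    (integrable_inner_of_memLp hg hg)).1 h
  filter_upwards [h0] with x hx
  exact inner_self_eq_zero.1 hx

theorem integral_inner_self_nonneg {U : Set (Vec d)} (g : Vec d → Vec d) :
    0 ≤ ∫ x in U, inner ℝ (g x) (g x) :=
  integral_nonneg fun _ => real_inner_self_nonneg

theorem hsize_pos {T : Finset (Vec d)} (hT : 1 < T.card) : 0 < hsize T := by
  obtain ⟨a, ha, b, hb, hab⟩ := Finset.one_lt_card.1 hT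
  exact (dist_pos.2 hab).trans_le (Metric.dist_le_diam_of_mem
    (IsSimplex.isCompact_convexHull.isBounded) (subset_convexHull ℝ _ ha)
    (subset_convexHull ℝ _ hb))

namespace Triangulation

variable {𝒯 : Triangulation Ω} {T : Finset (Vec d)}

theorem gradForm_comm (u v : LTwoVec Ω) : 𝒯.gradForm u v = 𝒯.gradForm v u := by
  simp only [gradForm, real_inner_comm]

theorem gradForm_add_left (hΩ : interior (closure Ω) = Ω) {u v w : LTwoVec Ω}
    (hu : u ∈ 𝒯.Vh) (hv : v ∈ 𝒯.Vh) (hw : w ∈ 𝒯.Vh) :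
    𝒯.gradForm (u + v) w = 𝒯.gradForm u w + 𝒯.gradForm v w := by
  simp only [gradForm, ← Finset.sum_add_distrib]
  refine Finset.sum_congr rfl fun T hT => Finset.sum_congr rfl fun i _ => ?_
  have h1 := exists_hasWeakGrad_cell hΩ hT hu i
  have h2 := exists_hasWeakGrad_cell hΩ hT hv i
  have h3 := exists_hasWeakGrad_cell hΩ hT hw i
  have h4 := weakGrad_ae_eq IsSimplex.isOpen_cell ((h1.add h2).congr
    (w' := fun x => (u + v : LTwoVec Ω) x i) (by
      filter_upwards [ae_restrict_of_ae_restrict_of_subset (𝒯.cell_subset hΩ hT)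
        (Lp.coeFn_add u v)] with x hx
      rw [hx]
      rfl))
  rw [← integral_add (integrable_inner_of_memLp h1.2.1 h3.2.1)
    (integrable_inner_of_memLp h2.2.1 h3.2.1)]
  refine integral_congr_ae ?_
  filter_upwards [h4] with x hx
  rw [hx, Pi.add_apply, inner_add_left]

theorem gradForm_smul_left (hΩ : interior (closure Ω) = Ω) (c : ℝ) {u v : LTwoVec Ω}
    (hu : u ∈ 𝒯.Vh) : 𝒯.gradForm (c • u) v = c * 𝒯.gradForm u v := by
  simp only [gradForm, Finset.mul_sum]
  refine Finset.sum_congr rfl fun T hT => Finset.sum_congr rfl fun i _ => ?_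
  have h1 := exists_hasWeakGrad_cell hΩ hT hu i
  have h4 := weakGrad_ae_eq IsSimplex.isOpen_cell ((h1.smul c).congr
    (w' := fun x => (c • u : LTwoVec Ω) x i) (by
      filter_upwards [ae_restrict_of_ae_restrict_of_subset (𝒯.cell_subset hΩ hT)
        (Lp.coeFn_smul c u)] with x hx
      simp [hx]))
  rw [← integral_const_mul]
  refine integral_congr_ae ?_
  filter_upwards [h4] with x hx
  rw [hx, Pi.smul_apply, real_inner_smul_left]

theorem gradForm_self_nonneg (u : LTwoVec Ω) : 0 ≤ 𝒯.gradForm u u :=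
  Finset.sum_nonneg fun _ _ => Finset.sum_nonneg fun _ _ => integral_inner_self_nonneg _

theorem weakGrad_ae_eq_zero_of_gradForm_self_eq_zero (hΩ : interior (closure Ω) = Ω)
    {u : LTwoVec Ω} (hu : u ∈ 𝒯.Vh) (h : 𝒯.gradForm u u = 0) (hT : T ∈ 𝒯.elements) (i : Fin d) :
    weakGrad (cell T) (fun x => u x i) =ᵐ[volume.restrict (cell T)] 0 := by
  have h1 := (Finset.sum_eq_zero_iff_of_nonneg fun _ _ => Finset.sum_nonneg fun _ _ =>
    integral_inner_self_nonneg _).1 h T hT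
  have h2 := (Finset.sum_eq_zero_iff_of_nonneg fun _ _ => integral_inner_self_nonneg _).1 h1 i
    (Finset.mem_univ i)
  exact ae_eq_zero_of_integral_inner_self_eq_zero (exists_hasWeakGrad_cell hΩ hT hu i).2.1 h2

theorem stabForm_comm (J : 𝒯.Stabilization) (u v : LTwoVec Ω) :
    𝒯.stabForm J u v = 𝒯.stabForm J v u := by
  cases J with
  | elementwise α hα => simp only [stabForm, real_inner_comm]
  | diagonal α hα =>
    simp only [stabForm]
    exact Finset.sum_congr rfl fun e _ => by ring

theorem memLp_cell (hΩ : interior (closure Ω) = Ω) (hT : T ∈ 𝒯.elements) (u : LTwoVec Ω) :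
    MemLp u 2 (volume.restrict (cell T)) :=
  (Lp.memLp u).mono_measure (Measure.restrict_mono (𝒯.cell_subset hΩ hT) le_rfl)

theorem stabForm_add_left (hd : 0 < d) (hΩ : interior (closure Ω) = Ω) (ho : IsOpen Ω)
    (hb : Bornology.IsBounded Ω) (J : 𝒯.Stabilization) {u v : LTwoVec Ω} (w : LTwoVec Ω)
    (hu : u ∈ 𝒯.RT0) (hv : v ∈ 𝒯.RT0) :
    𝒯.stabForm J (u + v) w = 𝒯.stabForm J u w + 𝒯.stabForm J v w := by
  cases J with
  | elementwise α hα =>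
    simp only [stabForm, ← Finset.sum_add_distrib, ← mul_add]
    refine Finset.sum_congr rfl fun T _ => ?_
    rw [← integral_add (integrable_inner_of_memLp (memLp_cell hΩ T.2 u) (memLp_cell hΩ T.2 w))
      (integrable_inner_of_memLp (memLp_cell hΩ T.2 v) (memLp_cell hΩ T.2 w))]
    congr 1
    refine integral_congr_ae ?_
    filter_upwards [ae_restrict_of_ae_restrict_of_subset (𝒯.cell_subset hΩ T.2)
      (Lp.coeFn_add u v)] with x hx
    rw [hx, Pi.add_apply, inner_add_left]
  | diagonal α hα =>
    simp only [stabForm, rtCoeff_add hd hΩ ho hb hu hv, ← Finset.sum_add_distrib, Pi.add_apply]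
    exact Finset.sum_congr rfl fun e _ => by ring

theorem stabForm_smul_left (hd : 0 < d) (hΩ : interior (closure Ω) = Ω) (ho : IsOpen Ω)
    (hb : Bornology.IsBounded Ω) (J : 𝒯.Stabilization) (c : ℝ) {u : LTwoVec Ω} (w : LTwoVec Ω)
    (hu : u ∈ 𝒯.RT0) : 𝒯.stabForm J (c • u) w = c * 𝒯.stabForm J u w := by
  cases J with
  | elementwise α hα =>
    simp only [stabForm, Finset.mul_sum]
    refine Finset.sum_congr rfl fun T _ => ?_
    rw [mul_left_comm c, ← integral_const_mul c]
    congr 1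
    refine integral_congr_ae ?_
    filter_upwards [ae_restrict_of_ae_restrict_of_subset (𝒯.cell_subset hΩ T.2)
      (Lp.coeFn_smul c u)] with x hx
    rw [hx, Pi.smul_apply, real_inner_smul_left]
  | diagonal α hα =>
    simp only [stabForm, rtCoeff_smul hd hΩ ho hb c hu, Finset.mul_sum, Pi.smul_apply, smul_eq_mul]
    exact Finset.sum_congr rfl fun e _ => by ring

/-- If `Φ_e` vanished, the combination with the single coefficient `1` at `e` would contradict
linear independence. -/
theorem integral_inner_rtBasis_pos (hd : 0 < d) (hΩ : interior (closure Ω) = Ω)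
    (hb : Bornology.IsBounded Ω) (e : 𝒯.interiorFaces) :
    0 < ∫ x in Ω, inner ℝ (𝒯.rtBasis e.1 x) (𝒯.rtBasis e.1 x) := by
  refine (integral_inner_self_nonneg _).lt_of_ne fun h => ?_
  obtain ⟨T, T', a, a', hadj⟩ := exists_adjacent e.2
  have h0 := ae_eq_zero_of_integral_inner_self_eq_zero (hadj.memLp_rtBasis hb) h.symm
  have h1 : (Pi.single e 1 : 𝒯.interiorFaces → ℝ) = 0 := rtCoeff_unique hd hΩ (by
    filter_upwards [h0] with x hx
    rw [Finset.sum_eq_single_of_mem e (Finset.mem_univ e)]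
    · rw [Pi.single_eq_same, hx, Pi.zero_apply, smul_zero]
    · intro e' _ hne
      rw [Pi.single_eq_of_ne hne, zero_smul])
  simpa using congrFun h1 e

theorem stabForm_self_nonneg (J : 𝒯.Stabilization) (u : LTwoVec Ω) : 0 ≤ 𝒯.stabForm J u u := by
  cases J with
  | elementwise α hα =>
    exact Finset.sum_nonneg fun T _ => mul_nonneg
      (mul_nonneg (hα T).le (inv_nonneg.2 (sq_nonneg _))) (integral_inner_self_nonneg _)
  | diagonal α hα =>
    refine Finset.sum_nonneg fun e _ => mul_nonneg ?_ (integral_inner_self_nonneg _)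
    rw [mul_assoc]
    exact mul_nonneg (mul_nonneg (hα e).le (inv_nonneg.2 (sq_nonneg _))) (mul_self_nonneg _)

/-- `𝒥⁰` is a weighted sum of squared `L²` norms over the elements; `𝒥ᴰ` is a positively weighted
sum of squares of the coefficients in a basis. -/
theorem eq_zero_of_stabForm_self_eq_zero (hd : 2 ≤ d) (hΩ : interior (closure Ω) = Ω)
    (ho : IsOpen Ω) (hb : Bornology.IsBounded Ω) (J : 𝒯.Stabilization) {u : LTwoVec Ω}
    (hu : u ∈ 𝒯.RT0) (h : 𝒯.stabForm J u u = 0) : u = 0 := by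
  have hd0 : 0 < d := by omega
  refine Lp.ext (EventuallyEq.trans ?_ (Lp.coeFn_zero (Vec d) 2 (volume.restrict Ω)).symm)
  cases J with
  | elementwise α hα =>
    refine ae_domain_of_ae_cell (𝒯 := 𝒯) fun T hT => ae_domain_of_ae_restrict_cell
      (ae_eq_zero_of_integral_inner_self_eq_zero (memLp_cell hΩ hT u) ?_)
    have h1 := (Finset.sum_eq_zero_iff_of_nonneg fun T _ => mul_nonneg
      (mul_nonneg (hα T).le (inv_nonneg.2 (sq_nonneg _))) (integral_inner_self_nonneg _)).1 h
      ⟨T, hT⟩ (Finset.mem_univ _)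
    have hs : 0 < hsize T := hsize_pos (by rw [𝒯.card_eq T hT]; omega)
    exact (mul_eq_zero.1 h1).resolve_left (mul_pos (hα _) (by positivity)).ne'
  | diagonal α hα =>
    have hc : ∀ e, 𝒯.rtCoeff u e = 0 := fun e => by
      have h1 := (Finset.sum_eq_zero_iff_of_nonneg fun e _ => by
        refine mul_nonneg ?_ (integral_inner_self_nonneg _)
        rw [mul_assoc]
        exact mul_nonneg (mul_nonneg (hα e).le (inv_nonneg.2 (sq_nonneg _)))
          (mul_self_nonneg _)).1 h e (Finset.mem_univ _)
      -- A face has `d ≥ 2` vertices, hence positive diameter; a one-point face would have `h_e = 0`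
      -- and a vanishing weight.
      have hs : 0 < hsize e.1 := hsize_pos (by rw [(𝒯.mem_interiorFaces.1 e.2).1]; omega)
      have h2 := (mul_eq_zero.1 h1).resolve_right (integral_inner_rtBasis_pos hd0 hΩ hb e).ne'
      rw [mul_assoc] at h2
      exact mul_self_eq_zero.1
        ((mul_eq_zero.1 h2).resolve_left (mul_pos (hα _) (by positivity)).ne')
    filter_upwards [rtCoeff_spec hd0 hΩ ho hb hu] with x hx
    rw [hx, Pi.zero_apply]
    exact Finset.sum_eq_zero fun e _ => by rw [hc, zero_smul]

theorem ah_comm (J : 𝒯.Stabilization) (u v : LTwoVec Ω) : 𝒯.ah J u v = 𝒯.ah J v u := by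
  rw [ah, ah, gradForm_comm, stabForm_comm]

theorem ah_add_left (hd : 2 ≤ d) (hΩ : interior (closure Ω) = Ω) (ho : IsOpen Ω)
    (hb : Bornology.IsBounded Ω) (J : 𝒯.Stabilization) {u v w : LTwoVec Ω}
    (hu : u ∈ 𝒯.Vh) (hv : v ∈ 𝒯.Vh) (hw : w ∈ 𝒯.Vh) :
    𝒯.ah J (u + v) w = 𝒯.ah J u w + 𝒯.ah J v w := by
  rw [ah, ah, ah, gradForm_add_left hΩ hu hv hw, rtPart_add hd hΩ ho hb hu hv,
    stabForm_add_left (by omega) hΩ ho hb J _ (rtPart_mem hu).1 (rtPart_mem hv).1]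
  ring

theorem ah_smul_left (hd : 2 ≤ d) (hΩ : interior (closure Ω) = Ω) (ho : IsOpen Ω)
    (hb : Bornology.IsBounded Ω) (J : 𝒯.Stabilization) (c : ℝ) {u : LTwoVec Ω} (w : LTwoVec Ω)
    (hu : u ∈ 𝒯.Vh) : 𝒯.ah J (c • u) w = c * 𝒯.ah J u w := by
  rw [ah, ah, gradForm_smul_left hΩ c hu, rtPart_smul hd hΩ ho hb c hu,
    stabForm_smul_left (by omega) hΩ ho hb J c _ (rtPart_mem hu).1, mul_add]

/-- The form `a_h` is positive definite on `V_h`. -/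
theorem eq_zero_of_ah_self_eq_zero (hd : 2 ≤ d) (hΩ : interior (closure Ω) = Ω) (ho : IsOpen Ω)
    (hb : Bornology.IsBounded Ω) (J : 𝒯.Stabilization) {u : LTwoVec Ω} (hu : u ∈ 𝒯.Vh)
    (h : 𝒯.ah J u u = 0) : u = 0 := by
  have h1 := gradForm_self_nonneg (𝒯 := 𝒯) u
  have h2 := stabForm_self_nonneg J (𝒯.rtPart u)
  rw [ah] at h
  have hR := eq_zero_of_stabForm_self_eq_zero hd hΩ ho hb J (rtPart_mem hu).1 (by linarith)
  have hV := (rtPart_mem hu).2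
  rw [hR, sub_zero] at hV
  exact eq_zero_of_weakGrad_eq_zero (by omega) hΩ ho hb hV fun T hT i =>
    weakGrad_ae_eq_zero_of_gradForm_self_eq_zero hΩ hu (by linarith) hT i

end Triangulation

end BilinearForms

/-! ### The form `b` and the pressure space -/

section Divergence

open scoped Classical

variable {d : ℕ} {Ω : Set (Vec d)}

/-- The weak divergence of a field in `H₀(div)` is square integrable. -/
theorem MemH0Div.memLp_weakDiv {v : Vec d → Vec d} (ho : IsOpen Ω) (h : MemH0Div Ω v) :
    MemLp (StokesFEM.weakDiv Ω v) 2 (volume.restrict Ω) :=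
  (h.weakDiv ho).1.2.1

theorem divForm_eq_inner {v : LTwoVec Ω} (ho : IsOpen Ω) (h : MemH0Div Ω v) (q : LTwo Ω) :
    divForm v q = inner ℝ ((h.memLp_weakDiv ho).toLp _) q := by
  rw [L2.inner_def, divForm]
  refine integral_congr_ae ?_
  filter_upwards [(h.memLp_weakDiv ho).coeFn_toLp] with x hx
  simp [hx, mul_comm]

theorem divForm_add_left (ho : IsOpen Ω) {u v : LTwoVec Ω} (hu : MemH0Div Ω u)
    (hv : MemH0Div Ω v) (q : LTwo Ω) : divForm (u + v) q = divForm u q + divForm v q := by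
  have h1 := (hu.weakDiv ho).1
  have h2 := (hv.weakDiv ho).1
  have h3 := weakDiv_ae_eq ho ((h1.add h2).congr (Lp.coeFn_add u v).symm)
  rw [divForm, divForm, divForm, ← integral_add (integrable_mul_of_memLp h1.2.1 (Lp.memLp q))
    (integrable_mul_of_memLp h2.2.1 (Lp.memLp q))]
  refine integral_congr_ae ?_
  filter_upwards [h3] with x hx
  rw [hx, Pi.add_apply, add_mul]

theorem divForm_smul_left (ho : IsOpen Ω) (c : ℝ) {u : LTwoVec Ω} (hu : MemH0Div Ω u)
    (q : LTwo Ω) : divForm (c • u) q = c * divForm u q := by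
  have h1 := (hu.weakDiv ho).1
  have h3 := weakDiv_ae_eq ho ((h1.smul c).congr (Lp.coeFn_smul c u).symm)
  rw [divForm, divForm, ← integral_const_mul]
  refine integral_congr_ae ?_
  filter_upwards [h3] with x hx
  rw [hx, Pi.smul_apply, smul_eq_mul, mul_assoc]

theorem divForm_add_right (ho : IsOpen Ω) {u : LTwoVec Ω} (hu : MemH0Div Ω u) (q r : LTwo Ω) :
    divForm u (q + r) = divForm u q + divForm u r := by
  simp only [divForm_eq_inner ho hu, inner_add_right]

theorem divForm_smul_right (ho : IsOpen Ω) (c : ℝ) {u : LTwoVec Ω} (hu : MemH0Div Ω u)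
    (q : LTwo Ω) : divForm u (c • q) = c * divForm u q := by
  simp only [divForm_eq_inner ho hu, real_inner_smul_right]

/-- Integration by parts for fields in `H₀(div)`. -/
theorem divForm_eq_neg_inner (ho : IsOpen Ω) {v : LTwoVec Ω} (hv : MemH0Div Ω v) {ψ : LTwo Ω}
    {gradψ : LTwoVec Ω} (hψ : HasWeakGrad Ω ψ gradψ) : divForm v ψ = -inner ℝ gradψ v := by
  obtain ⟨h1, h2⟩ := hv.weakDiv ho
  have h3 := h2 ψ gradψ hψ
  rw [integral_add (integrable_inner_of_memLp h1.1 hψ.2.1)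
    (integrable_mul_of_memLp h1.2.1 hψ.1)] at h3
  rw [real_inner_comm, L2.inner_def, divForm]
  linarith

namespace Triangulation

variable {𝒯 : Triangulation Ω} {T : Finset (Vec d)}

/-- The divergence of a field in `V_h` belongs to `W_h`. -/
theorem toLp_weakDiv_mem_Wh (hΩ : interior (closure Ω) = Ω) (ho : IsOpen Ω)
    (hb : Bornology.IsBounded Ω) {v : LTwoVec Ω} (hv : v ∈ 𝒯.Vh) :
    ((memH0Div_of_mem_Vh ho hv).memLp_weakDiv ho).toLp _ ∈ 𝒯.Wh := by
  have hm := (memH0Div_of_mem_Vh ho hv).memLp_weakDiv ho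
  have hfin := isFiniteMeasure_restrict hb
  obtain ⟨h1, h2⟩ := (memH0Div_of_mem_Vh ho hv).weakDiv ho
  refine ⟨?_, (Lp.memLp _).integrable (by norm_num), fun T hT => ?_⟩
  · rw [integral_congr_ae hm.coeFn_toLp]
    -- The zero normal trace, tested with the constant `1`, gives mean value zero.
    have h3 := hasWeakGrad_of_contDiff (χ := fun _ : Vec d => (1 : ℝ)) contDiff_const hb
    have h4 := h2 _ _ h3
    have h5 : gradient (fun _ : Vec d => (1 : ℝ)) = 0 := by funext x; simp [gradient]
    simpa [h5] using h4
  · obtain ⟨A, b, hAb⟩ := exists_affine_of_mem_Vh hv hT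
    have h3 := (h1.mono ho.measurableSet (𝒯.cell_subset hΩ hT)).ae_eq IsSimplex.isOpen_cell
      (hasWeakDiv_affine (isBounded_cell T) A b) (ae_cell_of_ae_domain hΩ hT hAb)
    refine ⟨∑ i, rowVec A i i, ?_⟩
    filter_upwards [hm.coeFn_toLp, ae_domain_of_ae_restrict_cell h3] with x hx hx' hxT
    rw [hx, hx' hxT]

/-- The projection is self-adjoint and fixes `∇·v`, which already lies in `W_h`. This inclusion is
what makes the scheme pressure-robust. -/
theorem divForm_Ph (hΩ : interior (closure Ω) = Ω) (ho : IsOpen Ω)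
    (hb : Bornology.IsBounded Ω) {v : LTwoVec Ω} (hv : v ∈ 𝒯.Vh) (r : LTwo Ω) :
    divForm v (𝒯.Ph r) = divForm v r := by
  rw [divForm_eq_inner ho (memH0Div_of_mem_Vh ho hv), divForm_eq_inner ho (memH0Div_of_mem_Vh ho hv),
    Ph, ← Submodule.inner_starProjection_left_eq_right,
    Submodule.starProjection_eq_self_iff.2 (toLp_weakDiv_mem_Wh hΩ ho hb hv)]

/-- Testing the divergence of a basis function with a piecewise constant function yields the jump
across the face. -/
theorem Adjacent.divForm_toLp_rtBasis {e T' : Finset (Vec d)} {a a' : Vec d}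
    (h : 𝒯.Adjacent e T T' a a') (hd : 0 < d) (hΩ : interior (closure Ω) = Ω) (ho : IsOpen Ω)
    (hb : Bornology.IsBounded Ω) {q : LTwo Ω} {c : Finset (Vec d) → ℝ} (hq : ∀ S ∈ 𝒯.elements,
      ∀ᵐ x ∂volume.restrict Ω, x ∈ cell S → q x = c S) :
    divForm ((h.memLp_rtBasis hb).toLp _) q = c T - c T' := by
  have hfin := isFiniteMeasure_restrict hb
  have h1 := weakDiv_ae_eq ho ((h.hasWeakDiv_rtBasis hd hΩ ho hb).congr
    (h.memLp_rtBasis hb).coeFn_toLp.symm)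
  have h2 : ∀ S ∈ 𝒯.elements, ∫ x in Ω, (cell S).indicator
      (fun _ => (volume.real (cell S))⁻¹ * c S) x = c S := fun S hS => by
    rw [integral_indicator_const _ IsSimplex.measurableSet_cell,
      measureReal_restrict_apply IsSimplex.measurableSet_cell,
      Set.inter_eq_left.2 (𝒯.cell_subset hΩ hS), smul_eq_mul,
      mul_inv_cancel_left₀ (𝒯.isSimplex hS).volume_real_cell_pos.ne']
  have h3 : ∀ S : Finset (Vec d), Integrable ((cell S).indicator
      (fun _ => (volume.real (cell S))⁻¹ * c S)) (volume.restrict Ω) := fun S =>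
    (integrable_const _).indicator IsSimplex.measurableSet_cell
  rw [divForm]
  conv_rhs => rw [← h2 T h.hT, ← h2 T' h.hT', ← integral_sub (h3 T) (h3 T')]
  refine integral_congr_ae ?_
  filter_upwards [h1, hq T h.hT, hq T' h.hT'] with x hx hxT hxT'
  rw [hx, rtDiv, sub_mul]
  congr 1
  · by_cases hc : x ∈ cell T
    · rw [Set.indicator_of_mem hc, Set.indicator_of_mem hc, hxT hc]
    · rw [Set.indicator_of_notMem hc, Set.indicator_of_notMem hc, zero_mul]
  · by_cases hc : x ∈ cell T'
    · rw [Set.indicator_of_mem hc, Set.indicator_of_mem hc, hxT' hc]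
    · rw [Set.indicator_of_notMem hc, Set.indicator_of_notMem hc, zero_mul]

/-- The divergence from `V_h` to `W_h` is onto, in dual form. -/
theorem eq_zero_of_divForm_eq_zero (hd : 0 < d) (hΩ : interior (closure Ω) = Ω) (ho : IsOpen Ω)
    (hconn : IsConnected Ω) (hb : Bornology.IsBounded Ω) {q : LTwo Ω} (hq : q ∈ 𝒯.Wh)
    (h : ∀ v ∈ 𝒯.Vh, divForm v q = 0) : q = 0 := by
  obtain ⟨h0, -, hpc⟩ := hq
  have hc : ∃ c : Finset (Vec d) → ℝ, ∀ T ∈ 𝒯.elements,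
      ∀ᵐ x ∂volume.restrict Ω, x ∈ cell T → q x = c T := by
    have : ∀ T : Finset (Vec d), ∃ c : ℝ, T ∈ 𝒯.elements →
        ∀ᵐ x ∂volume.restrict Ω, x ∈ cell T → q x = c := fun T => by
      by_cases hT : T ∈ 𝒯.elements
      · obtain ⟨c, hc⟩ := hpc T hT
        exact ⟨c, fun _ => hc⟩
      · exact ⟨0, fun hT' => absurd hT' hT⟩
    choose c hc using this
    exact ⟨c, hc⟩
  obtain ⟨c, hc⟩ := hc
  -- Distinct elements with `d` common vertices share an interior face, and testing with its basis
  -- function shows that `q` does not jump there.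
  have hjump : ∀ T ∈ 𝒯.elements, ∀ T' ∈ 𝒯.elements, d ≤ (T ∩ T').card → c T = c T' := by
    intro T hT T' hT' hcard
    by_cases hne : T = T'
    · rw [hne]
    obtain ⟨e, he, hecard⟩ := Finset.exists_subset_card_eq hcard
    have heT := he.trans Finset.inter_subset_left
    have heT' := he.trans Finset.inter_subset_right
    obtain ⟨S, S', a, a', hadj⟩ :=
      exists_adjacent (𝒯.mem_interiorFaces.2 ⟨hecard, T, hT, T', hT', hne, heT, heT'⟩)
    have h1 := hadj.divForm_toLp_rtBasis hd hΩ ho hb hc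
    rw [h _ (Submodule.mem_sup_right (hadj.toLp_mem_RT0 hd hΩ ho hb))] at h1
    have h2 : c S = c S' := by linarith
    rcases hadj.eq_or_eq T hT heT with rfl | rfl <;>
      rcases hadj.eq_or_eq T' hT' heT' with rfl | rfl
    · rfl
    · exact h2
    · exact h2.symm
    · rfl
  obtain ⟨κ, hκ⟩ : ∃ κ : ℝ, ∀ T ∈ 𝒯.elements, c T = κ := by
    by_cases hne : 𝒯.elements.Nonempty
    · obtain ⟨S, hS⟩ := hne
      exact ⟨c S, fun T hT => eq_of_eq_of_common_face hΩ ho hconn.isPreconnected hjump hT hS⟩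
    · exact ⟨0, fun T hT => absurd ⟨T, hT⟩ hne⟩
  have hqκ : ∀ᵐ x ∂volume.restrict Ω, q x = κ := ae_domain_of_ae_cell (𝒯 := 𝒯) fun T hT => by
    filter_upwards [hc T hT] with x hx hxT
    rw [hx hxT, hκ T hT]
  have hpos : volume.real Ω ≠ 0 := by
    rw [Ne, measureReal_eq_zero_iff hb.measure_lt_top.ne]
    exact (ho.measure_pos volume hconn.nonempty).ne'
  rw [integral_congr_ae hqκ, setIntegral_const, smul_eq_mul] at h0
  have hκ0 := (mul_eq_zero.1 h0).resolve_left hpos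
  refine Lp.ext ?_
  filter_upwards [hqκ, Lp.coeFn_zero ℝ 2 (volume.restrict Ω)] with x hx hx0
  rw [hx, hx0, hκ0, Pi.zero_apply]

end Triangulation

end Divergence

/-! ### Unique solvability and pressure-robustness -/

section DiscreteStokes

variable {d : ℕ} {Ω : Set (Vec d)} {𝒯 : Triangulation Ω}

/-- The bilinear form `ν a_h(u, v) - b(v, p) + b(u, q)` of the discrete Stokes problem. -/
noncomputable def stokesForm (hd : 2 ≤ d) (hΩ : interior (closure Ω) = Ω) (ho : IsOpen Ω)
    (hb : Bornology.IsBounded Ω) (J : 𝒯.Stabilization) (ν : ℝ) :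
    (𝒯.Vh × 𝒯.Wh) →ₗ[ℝ] (𝒯.Vh × 𝒯.Wh) →ₗ[ℝ] ℝ :=
  have h0 := fun u : 𝒯.Vh => Triangulation.memH0Div_of_mem_Vh ho u.2
  LinearMap.mk₂ ℝ (fun s t => ν * 𝒯.ah J s.1 t.1 - divForm (t.1 : LTwoVec Ω) (s.2 : LTwo Ω) +
      divForm (s.1 : LTwoVec Ω) (t.2 : LTwo Ω))
    (fun s s' t => by
      simp only [Prod.fst_add, Prod.snd_add, Submodule.coe_add]
      rw [Triangulation.ah_add_left hd hΩ ho hb J s.1.2 s'.1.2 t.1.2,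
        divForm_add_left ho (h0 _) (h0 _), divForm_add_right ho (h0 _)]
      ring)
    (fun c s t => by
      simp only [Prod.smul_fst, Prod.smul_snd, Submodule.coe_smul, smul_eq_mul]
      rw [Triangulation.ah_smul_left hd hΩ ho hb J c _ s.1.2,
        divForm_smul_left ho c (h0 _), divForm_smul_right ho c (h0 _)]
      ring)
    (fun s t t' => by
      simp only [Prod.fst_add, Prod.snd_add, Submodule.coe_add]
      rw [Triangulation.ah_comm, Triangulation.ah_add_left hd hΩ ho hb J t.1.2 t'.1.2 s.1.2,
        Triangulation.ah_comm J (t.1 : LTwoVec Ω), Triangulation.ah_comm J (t'.1 : LTwoVec Ω),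
        divForm_add_left ho (h0 _) (h0 _), divForm_add_right ho (h0 _)]
      ring)
    (fun c s t => by
      simp only [Prod.smul_fst, Prod.smul_snd, Submodule.coe_smul, smul_eq_mul]
      rw [Triangulation.ah_comm, Triangulation.ah_smul_left hd hΩ ho hb J c _ t.1.2,
        Triangulation.ah_comm J (t.1 : LTwoVec Ω),
        divForm_smul_left ho c (h0 _), divForm_smul_right ho c (h0 _)]
      ring)

theorem stokesForm_apply (hd : 2 ≤ d) (hΩ : interior (closure Ω) = Ω) (ho : IsOpen Ω)
    (hb : Bornology.IsBounded Ω) (J : 𝒯.Stabilization) (ν : ℝ) (s t : 𝒯.Vh × 𝒯.Wh) :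
    stokesForm hd hΩ ho hb J ν s t = ν * 𝒯.ah J s.1 t.1 -
      divForm (t.1 : LTwoVec Ω) (s.2 : LTwo Ω) + divForm (s.1 : LTwoVec Ω) (t.2 : LTwo Ω) :=
  rfl

/-- Testing with `s` itself cancels the two `b` terms and leaves `ν a_h(u, u) = 0`. Once `u = 0`,
testing with `(v, 0)` leaves `b(v, p) = 0` for all `v`. -/
theorem stokesForm_injective (hd : 2 ≤ d) (hΩ : interior (closure Ω) = Ω) (ho : IsOpen Ω)
    (hconn : IsConnected Ω) (hb : Bornology.IsBounded Ω) (J : 𝒯.Stabilization) {ν : ℝ}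
    (hν : 0 < ν) : Function.Injective (stokesForm hd hΩ ho hb J ν) := by
  refine (injective_iff_map_eq_zero _).2 fun s hs => ?_
  have h1 : ∀ t, stokesForm hd hΩ ho hb J ν s t = 0 := fun t => by rw [hs, LinearMap.zero_apply]
  have hu : s.1 = 0 := by
    have h2 := h1 s
    rw [stokesForm_apply, sub_add_cancel] at h2
    exact Subtype.ext (Triangulation.eq_zero_of_ah_self_eq_zero hd hΩ ho hb J s.1.2
      ((mul_eq_zero.1 h2).resolve_left hν.ne'))
  have hp : s.2 = 0 := by
    refine Subtype.ext (Triangulation.eq_zero_of_divForm_eq_zero (by omega) hΩ ho hconn hb s.2.2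
      fun v hv => ?_)
    have h2 := h1 (⟨v, hv⟩, 0)
    -- Writing zero as `0 • 0` lets homogeneity in the first argument evaluate the forms at zero.
    have h3 : s = ((0 : ℝ) • 0, s.2) := by rw [smul_zero, ← hu]
    rw [stokesForm_apply, h3] at h2
    simp only [Submodule.coe_smul] at h2
    rw [Triangulation.ah_smul_left hd hΩ ho hb J 0 _ (Submodule.coe_mem _),
      divForm_smul_left ho 0 (Triangulation.memH0Div_of_mem_Vh ho (Submodule.coe_mem _))] at h2
    linarith
  exact Prod.ext hu hp

/-- The form maps a finite-dimensional space to its dual, which has the same dimension, so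
injectivity implies surjectivity. -/
theorem stokesForm_bijective (hd : 2 ≤ d) (hΩ : interior (closure Ω) = Ω) (ho : IsOpen Ω)
    (hconn : IsConnected Ω) (hb : Bornology.IsBounded Ω) (J : 𝒯.Stabilization) {ν : ℝ}
    (hν : 0 < ν) : Function.Bijective (stokesForm hd hΩ ho hb J ν) := by
  have hinj := stokesForm_injective hd hΩ ho hconn hb J hν
  have := Triangulation.finiteDimensional_Vh (𝒯 := 𝒯) hb
  exact ⟨hinj, (LinearMap.injective_iff_surjective_of_finrank_eq_finrank
    (Subspace.dual_finrank_eq (K := ℝ) (V := 𝒯.Vh × 𝒯.Wh)).symm).1 hinj⟩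

/-- The load functional `(v, q) ↦ (f, v)`. -/
noncomputable def loadForm (𝒯 : Triangulation Ω) (f : LTwoVec Ω) : (𝒯.Vh × 𝒯.Wh) →ₗ[ℝ] ℝ :=
  (innerₗ (LTwoVec Ω) f).comp (𝒯.Vh.subtype.comp (LinearMap.fst ℝ 𝒯.Vh 𝒯.Wh))

/-- The two equations are added into one identity for all pairs `(v, q)`; setting `q = 0` or `v = 0`
recovers each of them. -/
theorem isDiscreteSolution_iff (hd : 2 ≤ d) (hΩ : interior (closure Ω) = Ω) (ho : IsOpen Ω)
    (hb : Bornology.IsBounded Ω) (J : 𝒯.Stabilization) (ν : ℝ) (f : LTwoVec Ω)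
    (s : 𝒯.Vh × 𝒯.Wh) : IsDiscreteSolution 𝒯 J ν f s.1 s.2 ↔
      stokesForm hd hΩ ho hb J ν s = loadForm 𝒯 f := by
  have h0 := fun u : 𝒯.Vh => Triangulation.memH0Div_of_mem_Vh ho u.2
  constructor
  · refine fun h => LinearMap.ext fun t => ?_
    rw [stokesForm_apply, h.momentum _ t.1.2, h.continuity _ t.2.2, add_zero]
    rfl
  · intro h
    refine ⟨s.1.2, s.2.2, fun v hv => ?_, fun q hq => ?_⟩
    · have h1 := LinearMap.congr_fun h (⟨v, hv⟩, (0 : ℝ) • 0)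
      rw [stokesForm_apply] at h1
      simp only [Submodule.coe_smul] at h1
      rw [divForm_smul_right ho 0 (h0 _), zero_mul, add_zero] at h1
      exact h1
    · have h1 := LinearMap.congr_fun h ((0 : ℝ) • 0, ⟨q, hq⟩)
      rw [stokesForm_apply] at h1
      simp only [Submodule.coe_smul] at h1
      rw [divForm_smul_left ho 0 (h0 _), Triangulation.ah_comm,
        Triangulation.ah_smul_left hd hΩ ho hb J 0 _ (Submodule.coe_mem _)] at h1
      simpa [loadForm] using h1

/-- The discrete Stokes problem is uniquely solvable. -/
theorem existsUnique_isDiscreteSolution (hd : 2 ≤ d) (hΩ : interior (closure Ω) = Ω)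
    (ho : IsOpen Ω) (hconn : IsConnected Ω) (hb : Bornology.IsBounded Ω) (J : 𝒯.Stabilization)
    {ν : ℝ} (hν : 0 < ν) (f : LTwoVec Ω) :
    ∃! s : LTwoVec Ω × LTwo Ω, IsDiscreteSolution 𝒯 J ν f s.1 s.2 := by
  obtain ⟨hinj, hsurj⟩ := stokesForm_bijective hd hΩ ho hconn hb J hν (𝒯 := 𝒯)
  obtain ⟨s, hs⟩ := hsurj (loadForm 𝒯 f)
  refine ⟨(s.1, s.2), (isDiscreteSolution_iff hd hΩ ho hb J ν f s).2 hs, ?_⟩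
  rintro ⟨u, p⟩ h
  have h1 := (isDiscreteSolution_iff hd hΩ ho hb J ν f (⟨u, h.mem_Vh⟩, ⟨p, h.mem_Wh⟩)).1 h
  rw [← hinj (h1.trans hs.symm)]

/-- A gradient in the force only changes the pressure. -/
theorem IsDiscreteSolution.add_gradient (hΩ : interior (closure Ω) = Ω) (ho : IsOpen Ω)
    (hb : Bornology.IsBounded Ω) {J : 𝒯.Stabilization} {ν : ℝ} {f u : LTwoVec Ω} {p : LTwo Ω}
    (h : IsDiscreteSolution 𝒯 J ν f u p) {ψ : LTwo Ω} {gradψ : LTwoVec Ω}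
    (hψ : HasWeakGrad Ω ψ gradψ) :
    IsDiscreteSolution 𝒯 J ν (f + gradψ) u (p + 𝒯.Ph ψ) where
  mem_Vh := h.mem_Vh
  mem_Wh := Submodule.add_mem _ h.mem_Wh (Submodule.starProjection_apply_mem _ _)
  momentum v hv := by
    have h0 := Triangulation.memH0Div_of_mem_Vh ho hv
    have h1 := h.momentum v hv
    -- The pressure increment contributes `-(∇·v, P_h ψ) = -(∇·v, ψ) = (∇ψ, v)`, exactly the
    -- additional load.
    rw [divForm_add_right ho h0, Triangulation.divForm_Ph hΩ ho hb hv,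
      divForm_eq_neg_inner ho h0 hψ, inner_add_left]
    linarith
  continuity := h.continuity

end DiscreteStokes

end StokesFEM

theorem mainTheorem3 {d : ℕ} (hd : d = 2 ∨ d = 3) {Ω : Set (StokesFEM.Vec d)}
    (hΩ_open : IsOpen Ω) (hΩ_conn : IsConnected Ω) (hΩ_bdd : Bornology.IsBounded Ω)
    (hΩ_lip : StokesFEM.HasLipschitzBoundary Ω) (𝒯 : StokesFEM.Triangulation Ω)
    (J : 𝒯.Stabilization) (ν : ℝ) (hν : 0 < ν) (f : StokesFEM.LTwoVec Ω)
    (ψ : StokesFEM.LTwo Ω) (gradψ : StokesFEM.LTwoVec Ω)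
    (hψ : StokesFEM.HasWeakGrad Ω ψ gradψ) :
    (∃! s : StokesFEM.LTwoVec Ω × StokesFEM.LTwo Ω,
      StokesFEM.IsDiscreteSolution 𝒯 J ν f s.1 s.2) ∧
    ∀ (u u' : StokesFEM.LTwoVec Ω) (p p' : StokesFEM.LTwo Ω),
      StokesFEM.IsDiscreteSolution 𝒯 J ν f u p →
        (StokesFEM.IsDiscreteSolution 𝒯 J ν (f + gradψ) u' p' ↔ u' = u ∧ p' = p + 𝒯.Ph ψ) := by
  have hd2 : 2 ≤ d := by omega
  have hΩ : interior (closure Ω) = Ω := hΩ_lip.interior_closure hΩ_open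
  have hex := fun f => StokesFEM.existsUnique_isDiscreteSolution (𝒯 := 𝒯) hd2 hΩ hΩ_open hΩ_conn
    hΩ_bdd J hν f
  refine ⟨hex f, fun u u' p p' h => ?_⟩
  -- The shifted pair solves the problem for `f + ∇ψ`; uniqueness for that load makes it the only
  -- solution.
  have h1 := h.add_gradient hΩ hΩ_open hΩ_bdd hψ
  constructor
  · intro h2
    have h3 := (hex (f + gradψ)).unique (y₁ := (u', p')) (y₂ := (u, p + 𝒯.Ph ψ)) h2 h1
    exact ⟨congrArg Prod.fst h3, congrArg Prod.snd h3⟩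
  · rintro ⟨rfl, rfl⟩
    exact h1
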